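/- Let $\lambda$ be a limit ordinal and let $\mathcal{E}_\lambda$ be the set of nontrivial (that is, different from the identity) elementary embeddings $j\colon (V_\lambda,\in)\to(V_\lambda,\in)$. For $j\in\mathcal{E}_\lambda$ and $A\subseteq V_\lambda$ put $j\cdot A=\bigcup_{\alpha<\lambda}j(A\cap V_\alpha)$. Every function from $V_\lambda$ to $V_\lambda$ is identified with its graph, a subset of $V_\lambda$; so $j\cdot k$ makes sense for $j,k\in\mathcal{E}_\lambda$. Let $m$ be a natural number. A formula of second-order set theory is $\Sigma^1_0$ (equivalently $\Pi^1_0$) if it has no second-order quantifiers; it is $\Sigma^1_{n+1}$ (respectively $\Pi^1_{n+1}$) if it is a $\Pi^1_n$ (respectively $\Sigma^1_n$) formula preceded by a block of existential (respectively universal) second-order quantifiers. An embedding $j\in\mathcal{E}_\lambda$ is $\Sigma^1_m$-elementary if for every $\Sigma^1_m$ formula $\varphi$, all $x_1,\dots,x_n\in V_\lambda$ and all $X_1,\dots,X_p\subseteq V_\lambda$, $$V_\lambda\models\varphi[x_1,\dots,x_n,X_1,\dots,X_p]\iff V_\lambda\models\varphi[j(x_1),\dots,j(x_n),j\cdot X_1,\dots,j\cdot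 X_p],$$ where second-order variables range over all subsets of $V_\lambda$. The right powers of $j\in\mathcal{E}_\lambda$ are $j^{(0)}=j$ and $j^{(n+1)}=j^{(n)}\cdot j^{(n)}$. The critical point $\operatorname{crit}(k)$ of $k\in\mathcal{E}_\lambda$ is the least ordinal $\kappa$ with $\kappa<k(\kappa)$. If $\langle k_n\mid n<\omega\rangle$ is a sequence in $\mathcal{E}_\lambda$ with $\liminf_n\operatorname{crit}(k_n)=\lambda$, its inverse limit $K=k_0\circ k_1\circ\cdots$ is the function on $V_\lambda$ given by $K(a)=(k_0\circ\cdots\circ k_n)(a)$, where $n$ is large enough that $k_i(a)=a$ for all $i>n$. The iterated range of $j\in\mathcal{E}_\lambda$ is $\operatorname{irng}(j)=\bigcup_{n<\omega}\operatorname{irng}_n(j)$, where $\operatorname{irng}_0(j)=\{j\cdot B\mid B\subseteq V_\lambda\}\cap\mathcal{E}_\lambda$ and $\operatorname{irng}_{n+1}(j)=\bigcup_{k\in\operatorname{irng}_n(j)}\operatorname{irng}_0(k)$. **Theorem.** Suppose $j\in\mathcal{E}_\lambda$ is $\Sigma^1_m$-elementary. Then there are $\Sigma^1_m$-elementary $k,\ell\in\mathcal{E}_\lambda$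 with disjoint iterated ranges: $\operatorname{irng}(k)\cap\operatorname{irng}(\ell)=\emptyset$. Namely, the right powers $j^{(n)}$ of $j$ are well-defined members of $\mathcal{E}_\lambda$ with $\liminf_n\operatorname{crit}(j^{(n)})=\lambda$, and the inverse limits $$k=j\circ j^{(1)}\circ j^{(2)}\circ\cdots\qquad\text{and}\qquad \ell=j^{(1)}\circ j^{(2)}\circ\cdots$$ are such embeddings. -/

import Mathlib

open FirstOrder
open scoped ZFSet

universe u

/-- The rank-initial segment `V_λ` of the universe of sets, as a type. -/
abbrev VRank (lam : Ordinal.{u}) : Type (u + 1) := {x : ZFSet.{u} // x ∈ V_ lam}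

/-- Relation symbols: the binary symbol `∈` and `p` unary predicate symbols, the latter
playing the role of free second-order variables. -/
inductive MemRel (p : ℕ) : ℕ → Type
  | mem : MemRel p 2
  | pred (i : Fin p) : MemRel p 1

/-- The language of set theory with `p` unary predicate symbols; `setLang 0` is `{∈}`. -/
def setLang (p : ℕ) : FirstOrder.Language.{0, 0} where
  Functions := fun _ => Empty
  Relations := MemRel p

/-- The structure `(V_λ, ∈, X₀, …, X_{p-1})`. -/
@[reducible] def rankStructure (lam : Ordinal.{u}) {p : ℕ} (X : Fin p → Set (VRank lam)) :
    (setLang p).Structure (VRank lam) where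
  funMap := fun f => nomatch f
  RelMap := fun {_} r =>
    match r with
    | .mem => fun v => (v 0).1 ∈ (v 1).1
    | .pred i => fun v => v 0 ∈ X i

/-- The structure `(V_λ, ∈)`. -/
instance instRankStructure (lam : Ordinal.{u}) : (setLang 0).Structure (VRank lam) :=
  rankStructure lam Fin.elim0

/-- Rank-to-rank embeddings: nontrivial elementary embeddings of `(V_λ, ∈)` into itself. -/
def RankEmb (lam : Ordinal.{u}) : Set (VRank lam → VRank lam) :=
  {j | (∃ e : VRank lam ↪ₑ[setLang 0] VRank lam, ⇑e = j) ∧ j ≠ id}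

/-- For `A ⊆ V_λ` and `α < λ`, the set `A ∩ V_α` as an element of `V_λ`. -/
noncomputable def truncSet {lam : Ordinal.{u}} (A : Set (VRank lam)) (α : Ordinal.{u})
    (hα : α < lam) : VRank lam :=
  ⟨ZFSet.sep (fun x => ∃ h : x ∈ V_ lam, (⟨x, h⟩ : VRank lam) ∈ A) (V_ α),
    ZFSet.mem_vonNeumann_of_subset (ZFSet.sep_subset ..) (ZFSet.vonNeumann_mem_of_lt hα)⟩

/-- The extension of `j` to subsets of `V_λ`: `j · A = ⋃_{α < λ} j (A ∩ V_α)`. -/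
def extendEmb {lam : Ordinal.{u}} (j : VRank lam → VRank lam) (A : Set (VRank lam)) :
    Set (VRank lam) :=
  {y | ∃ (α : Ordinal.{u}) (hα : α < lam), y.1 ∈ (j (truncSet A α hα)).1}

/-- A function `V_λ → V_λ` as a subset of `V_λ`, a set of Kuratowski pairs. -/
def graphEmb {lam : Ordinal.{u}} (j : VRank lam → VRank lam) : Set (VRank lam) :=
  {z | ∃ x : VRank lam, z.1 = ZFSet.pair x.1 (j x).1}

/-- Second-order formulas in prenex form with `n` free first-order variables and `p` free
second-order variables: a string of second-order quantifiers in front of a formula without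
second-order quantifiers. Under a quantifier, the bound variable has index `0`. -/
inductive SOFormula (n : ℕ) : ℕ → Type
  | fo {p : ℕ} (φ : (setLang p).Formula (Fin n)) : SOFormula n p
  | ex {p : ℕ} (φ : SOFormula n (p + 1)) : SOFormula n p
  | all {p : ℕ} (φ : SOFormula n (p + 1)) : SOFormula n p

/-- Satisfaction in `V_λ`, second-order variables ranging over all subsets of `V_λ`. -/
def SOFormula.Sat {lam : Ordinal.{u}} {n : ℕ} (x : Fin n → VRank lam) :
    {p : ℕ} → SOFormula n p → (Fin p → Set (VRank lam)) → Prop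
  | p, .fo φ, X => @FirstOrder.Language.Formula.Realize (setLang p) (VRank lam) (rankStructure lam X) _ φ x
  | _, .ex φ, X => ∃ Y : Set (VRank lam), φ.Sat x (Fin.cons Y X : Fin _ → Set (VRank lam))
  | _, .all φ, X => ∀ Y : Set (VRank lam), φ.Sat x (Fin.cons Y X : Fin _ → Set (VRank lam))

/-- `IsLevel true m φ` says that `φ` is `Σ¹_m`, and `IsLevel false m φ` that `φ` is `Π¹_m`:
a `Σ¹_{m+1}` formula is a block of existential second-order quantifiers followed by a
`Π¹_m` formula, and dually. -/
inductive SOFormula.IsLevel {n : ℕ} : Bool → ℕ → {p : ℕ} → SOFormula n p → Prop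
  | fo (b : Bool) {p : ℕ} (φ : (setLang p).Formula (Fin n)) : IsLevel b 0 (.fo φ)
  | switch {b : Bool} {m p : ℕ} {φ : SOFormula n p} (h : IsLevel b m φ) :
      IsLevel (!b) (m + 1) φ
  | ex {m p : ℕ} {φ : SOFormula n (p + 1)} (h : IsLevel true (m + 1) φ) :
      IsLevel true (m + 1) (.ex φ)
  | all {m p : ℕ} {φ : SOFormula n (p + 1)} (h : IsLevel false (m + 1) φ) :
      IsLevel false (m + 1) (.all φ)

/-- `j` preserves `Σ¹_m` formulas with parameters from `V_λ` and subsets of `V_λ`. -/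
def SigmaElementary {lam : Ordinal.{u}} (m : ℕ) (j : VRank lam → VRank lam) : Prop :=
  ∀ (n p : ℕ) (φ : SOFormula n p), φ.IsLevel true m →
    ∀ (x : Fin n → VRank lam) (X : Fin p → Set (VRank lam)),
      φ.Sat x X ↔ φ.Sat (fun i => j (x i)) (fun i => extendEmb j (X i))

/-- The critical point: the least ordinal `κ` with `κ < j κ`. -/
noncomputable def critPt {lam : Ordinal.{u}} (j : VRank lam → VRank lam) : Ordinal.{u} :=
  sInf {κ | ∃ h : κ.toZFSet ∈ V_ lam, κ.toZFSet ∈ (j ⟨κ.toZFSet, h⟩).1}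

/-- `r` is the sequence of right powers of `j`: `j⁽⁰⁾ = j` and `j⁽ⁿ⁺¹⁾ = j⁽ⁿ⁾ · j⁽ⁿ⁾`, where
the application `k · k` is the function whose graph is the image of the graph of `k` under the
extension of `k` to subsets of `V_λ`. -/
def IsRightPowers {lam : Ordinal.{u}} (j : VRank lam → VRank lam)
    (r : ℕ → VRank lam → VRank lam) : Prop :=
  r 0 = j ∧ ∀ n, graphEmb (r (n + 1)) = extendEmb (r n) (graphEmb (r n))

/-- The finite composition `k₀ ∘ k₁ ∘ ⋯ ∘ kₙ`. -/
def compUpTo {lam : Ordinal.{u}} (k : ℕ → VRank lam → VRank lam) : ℕ → VRank lam → VRank lam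
  | 0 => k 0
  | n + 1 => compUpTo k n ∘ k (n + 1)

/-- `K = k₀ ∘ k₁ ∘ ⋯` is the inverse limit of a sequence of rank-to-rank embeddings whose
critical points have limit inferior `λ`. -/
def IsInverseLimit {lam : Ordinal.{u}} (k : ℕ → VRank lam → VRank lam)
    (K : VRank lam → VRank lam) : Prop :=
  (∀ n, k n ∈ RankEmb lam) ∧
  Filter.liminf (fun n => critPt (k n)) Filter.atTop = lam ∧
  ∀ a, ∃ n, (∀ i, n < i → k i a = a) ∧ K a = compUpTo k n a

/-- `irng₀ j`: the rank-to-rank embeddings in the range of `j` as a map on subsets of `V_λ`. -/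
def irngZero {lam : Ordinal.{u}} (j : VRank lam → VRank lam) : Set (VRank lam → VRank lam) :=
  {k | k ∈ RankEmb lam ∧ ∃ B : Set (VRank lam), extendEmb j B = graphEmb k}

/-- `irngₙ j`. -/
def irngStep {lam : Ordinal.{u}} (j : VRank lam → VRank lam) : ℕ → Set (VRank lam → VRank lam)
  | 0 => irngZero j
  | n + 1 => ⋃ k ∈ irngStep j n, irngZero k

/-- The iterated range of `j`. -/
def irng {lam : Ordinal.{u}} (j : VRank lam → VRank lam) : Set (VRank lam → VRank lam) :=
  ⋃ n, irngStep j n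

/-! Write $\kappa_n$ for the critical sequence of $j$. By Kunen's theorem (`Elem.exists_lt_critSeq`)
it is cofinal in $\lambda$, so $\lambda$ has cofinality $\omega$. Then elementarity of a map is a
first-order condition on its graph: it follows from the finite list `Good` (`Good.elem`), which even
gives preservation of first-order formulas with class parameters (`Good.iff`). Hence quantifying
over embeddings costs a single second-order quantifier, and $j\cdot k$ is again an embedding. By
induction $j^{(n)}$ has critical point $\kappa_n$ and moves $\kappa_m$ to $\kappa_{m+1}$ for $m\ge
n$ (`rightPowers_spec`), so both inverse limits exist.

Elementarity. It suffices that the limit reflects $\Sigma^1_m$ properties from images to preimages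
(`DownAll.up`). The core is `exists_reflecting_list`: if all factors $k_n$ reflect $\Sigma^1_{2a+1}$
properties, their inverse limit $K$ reflects $\Sigma^1_{2a+2}$ ones. Suppose $\exists Y\forall Z\,T$
holds at $K\cdot E$, with witness $Y$. Replace the factors one at a time by embeddings $l_n$ that
act in the same way on the relevant images of $E$ and have a prescribed class in their range; they
exist because $k_n$ itself witnesses the image of this statement under $k_n$, and $k_n$ reflects it.
The inverse limit $L$ of the $l_n$ agrees with $K$ on $E$, has $Y$ in its range and reflects $T$ by
induction. Applied to $j\circ\mathrm{id}\circ\mathrm{id}\circ\cdots$, this raises an odd level by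
one (`DownAll.succ`); therefore odd levels are closed under application (`DownAll.apply`) and pass
to all right powers.

Disjointness. Let $K=j^{(t)}\circ j^{(t+1)}\circ\cdots$. It sends $\kappa_{s+t}$ to
$\nu_s=\kappa_{2s+t+1}$, but everything of rank below $\kappa_{s+t}$ to rank below $\kappa_{2s+t}$,
so $\theta_s=\sup K[\kappa_{s+t}]\le\kappa_{2s+t}$. Since $\kappa_{s+t}$ is a critical point, a
function in the range of $K$ has at arguments in $V_{\theta_s}$ no value in $V_{\nu_s}\setminus
V_{\theta_s}$ (`Good.avoids`). An embedding in the range inherits this once its critical point is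
below $\theta_s$ (`Avoids.of_graph`). So for $h\in\operatorname{irng}(K)$ and all large $s$, no
$h(x)$ has rank in $[\kappa_{2s+t},\kappa_{2s+t+1})$. For $t=0$ and $t=1$ these are the even and the
odd gaps; a common member would omit all of them from some point on and have bounded range, which is
absurd. -/

set_option linter.unusedSectionVars false

/-! ### Jónsson functions -/

open Cardinal in
/-- A family of sets each of which is at least as large as the index type has an injective
choice function. -/
theorem exists_injective_choice {I X : Type u} (S : I → Set X) (h : ∀ i, #I ≤ #(S i)) :
    ∃ s : I → X, Function.Injective s ∧ ∀ i, s i ∈ S i := by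
  obtain ⟨r, hr, e⟩ := exists_ord_eq I
  -- Recursion along a well-order of least order type: before stage `i` fewer than `#I` values are
  -- used, so `S i` still has a free one.
  have pick : ∀ (i : I) (f : ∀ k, r k i → X), ∃ x, x ∈ S i ∧ ∀ k hk, f k hk ≠ x := by
    intro i f
    by_contra! hne
    have h1 : S i ⊆ Set.range fun k : {k | r k i} => f k.1 k.2 := fun x hx => by
      obtain ⟨k, hk, e⟩ := hne x hx
      exact ⟨⟨k, hk⟩, e⟩
    have h2 : #(S i) ≤ #{k | r k i} := (mk_le_mk_of_subset h1).trans mk_range_le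
    have h3 : #{k | r k i} < #I := by
      have := (Ordinal.typein_lt_type r i)
      rw [← e, lt_ord] at this
      exact this
    exact ((h i).trans h2).not_gt h3
  choose c hc1 hc2 using pick
  let s : I → X := hr.wf.fix c
  have hs : ∀ i, s i = c i fun k _ => s k := fun i => hr.wf.fix_eq c i
  have hne : ∀ i k, r k i → s k ≠ s i := fun i k hk => by
    rw [hs i]
    exact hc2 i (fun k _ => s k) k hk
  refine ⟨s, fun i k hik => ?_, fun i => by rw [hs i]; exact hc1 i _⟩
  rcases trichotomous_of r i k with h | h | h
  · exact absurd hik (hne k i h)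
  · exact h
  · exact absurd hik.symm (hne i k h)

open Cardinal in
/-- If `T` has as many `ω`-sequences as subsets, there is a function on `ω`-sequences of `T` all of
whose restrictions to the sequences in an injective image of `T` are surjective. -/
theorem exists_jonsson {T : Type u} [Infinite T] {e : Set T → ℕ → T} (he : Function.Injective e) :
    ∃ F : (ℕ → T) → T, ∀ g : T → T, Function.Injective g → ∀ y, ∃ t : ℕ → T, F (g ∘ t) = y := by
  have hT : ℵ₀ ≤ #T := aleph0_le_mk T
  have hS : #(Set T) ≤ #(ℕ → T) := mk_le_of_injective he
  -- There are at most $2^{|T|}$ pairs $(g,y)$, and each $g$ provides at least that many sequences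
  -- $g\circ t$. So distinct pairs can be given distinct sequences, and `F` reads $y$ off the
  -- sequence.
  have hI : #({g : T → T // Function.Injective g} × T) ≤ #(ℕ → T) := by
    refine le_trans ?_ hS
    have h1 : #{g : T → T // Function.Injective g} ≤ #(Set T) := by
      refine (mk_subtype_le _).trans ?_
      rw [← power_def, power_self_eq hT, mk_set]
    have h2 : #T ≤ #(Set T) := by
      rw [mk_set]; exact (cantor _).le
    have h3 : ℵ₀ ≤ #(Set T) := hT.trans h2
    calc #({g : T → T // Function.Injective g} × T) = _ * _ := by rw [mk_prod, lift_id, lift_id]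
      _ ≤ #(Set T) * #(Set T) := mul_le_mul' h1 h2
      _ = #(Set T) := mul_eq_self h3
  obtain ⟨s, hs, hs'⟩ := exists_injective_choice
    (fun i : {g : T → T // Function.Injective g} × T => Set.range fun t : ℕ → T => i.1.1 ∘ t)
    fun i => hI.trans (mk_range_eq _ (i.1.2.comp_left)).ge
  have : Nonempty ({g : T → T // Function.Injective g} × T) :=
    ⟨⟨id, Function.injective_id⟩, Classical.arbitrary T⟩
  refine ⟨fun x => (Function.invFun s x).2, fun g hg y => ?_⟩
  obtain ⟨t, ht⟩ := hs' ⟨⟨g, hg⟩, y⟩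
  refine ⟨t, ?_⟩
  change (Function.invFun s (g ∘ t)).2 = y
  rw [show g ∘ t = s ⟨⟨g, hg⟩, y⟩ from ht, Function.leftInverse_invFun hs]

/-! ### First-order definability over $V_\lambda$ -/

namespace VRank

variable {lam : Ordinal.{u}}

/-- Predicates in first-order variables `ι` and second-order variables `κ` that are definable over
`V_λ` without second-order quantifiers. -/
def FODef {ι κ : Type} (P : (ι → VRank lam) → (κ → Set (VRank lam)) → Prop) : Prop :=
  ∀ (p : ℕ) (g : κ → Fin p), ∃ φ : (setLang p).Formula ι,
    ∀ (X : Fin p → Set (VRank lam)) (x : ι → VRank lam),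
      @FirstOrder.Language.Formula.Realize (setLang p) (VRank lam) (rankStructure lam X) _ φ x ↔
        P x (fun k => X (g k))

namespace FODef

variable {ι κ : Type} {P Q : (ι → VRank lam) → (κ → Set (VRank lam)) → Prop}

theorem congr (h : FODef P) (e : ∀ x X, Q x X ↔ P x X) : FODef Q := fun p g => by
  obtain ⟨φ, hφ⟩ := h p g
  exact ⟨φ, fun X x => (hφ X x).trans (e _ _).symm⟩

theorem mem (i k : ι) : FODef (lam := lam) (κ := κ) fun x _ => (x i).1 ∈ (x k).1 := fun p _ =>
  ⟨Language.Relations.formula₂ (L := setLang p) (MemRel.mem : MemRel p 2) (.var i) (.var k),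
    fun X x => by
      let _ := rankStructure lam X
      exact Language.Formula.realize_rel₂⟩

theorem eq (i k : ι) : FODef (lam := lam) (κ := κ) fun x _ => x i = x k := fun p _ =>
  ⟨Language.Term.equal (.var i) (.var k), fun X x => by
    let _ := rankStructure lam X
    rw [Language.Formula.realize_equal]
    rfl⟩

theorem pred (k : κ) (i : ι) : FODef (lam := lam) fun x (X : κ → Set (VRank lam)) => x i ∈ X k :=
  fun p g => ⟨Language.Relations.formula₁ (L := setLang p) (MemRel.pred (g k) : MemRel p 1) (.var i),
    fun X x => by
      let _ := rankStructure lam X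
      exact Language.Formula.realize_rel₁⟩

theorem true' : FODef (lam := lam) (ι := ι) (κ := κ) fun _ _ => True := fun _ _ =>
  ⟨⊤, fun X _ => by
    let _ := rankStructure lam X
    simp [Language.Formula.Realize]⟩

theorem not (h : FODef P) : FODef fun x X => ¬ P x X := fun p g => by
  obtain ⟨φ, hφ⟩ := h p g
  refine ⟨φ.not, fun X x => ?_⟩
  let _ := rankStructure lam X
  rw [Language.Formula.realize_not, hφ X x]

theorem imp (h : FODef P) (h' : FODef Q) : FODef fun x X => P x X → Q x X := fun p g => by
  obtain ⟨φ, hφ⟩ := h p g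
  obtain ⟨ψ, hψ⟩ := h' p g
  refine ⟨φ.imp ψ, fun X x => ?_⟩
  let _ := rankStructure lam X
  rw [Language.Formula.realize_imp, hφ X x, hψ X x]

theorem and (h : FODef P) (h' : FODef Q) : FODef fun x X => P x X ∧ Q x X :=
  (h.imp h'.not).not.congr fun _ _ => by tauto

theorem or (h : FODef P) (h' : FODef Q) : FODef fun x X => P x X ∨ Q x X :=
  (h.not.imp h').congr fun _ _ => by tauto

theorem iff (h : FODef P) (h' : FODef Q) : FODef fun x X => P x X ↔ Q x X :=
  ((h.imp h').and (h'.imp h)).congr fun _ _ => by tauto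

theorem rename {ι' κ' : Type} (h : FODef P) (f : ι → ι') (g : κ → κ') :
    FODef fun x X => P (fun i => x (f i)) (fun k => X (g k)) := fun p g' => by
  obtain ⟨φ, hφ⟩ := h p (fun k => g' (g k))
  refine ⟨φ.relabel f, fun X x => ?_⟩
  let _ := rankStructure lam X
  rw [Language.Formula.realize_relabel, hφ X]
  rfl

/-- The bound variable is `none` and outer variables are shifted by `some`, so the chains of `some`
in later definability proofs are de Bruijn indices. -/
theorem ex {Q : (ι → VRank lam) → (κ → Set (VRank lam)) → VRank lam → Prop}
    (h : FODef fun (x : Option ι → VRank lam) X => Q (fun i => x (some i)) X (x none)) :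
    FODef fun x X => ∃ y, Q x X y := fun p g => by
  obtain ⟨φ, hφ⟩ := h p g
  refine ⟨(φ.relabel (β := ι ⊕ Unit) fun o => o.elim (Sum.inr ()) Sum.inl).iExs Unit,
    fun X x => ?_⟩
  let _ := rankStructure lam X
  rw [Language.Formula.realize_iExs]
  simp only [Language.Formula.realize_relabel, hφ X]
  exact ⟨fun ⟨i, hi⟩ => ⟨i (), hi⟩, fun ⟨y, hy⟩ => ⟨fun _ => y, hy⟩⟩

theorem all {Q : (ι → VRank lam) → (κ → Set (VRank lam)) → VRank lam → Prop}
    (h : FODef fun (x : Option ι → VRank lam) X => Q (fun i => x (some i)) X (x none)) :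
    FODef fun x X => ∀ y, Q x X y :=
  (ex (Q := fun x X y => ¬ Q x X y) h.not).not.congr fun _ _ => by simp

theorem forall_fin {q : ℕ} {R : Fin q → (ι → VRank lam) → (κ → Set (VRank lam)) → Prop}
    (h : ∀ i, FODef (R i)) : FODef fun x X => ∀ i, R i x X := by
  induction q with
  | zero => exact true'.congr fun _ _ => by simp
  | succ q ih =>
    exact ((h 0).and (ih fun i => h i.succ)).congr fun _ _ => by rw [Fin.forall_fin_succ]

end FODef

/-! ### Elementary maps and the sets available in $V_\lambda$ -/

/-- Maps of `V_λ` into itself that are elementary for `∈`. -/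
def Elem (j : VRank lam → VRank lam) : Prop :=
  ∃ e : VRank lam ↪ₑ[setLang 0] VRank lam, ⇑e = j

theorem Elem.iff {j : VRank lam → VRank lam} (hj : Elem j) {ι : Type}
    {P : (ι → VRank lam) → (Empty → Set (VRank lam)) → Prop} (h : FODef P) (x : ι → VRank lam) :
    P x nofun ↔ P (fun i => j (x i)) nofun := by
  obtain ⟨e, rfl⟩ := hj
  obtain ⟨φ, hφ⟩ := h 0 nofun
  have h1 := hφ Fin.elim0
  have h2 := e.map_formula φ x
  have h3 := h1 x
  have h4 := h1 (e ∘ x)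
  have e0 : ∀ f : Empty → Set (VRank lam), f = nofun := fun f => by funext k; exact k.elim
  rw [e0 (fun k => _)] at h3 h4
  exact h3.symm.trans (h2.symm.trans h4)

theorem Elem.iff₁ {j : VRank lam → VRank lam} (hj : Elem j) {R : VRank lam → Prop}
    (h : FODef (ι := Fin 1) (κ := Empty) fun x _ => R (x 0)) (a : VRank lam) :
    R a ↔ R (j a) := hj.iff h ![a]

theorem Elem.iff₂ {j : VRank lam → VRank lam} (hj : Elem j) {R : VRank lam → VRank lam → Prop}
    (h : FODef (ι := Fin 2) (κ := Empty) fun x _ => R (x 0) (x 1)) (a b : VRank lam) :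
    R a b ↔ R (j a) (j b) := hj.iff h ![a, b]

theorem Elem.iff₃ {j : VRank lam → VRank lam} (hj : Elem j)
    {R : VRank lam → VRank lam → VRank lam → Prop}
    (h : FODef (ι := Fin 3) (κ := Empty) fun x _ => R (x 0) (x 1) (x 2)) (a b c : VRank lam) :
    R a b c ↔ R (j a) (j b) (j c) := hj.iff h ![a, b, c]

/-- A map preserving all first-order definable relations is elementary. -/
theorem Elem.of_forall {j : VRank lam → VRank lam}
    (h : ∀ (n : ℕ) (φ : (setLang 0).Formula (Fin n)) (x : Fin n → VRank lam),
      φ.Realize (j ∘ x) ↔ φ.Realize x) : Elem j :=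
  ⟨⟨j, fun n φ x => h n φ x⟩, rfl⟩

theorem ext_mem {x y : VRank lam} (h : ∀ w : VRank lam, w.1 ∈ x.1 ↔ w.1 ∈ y.1) : x = y := by
  apply Subtype.ext
  ext w
  exact ⟨fun hw => (h ⟨w, ZFSet.isTransitive_vonNeumann lam _ x.2 hw⟩).1 hw,
    fun hw => (h ⟨w, ZFSet.isTransitive_vonNeumann lam _ y.2 hw⟩).2 hw⟩

theorem subset_iff {x y : VRank lam} : x.1 ⊆ y.1 ↔ ∀ w : VRank lam, w.1 ∈ x.1 → w.1 ∈ y.1 :=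
  ⟨fun h _ hw => h hw, fun h w hw => h ⟨w, ZFSet.isTransitive_vonNeumann lam _ x.2 hw⟩ hw⟩

theorem rank_lt (x : VRank lam) : x.1.rank < lam := ZFSet.mem_vonNeumann.1 x.2

/-- The subset of `b` cut out by a predicate. -/
noncomputable def sep (b : VRank lam) (p : VRank lam → Prop) : VRank lam :=
  ⟨ZFSet.sep (fun x => ∃ h : x ∈ V_ lam, p ⟨x, h⟩) b.1,
    ZFSet.mem_vonNeumann_of_subset (ZFSet.sep_subset ..) b.2⟩

@[simp]
theorem mem_sep {b : VRank lam} {p : VRank lam → Prop} {w : VRank lam} :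
    w.1 ∈ (sep b p).1 ↔ w.1 ∈ b.1 ∧ p w := by
  simp [sep]

/-- The level `V_α` as an element of `V_λ`. -/
noncomputable def lev (α : Ordinal.{u}) (h : α < lam) : VRank lam :=
  ⟨V_ α, ZFSet.vonNeumann_mem_of_lt h⟩

theorem mem_lev {α : Ordinal.{u}} {h : α < lam} {w : VRank lam} :
    w.1 ∈ (lev α h).1 ↔ w.1.rank < α := ZFSet.mem_vonNeumann

theorem lev_inj {α β : Ordinal.{u}} {h : α < lam} {h' : β < lam} :
    lev α h = lev β h' ↔ α = β := by
  simp [lev, Subtype.ext_iff]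

theorem exists_of_rank_lt {α : Ordinal.{u}} (hα : α < lam) (A : VRank lam → Prop)
    (h : ∀ x, A x → x.1.rank < α) : ∃ z : VRank lam, ∀ w : VRank lam, w.1 ∈ z.1 ↔ A w :=
  ⟨sep (lev α hα) A, fun w => by
    rw [mem_sep, mem_lev]
    exact ⟨fun h => h.2, fun hw => ⟨h w hw, hw⟩⟩⟩

variable [hl : Fact (Order.IsSuccLimit lam)]

theorem rank_pair_lt {α : Ordinal.{u}} (hα : Order.IsSuccLimit α) {x y : ZFSet.{u}}
    (hx : x.rank < α) (hy : y.rank < α) : (ZFSet.pair x y).rank < α := by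
  have h1 := hα.succ_lt hx
  have h2 := hα.succ_lt hy
  have h3 := hα.succ_lt h1
  have h4 := hα.succ_lt h2
  simp only [ZFSet.pair, ZFSet.rank_pair, ZFSet.rank_singleton]
  simp only [max_lt_iff, Order.IsSuccLimit.succ_lt_iff hα, hx, hy, and_self]

theorem rank_fst_lt_pair (x y : ZFSet.{u}) : x.rank < (ZFSet.pair x y).rank :=
  (ZFSet.rank_lt_of_mem (ZFSet.mem_singleton.2 rfl : x ∈ ({x} : ZFSet))).trans
    (ZFSet.rank_lt_of_mem (by simp [ZFSet.pair]))

theorem rank_snd_lt_pair (x y : ZFSet.{u}) : y.rank < (ZFSet.pair x y).rank :=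
  (ZFSet.rank_lt_of_mem (by simp : y ∈ ({x, y} : ZFSet))).trans
    (ZFSet.rank_lt_of_mem (by simp [ZFSet.pair]))

/-! ### Pairs, $\omega$ and the levels $V_\alpha$, with their definitions -/

/-- Kuratowski pairs in `V_λ`. -/
def pair (x y : VRank lam) : VRank lam :=
  ⟨ZFSet.pair x.1 y.1, ZFSet.mem_vonNeumann.2 (rank_pair_lt hl.out x.rank_lt y.rank_lt)⟩

@[simp]
theorem pair_inj {x y x' y' : VRank lam} : pair x y = pair x' y' ↔ x = x' ∧ y = y' := by
  rw [pair, pair, Subtype.mk_eq_mk, ZFSet.pair_inj, Subtype.ext_iff, Subtype.ext_iff]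

theorem exists_rank_bound (x y : VRank lam) :
    ∃ α < lam, Order.succ x.1.rank < α ∧ Order.succ y.1.rank < α :=
  ⟨Order.succ (max (Order.succ x.1.rank) (Order.succ y.1.rank)),
    hl.out.succ_lt (max_lt (hl.out.succ_lt x.rank_lt) (hl.out.succ_lt y.rank_lt)),
    Order.lt_succ_of_le (le_max_left _ _), Order.lt_succ_of_le (le_max_right _ _)⟩

theorem exists_sing (x : VRank lam) : ∃ z : VRank lam, ∀ w, w.1 ∈ z.1 ↔ w = x :=
  exists_of_rank_lt (hl.out.succ_lt x.rank_lt) (· = x) (by rintro _ rfl; exact Order.lt_succ _)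

theorem exists_union (x y : VRank lam) :
    ∃ z : VRank lam, ∀ w : VRank lam, w.1 ∈ z.1 ↔ w.1 ∈ x.1 ∨ w.1 ∈ y.1 := by
  obtain ⟨α, hα, h1, h2⟩ := exists_rank_bound x y
  refine exists_of_rank_lt hα _ fun w hw => ?_
  rcases hw with hw | hw
  · exact (ZFSet.rank_lt_of_mem hw).trans ((Order.lt_succ _).trans h1)
  · exact (ZFSet.rank_lt_of_mem hw).trans ((Order.lt_succ _).trans h2)

theorem exists_upair (x y : VRank lam) : ∃ z : VRank lam, ∀ w, w.1 ∈ z.1 ↔ w = x ∨ w = y := by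
  obtain ⟨a, ha⟩ := exists_sing x
  obtain ⟨b, hb⟩ := exists_sing y
  obtain ⟨z, hz⟩ := exists_union a b
  exact ⟨z, fun w => by rw [hz, ha, hb]⟩

theorem exists_pow (x : VRank lam) : ∃ z : VRank lam, ∀ w : VRank lam, w.1 ∈ z.1 ↔ w.1 ⊆ x.1 :=
  exists_of_rank_lt (hl.out.succ_lt x.rank_lt) (fun w => w.1 ⊆ x.1)
    fun _ hw => Order.lt_succ_of_le (ZFSet.rank_mono hw)

theorem exists_prod (x y : VRank lam) : ∃ z : VRank lam, ∀ w : VRank lam,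
    w.1 ∈ z.1 ↔ ∃ a b, a.1 ∈ x.1 ∧ b.1 ∈ y.1 ∧ w = pair a b := by
  obtain ⟨α, hα, h1, h2⟩ := exists_rank_bound x y
  refine exists_of_rank_lt (hl.out.succ_lt (hl.out.succ_lt hα)) _ ?_
  rintro w ⟨a, b, ha, hb, rfl⟩
  have ha' := (ZFSet.rank_lt_of_mem ha).trans ((Order.lt_succ _).trans h1)
  have hb' := (ZFSet.rank_lt_of_mem hb).trans ((Order.lt_succ _).trans h2)
  simp [pair, ZFSet.pair, ha', hb']

theorem mem_pair {x y w : VRank lam} : w.1 ∈ (pair x y).1 ↔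
    (∀ u : VRank lam, u.1 ∈ w.1 ↔ u = x) ∨ ∀ u : VRank lam, u.1 ∈ w.1 ↔ u = x ∨ u = y := by
  obtain ⟨a, ha⟩ := exists_sing x
  obtain ⟨b, hb⟩ := exists_upair x y
  have ha' : a.1 = {x.1} := by
    ext u
    rw [ZFSet.mem_singleton]
    constructor
    · intro hu
      exact congrArg Subtype.val ((ha ⟨u, ZFSet.isTransitive_vonNeumann lam _ a.2 hu⟩).1 hu)
    · rintro rfl; exact (ha x).2 rfl
  have hb' : b.1 = {x.1, y.1} := by
    ext u
    rw [ZFSet.mem_pair]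
    constructor
    · intro hu
      exact ((hb ⟨u, ZFSet.isTransitive_vonNeumann lam _ b.2 hu⟩).1 hu).imp
        (congrArg Subtype.val) (congrArg Subtype.val)
    · rintro (rfl | rfl)
      · exact (hb x).2 (Or.inl rfl)
      · exact (hb y).2 (Or.inr rfl)
  simp only [pair, ZFSet.pair, ZFSet.mem_pair, ← ha', ← hb', ← Subtype.ext_iff]
  constructor
  · rintro (rfl | rfl)
    · exact Or.inl ha
    · exact Or.inr hb
  · rintro (h | h)
    · exact Or.inl (ext_mem fun u => (h u).trans (ha u).symm)
    · exact Or.inr (ext_mem fun u => (h u).trans (hb u).symm)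

namespace FODef

variable {ι κ : Type}

theorem sub (i k : ι) : FODef (lam := lam) (κ := κ) fun x _ => (x i).1 ⊆ (x k).1 :=
  (all (Q := fun x _ w => w.1 ∈ (x i).1 → w.1 ∈ (x k).1)
    ((mem none (some i)).imp (mem none (some k)))).congr fun _ _ => subset_iff

theorem eqPair (i j k : ι) : FODef (lam := lam) (κ := κ) fun x _ => x i = pair (x j) (x k) := by
  have : FODef (lam := lam) (ι := ι) (κ := κ) fun x _ => ∀ w : VRank lam, w.1 ∈ (x i).1 ↔
      (∀ u : VRank lam, u.1 ∈ w.1 ↔ u = x j) ∨ ∀ u : VRank lam, u.1 ∈ w.1 ↔ u = x j ∨ u = x k :=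
    all ((mem none (some i)).iff ((all ((mem none (some none)).iff (eq none (some (some j))))).or
      (all ((mem none (some none)).iff ((eq none (some (some j))).or (eq none (some (some k))))))))
  refine this.congr fun x X => ?_
  constructor
  · intro h w; rw [h, mem_pair]
  · intro h; exact ext_mem fun w => (h w).trans mem_pair.symm

theorem pairMem (i j k : ι) :
    FODef (lam := lam) (κ := κ) fun x _ => (pair (x i) (x j)).1 ∈ (x k).1 :=
  (ex (Q := fun x _ w => w = pair (x i) (x j) ∧ w.1 ∈ (x k).1)
    ((eqPair none (some i) (some j)).and (mem none (some k)))).congr fun _ _ => by simp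

theorem pairPred (k : κ) (i j : ι) :
    FODef (lam := lam) fun x (X : κ → Set (VRank lam)) => pair (x i) (x j) ∈ X k :=
  (ex (Q := fun x X w => w = pair (x i) (x j) ∧ w ∈ X k)
    ((eqPair none (some i) (some j)).and (pred k none))).congr fun _ _ => by simp

theorem eqTriple (i j k m : ι) :
    FODef (lam := lam) (κ := κ) fun x _ => x i = pair (x j) (pair (x k) (x m)) :=
  (ex (Q := fun x _ w => w = pair (x k) (x m) ∧ x i = pair (x j) w)
    ((eqPair none (some k) (some m)).and (eqPair (some i) (some j) none))).congr
    fun _ _ => by simp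

end FODef

/-- `z` contains the empty set and is closed under successors. -/
def Inductive (z : VRank lam) : Prop :=
  (∃ e : VRank lam, e.1 ∈ z.1 ∧ ∀ u : VRank lam, ¬ u.1 ∈ e.1) ∧
    ∀ n : VRank lam, n.1 ∈ z.1 → ∃ m : VRank lam, m.1 ∈ z.1 ∧
      ∀ u : VRank lam, u.1 ∈ m.1 ↔ u.1 ∈ n.1 ∨ u = n

/-- `z` is the set of natural numbers, the least inductive set. -/
def IsOmega (z : VRank lam) : Prop :=
  Inductive z ∧ ∀ y : VRank lam, Inductive y → ∀ n : VRank lam, n.1 ∈ z.1 → n.1 ∈ y.1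

theorem FODef.inductive {ι κ : Type} (i : ι) :
    FODef (lam := lam) (κ := κ) fun x _ => Inductive (x i) :=
  (ex ((mem none (some i)).and (all (mem none (some none)).not))).and
    (all ((mem none (some i)).imp (ex ((mem none (some (some i))).and
      (all ((mem none (some none)).iff
        ((mem none (some (some none))).or (eq none (some (some none))))))))))

theorem FODef.isOmega {ι κ : Type} (i : ι) :
    FODef (lam := lam) (κ := κ) fun x _ => IsOmega (x i) :=
  (FODef.inductive i).and (all ((FODef.inductive none).imp
    (all ((mem none (some (some i))).imp (mem none (some none))))))

/-- The natural number `n` as an element of `V_λ`. -/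
noncomputable def nat (n : ℕ) : VRank lam :=
  ⟨(n : Ordinal.{u}).toZFSet, ZFSet.mem_vonNeumann.2 (by
    rw [Ordinal.rank_toZFSet]
    exact (Ordinal.natCast_lt_omega0 n).trans_le (Ordinal.omega0_le_of_isSuccLimit hl.out))⟩

theorem not_mem_nat_zero (u : VRank lam) : ¬ u.1 ∈ (nat 0 : VRank lam).1 := by
  simp [nat]

theorem mem_nat_succ (n : ℕ) (u : VRank lam) :
    u.1 ∈ (nat (n + 1) : VRank lam).1 ↔ u.1 ∈ (nat n : VRank lam).1 ∨ u = nat n := by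
  simp only [nat, Nat.cast_add, Nat.cast_one, Ordinal.toZFSet_add_one, ZFSet.mem_insert_iff,
    Subtype.ext_iff]
  tauto

theorem nat_injective : Function.Injective (nat : ℕ → VRank lam) := fun m n h => by
  have := Ordinal.toZFSet_injective (congrArg Subtype.val h)
  exact_mod_cast this

theorem nat_mem_of_inductive {z : VRank lam} (hz : Inductive z) (n : ℕ) :
    (nat n : VRank lam).1 ∈ z.1 := by
  induction n with
  | zero =>
    obtain ⟨e, he, h⟩ := hz.1
    rwa [show (nat 0 : VRank lam) = e from
      ext_mem fun u => iff_of_false (not_mem_nat_zero u) (h u)]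
  | succ n ih =>
    obtain ⟨m, hm, h⟩ := hz.2 _ ih
    rwa [show (nat (n + 1) : VRank lam) = m from
      ext_mem fun u => (mem_nat_succ n u).trans (h u).symm]

theorem exists_isOmega (h : Ordinal.omega0 < lam) : ∃ z : VRank lam, IsOmega z := by
  obtain ⟨z, hz⟩ := exists_of_rank_lt h (fun w => ∃ n, w = nat n) (by
    rintro _ ⟨n, rfl⟩
    simp [nat])
  refine ⟨z, ⟨⟨nat 0, (hz _).2 ⟨0, rfl⟩, not_mem_nat_zero⟩, fun n hn => ?_⟩, fun y hy n hn => ?_⟩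
  · obtain ⟨k, rfl⟩ := (hz n).1 hn
    exact ⟨nat (k + 1), (hz _).2 ⟨_, rfl⟩, mem_nat_succ k⟩
  · obtain ⟨k, rfl⟩ := (hz n).1 hn
    exact nat_mem_of_inductive hy k

theorem IsOmega.mem_iff {z : VRank lam} (hz : IsOmega z) (w : VRank lam) :
    w.1 ∈ z.1 ↔ ∃ n, w = nat n := by
  constructor
  · intro hw
    have : Inductive (sep z fun w => ∃ n, w = nat n) := by
      refine ⟨⟨nat 0, mem_sep.2 ⟨nat_mem_of_inductive hz.1 0, 0, rfl⟩, not_mem_nat_zero⟩,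
        fun n hn => ?_⟩
      obtain ⟨-, k, rfl⟩ := mem_sep.1 hn
      exact ⟨nat (k + 1), mem_sep.2 ⟨nat_mem_of_inductive hz.1 _, _, rfl⟩, mem_nat_succ k⟩
    exact (mem_sep.1 (hz.2 _ this w hw)).2
  · rintro ⟨n, rfl⟩
    exact nat_mem_of_inductive hz.1 n

theorem IsOmega.unique {z z' : VRank lam} (hz : IsOmega z) (hz' : IsOmega z') : z = z' :=
  ext_mem fun w => by rw [hz.mem_iff, hz'.mem_iff]

/-- `h` is a set of levels that contains every level below each of its members. -/
def History (h : VRank lam) : Prop :=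
  ∀ v : VRank lam, v.1 ∈ h.1 → ∀ x : VRank lam,
    x.1 ∈ v.1 ↔ ∃ w : VRank lam, (w.1 ∈ h.1 ∧ w.1 ∈ v.1) ∧ x.1 ⊆ w.1

/-- `z` is one of the levels `V_α`, expressed without ordinals. -/
def IsLev (z : VRank lam) : Prop :=
  ∃ h : VRank lam, History h ∧
    ∀ x : VRank lam, x.1 ∈ z.1 ↔ ∃ w : VRank lam, w.1 ∈ h.1 ∧ x.1 ⊆ w.1

theorem FODef.isLev {ι κ : Type} (i : ι) : FODef (lam := lam) (κ := κ) fun x _ => IsLev (x i) :=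
  ex (and
    (all ((mem none (some none)).imp (all ((mem none (some none)).iff
      (ex (((mem none (some (some (some none)))).and (mem none (some (some none)))).and
        (sub (some none) none)))))))
    (all ((mem none (some (some i))).iff (ex ((mem none (some (some none))).and
      (sub (some none) none))))))

/-- By $\in$-induction: if $y$ has rank below that of $x\in h$, some $z\in x$ has at least the rank
of $y$, and $z\subseteq w$ with $w\in h\cap x$. As $w$ is a level by induction, $y\subseteq w$, and
so $y\in x$. -/
theorem History.eq_lev {h : VRank lam} (hh : History h) (v : VRank lam) (hv : v.1 ∈ h.1) :
    v.1 = V_ v.1.rank := by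
  suffices ∀ x : ZFSet.{u}, ∀ hx : x ∈ V_ lam, x ∈ h.1 → x = V_ x.rank from this v.1 v.2 hv
  intro x
  induction x using ZFSet.inductionOn with
  | h x ih =>
  intro hx hxh
  refine le_antisymm (ZFSet.subset_vonNeumann_self x) fun y hy => ?_
  rw [ZFSet.mem_vonNeumann, ZFSet.lt_rank_iff] at hy
  obtain ⟨z, hz, hyz⟩ := hy
  obtain ⟨w, ⟨hwh, hwx⟩, hzw⟩ :=
    (hh ⟨x, hx⟩ hxh ⟨z, ZFSet.isTransitive_vonNeumann lam _ hx hz⟩).1 hz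
  have hw := ih w.1 hwx w.2 hwh
  have hyw : y ⊆ w.1 := by
    rw [hw, ZFSet.subset_vonNeumann]
    exact hyz.trans (ZFSet.rank_mono hzw)
  exact (hh ⟨x, hx⟩ hxh ⟨y, ZFSet.mem_vonNeumann_of_subset hyw w.2⟩).2 ⟨w, ⟨hwh, hwx⟩, hyw⟩

theorem isLev_iff {z : VRank lam} : IsLev z ↔ ∃ α, ∃ h : α < lam, z = lev α h := by
  constructor
  · rintro ⟨h, hh, hz⟩
    refine ⟨z.1.rank, z.rank_lt, Subtype.ext ?_⟩
    refine le_antisymm (ZFSet.subset_vonNeumann_self _) fun y hy => ?_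
    rw [lev, ZFSet.mem_vonNeumann, ZFSet.lt_rank_iff] at hy
    obtain ⟨x, hx, hyx⟩ := hy
    obtain ⟨w, hwh, hxw⟩ := (hz ⟨x, ZFSet.isTransitive_vonNeumann lam _ z.2 hx⟩).1 hx
    have hyw : y ⊆ w.1 := by
      rw [hh.eq_lev w hwh, ZFSet.subset_vonNeumann]
      exact hyx.trans (ZFSet.rank_mono hxw)
    exact (hz ⟨y, ZFSet.mem_vonNeumann_of_subset hyw w.2⟩).2 ⟨w, hwh, hyw⟩
  · rintro ⟨α, hα, rfl⟩
    -- The history of $V_\alpha$ is $\{V_\beta\mid\beta<\alpha\}$.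
    obtain ⟨h, hh⟩ := exists_of_rank_lt hα (fun w => ∃ β, ∃ h : β < lam, β < α ∧ w = lev β h) (by
      rintro _ ⟨β, h, hβ, rfl⟩
      simpa [lev] using hβ)
    have key : ∀ γ ≤ α, ∀ x : VRank lam, x.1.rank < γ ↔
        ∃ w : VRank lam, (w.1 ∈ h.1 ∧ w.1.rank < γ) ∧ x.1 ⊆ w.1 := by
      intro γ hγ x
      constructor
      · intro hx
        refine ⟨lev x.1.rank x.rank_lt, ⟨(hh _).2 ⟨_, _, hx.trans_le hγ, rfl⟩, ?_⟩, ?_⟩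
        · simpa [lev] using hx
        · exact ZFSet.subset_vonNeumann_self _
      · rintro ⟨w, ⟨-, hw⟩, hxw⟩
        exact (ZFSet.rank_mono hxw).trans_lt hw
    refine ⟨h, fun v hv x => ?_, fun x => ?_⟩
    · obtain ⟨β, hβ, hβα, rfl⟩ := (hh v).1 hv
      simp only [mem_lev]
      exact key β hβα.le x
    · rw [mem_lev, key α le_rfl]
      refine exists_congr fun w => ⟨fun h => ⟨h.1.1, h.2⟩, fun h' => ⟨⟨h'.1, ?_⟩, h'.2⟩⟩
      obtain ⟨β, hβ, hβα, rfl⟩ := (hh w).1 h'.1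
      simpa [lev] using hβα

/-! ### Action on levels and ordinals, critical points -/

section Elementary

variable {j : VRank lam → VRank lam}

theorem Elem.mem_iff (hj : Elem j) {x y : VRank lam} : (j x).1 ∈ (j y).1 ↔ x.1 ∈ y.1 :=
  (hj.iff₂ (R := fun x y => x.1 ∈ y.1) (FODef.mem 0 1) x y).symm

theorem Elem.injective (hj : Elem j) : Function.Injective j := fun x y h =>
  (hj.iff₂ (R := fun x y => x = y) (FODef.eq 0 1) x y).2 h

theorem Elem.map_pair (hj : Elem j) (x y : VRank lam) : j (pair x y) = pair (j x) (j y) :=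
  (hj.iff₃ (R := fun z x y => z = pair x y) (FODef.eqPair 0 1 2) (pair x y) x y).1 rfl

/-- The action of a map of `V_λ` on (indices of) levels. -/
noncomputable def ordMap (j : VRank lam → VRank lam) (α : Ordinal.{u}) : Ordinal.{u} :=
  open Classical in if h : α < lam then (j (lev α h)).1.rank else α

theorem ordMap_lt (j : VRank lam → VRank lam) {α : Ordinal.{u}} (h : α < lam) :
    ordMap j α < lam := by
  rw [ordMap, dif_pos h]
  exact rank_lt _

theorem Elem.map_lev (hj : Elem j) {α : Ordinal.{u}} (h : α < lam) :
    j (lev α h) = lev (ordMap j α) (ordMap_lt j h) := by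
  obtain ⟨β, hβ, e⟩ := isLev_iff.1 ((hj.iff₁ (R := IsLev) (FODef.isLev 0) (lev α h)).1
    (isLev_iff.2 ⟨α, h, rfl⟩))
  rw [e, lev_inj, ordMap, dif_pos h, e]
  simp [lev]

theorem ordMap_eq_of_map_lev {α β : Ordinal.{u}} (h : α < lam) (hβ : β < lam)
    (e : j (lev α h) = lev β hβ) : ordMap j α = β := by
  rw [ordMap, dif_pos h, e]
  simp [lev]

theorem Elem.ordMap_lt_iff (hj : Elem j) {α β : Ordinal.{u}} (hα : α < lam) (hβ : β < lam) :
    ordMap j α < ordMap j β ↔ α < β := by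
  have := hj.mem_iff (x := lev α hα) (y := lev β hβ)
  rw [hj.map_lev, hj.map_lev] at this
  simpa [lev] using this

theorem Elem.le_ordMap (hj : Elem j) {α : Ordinal.{u}} (hα : α < lam) : α ≤ ordMap j α := by
  induction α using WellFoundedLT.induction with
  | ind α ih =>
  by_contra! h
  have h1 := ih _ h (ordMap_lt j hα)
  have h2 := (hj.ordMap_lt_iff (ordMap_lt j hα) hα).2 h
  exact (h1.trans_lt h2).false

theorem Elem.ordMap_le_iff (hj : Elem j) {α β : Ordinal.{u}} (hα : α < lam) (hβ : β < lam) :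
    ordMap j α ≤ ordMap j β ↔ α ≤ β := by
  rw [← not_lt, hj.ordMap_lt_iff hβ hα, not_lt]

/-- The rank of $x$ is the index of the least level that includes $x$, which is a first-order
description. -/
theorem Elem.rank_map (hj : Elem j) (x : VRank lam) : (j x).1.rank = ordMap j x.1.rank := by
  have key : ∀ x z : VRank lam, (IsLev z ∧ x.1 ⊆ z.1 ∧ ∀ y : VRank lam, IsLev y → x.1 ⊆ y.1 → z.1 ⊆ y.1) ↔
      z = lev x.1.rank x.rank_lt := by
    intro x z
    constructor
    · rintro ⟨hz, hxz, hmin⟩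
      have h1 := hmin (lev x.1.rank x.rank_lt) (isLev_iff.2 ⟨_, _, rfl⟩)
        (ZFSet.subset_vonNeumann_self _)
      obtain ⟨α, hα, rfl⟩ := isLev_iff.1 hz
      rw [lev_inj]
      refine le_antisymm ?_ (ZFSet.subset_vonNeumann.1 hxz)
      simpa [lev] using h1
    · rintro rfl
      refine ⟨isLev_iff.2 ⟨_, _, rfl⟩, ZFSet.subset_vonNeumann_self _, fun y hy hxy => ?_⟩
      obtain ⟨α, hα, rfl⟩ := isLev_iff.1 hy
      have := ZFSet.subset_vonNeumann.1 hxy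
      simpa [lev] using this
  have h := (hj.iff₂ (R := fun x z : VRank lam => IsLev z ∧ x.1 ⊆ z.1 ∧
      ∀ y : VRank lam, IsLev y → x.1 ⊆ y.1 → z.1 ⊆ y.1)
    ((FODef.isLev 1).and ((FODef.sub 0 1).and (FODef.all ((FODef.isLev none).imp
      ((FODef.sub (some 0) none).imp (FODef.sub (some 1) none)))))) x (lev x.1.rank x.rank_lt)).1
    ((key _ _).2 rfl)
  rw [key, hj.map_lev, lev_inj] at h
  exact h.symm

theorem Elem.map_eq_self (hj : Elem j) {κ : Ordinal.{u}}
    (h : ∀ α < κ, α < lam → ordMap j α = α) (x : VRank lam) (hx : x.1.rank < κ) : j x = x := by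
  suffices ∀ α < κ, ∀ x : VRank lam, x.1.rank = α → j x = x from this _ hx x rfl
  intro α
  induction α using WellFoundedLT.induction with
  | ind α ih =>
  intro hα x hxα
  have hrank : (j x).1.rank = α := by rw [hj.rank_map, h _ (hxα ▸ hα) x.rank_lt, hxα]
  refine ext_mem fun w => ⟨fun hw => ?_, fun hw => ?_⟩
  · have hwr : w.1.rank < α := hrank ▸ ZFSet.rank_lt_of_mem hw
    rwa [← ih _ hwr (hwr.trans hα) w rfl, hj.mem_iff] at hw
  · have hwr : w.1.rank < α := hxα ▸ ZFSet.rank_lt_of_mem hw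
    rwa [← ih _ hwr (hwr.trans hα) w rfl, hj.mem_iff]

theorem Elem.ordMap_succ (hj : Elem j) {α : Ordinal.{u}} (hα : α < lam) :
    ordMap j (Order.succ α) = Order.succ (ordMap j α) := by
  have hp : ∀ {β : Ordinal.{u}} (hβ : β < lam) (w : VRank lam),
      w.1 ∈ (lev (Order.succ β) (hl.out.succ_lt hβ)).1 ↔ w.1 ⊆ (lev β hβ).1 := fun hβ w => by
    rw [mem_lev, Order.lt_succ_iff, lev, ZFSet.subset_vonNeumann]
  have h := (hj.iff₂ (R := fun z x : VRank lam => ∀ w : VRank lam, w.1 ∈ z.1 ↔ w.1 ⊆ x.1)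
    (FODef.all ((FODef.mem none (some 0)).iff (FODef.sub none (some 1)))) _ _).1 (hp hα)
  rw [hj.map_lev, hj.map_lev] at h
  have := (lev_inj (lam := lam)).1 (ext_mem fun w => (h w).trans (hp (ordMap_lt j hα) w).symm)
  exact this

theorem Elem.ordMap_natCast (hj : Elem j) (n : ℕ) : ordMap j n = n := by
  have hn : ∀ n : ℕ, (n : Ordinal.{u}) < lam := fun n =>
    (Ordinal.natCast_lt_omega0 n).trans_le (Ordinal.omega0_le_of_isSuccLimit hl.out)
  induction n with
  | zero =>
    have h := (hj.iff₁ (R := fun z : VRank lam => ∀ w : VRank lam, ¬ w.1 ∈ z.1)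
      (FODef.all (FODef.mem none (some 0)).not) (lev 0 (by exact_mod_cast hn 0))).1
      (fun w hw => by simp [mem_lev] at hw)
    rw [hj.map_lev] at h
    by_contra hne
    rw [Nat.cast_zero] at hne
    exact h (lev 0 (by exact_mod_cast hn 0)) (by
      rw [mem_lev]
      simpa [lev] using pos_iff_ne_zero.2 hne)
  | succ n ih => rw [Nat.cast_succ, ← Order.succ_eq_add_one, hj.ordMap_succ (hn n), ih]

/-- The ordinal $\alpha$ consists of the transitive sets of transitive sets in $V_\alpha$. So
`ordMap`, defined through levels, is also the action on von Neumann ordinals, which is what `critPt`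
refers to. -/
theorem Elem.map_ordinal (hj : Elem j) {α : Ordinal.{u}} (h : α.toZFSet ∈ V_ lam) :
    (j ⟨α.toZFSet, h⟩).1 = (ordMap j α).toZFSet := by
  have hα : α < lam := by simpa using ZFSet.mem_vonNeumann.1 h
  let IsOrd : VRank lam → Prop := fun w =>
    (∀ a : VRank lam, a.1 ∈ w.1 → a.1 ⊆ w.1) ∧
      ∀ a : VRank lam, a.1 ∈ w.1 → ∀ b : VRank lam, b.1 ∈ a.1 → b.1 ⊆ a.1
  have hIsOrd : ∀ w : VRank lam, IsOrd w ↔ w.1.IsOrdinal := by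
    intro w
    rw [ZFSet.isOrdinal_iff_forall_mem_isTransitive]
    refine and_congr ⟨fun h a ha => ?_, fun h a ha => h _ ha⟩ ⟨fun h a ha b hb => ?_,
      fun h a ha b hb => h _ ha _ hb⟩
    · exact h ⟨a, ZFSet.isTransitive_vonNeumann lam _ w.2 ha⟩ ha
    · have ha' := ZFSet.isTransitive_vonNeumann lam _ w.2 ha
      exact h ⟨a, ha'⟩ ha ⟨b, ZFSet.isTransitive_vonNeumann lam _ ha' hb⟩ hb
  have key : ∀ {β : Ordinal.{u}} (hβ : β < lam) (w : VRank lam),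
      w.1 ∈ β.toZFSet ↔ w.1 ∈ (lev β hβ).1 ∧ IsOrd w := by
    intro β hβ w
    rw [hIsOrd, mem_lev, Ordinal.mem_toZFSet_iff]
    constructor
    · rintro ⟨a, ha, e⟩
      rw [← e]
      exact ⟨by simpa using ha, ZFSet.isOrdinal_toZFSet a⟩
    · rintro ⟨hr, ho⟩
      exact ⟨_, hr, ho.toZFSet_rank_eq⟩
  have h2 := (hj.iff₂ (R := fun z v : VRank lam => ∀ w : VRank lam, w.1 ∈ z.1 ↔ w.1 ∈ v.1 ∧ IsOrd w)
    (FODef.all ((FODef.mem none (some 0)).iff ((FODef.mem none (some 1)).and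
      ((FODef.all ((FODef.mem none (some none)).imp (FODef.sub none (some none)))).and
        (FODef.all ((FODef.mem none (some none)).imp (FODef.all ((FODef.mem none (some none)).imp
          (FODef.sub none (some none)))))))))) ⟨α.toZFSet, h⟩ (lev α hα)).1 (fun w => key hα w)
  rw [hj.map_lev] at h2
  have h3 : (ordMap j α).toZFSet ∈ V_ lam := by
    rw [ZFSet.mem_vonNeumann, Ordinal.rank_toZFSet]; exact ordMap_lt j hα
  exact congrArg Subtype.val (ext_mem (x := j ⟨α.toZFSet, h⟩) (y := ⟨_, h3⟩)
    fun w => (h2 w).trans (key (ordMap_lt j hα) w).symm)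

theorem Elem.critPt_eq (hj : Elem j) : critPt j = sInf {κ | κ < lam ∧ κ < ordMap j κ} := by
  rw [critPt]
  congr 1
  ext κ
  constructor
  · rintro ⟨h, hκ⟩
    rw [hj.map_ordinal, Ordinal.toZFSet_mem_toZFSet_iff] at hκ
    exact ⟨by simpa using ZFSet.mem_vonNeumann.1 h, hκ⟩
  · rintro ⟨h, hκ⟩
    have h' : κ.toZFSet ∈ V_ lam := by rwa [ZFSet.mem_vonNeumann, Ordinal.rank_toZFSet]
    refine ⟨h', ?_⟩
    rwa [hj.map_ordinal, Ordinal.toZFSet_mem_toZFSet_iff]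

theorem Elem.critPt_eq_of (hj : Elem j) {κ : Ordinal.{u}} (hκ : κ < lam)
    (h : κ < ordMap j κ) (hmin : ∀ α < κ, ordMap j α = α) : critPt j = κ := by
  rw [hj.critPt_eq]
  refine le_antisymm (csInf_le' ⟨hκ, h⟩) (le_csInf ⟨κ, hκ, h⟩ ?_)
  rintro α ⟨-, hα⟩
  by_contra! hlt
  exact hα.ne' (hmin α hlt)

theorem Elem.critPt_spec (hj : Elem j) (hne : j ≠ id) :
    critPt j < lam ∧ critPt j < ordMap j (critPt j) ∧ ∀ α < critPt j, ordMap j α = α := by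
  have hnon : {κ | κ < lam ∧ κ < ordMap j κ}.Nonempty := by
    by_contra hemp
    refine hne (funext fun x => hj.map_eq_self (κ := lam) (fun α _ hα => ?_) x x.rank_lt)
    by_contra hα'
    exact hemp ⟨α, hα, (hj.le_ordMap hα).lt_of_ne (Ne.symm hα')⟩
  have h := csInf_mem hnon
  rw [← hj.critPt_eq] at h
  refine ⟨h.1, h.2, fun α hα => ?_⟩
  by_contra hne'
  have hα' := hα.trans h.1
  rw [hj.critPt_eq] at hα
  exact notMem_of_lt_csInf' hα ⟨hα', (hj.le_ordMap hα').lt_of_ne (Ne.symm hne')⟩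

theorem Elem.omega0_lt (hj : Elem j) (hne : j ≠ id) : Ordinal.omega0 < lam := by
  obtain ⟨h1, h2, -⟩ := hj.critPt_spec hne
  refine lt_of_le_of_lt ?_ h1
  by_contra! hlt
  obtain ⟨n, hn⟩ := Ordinal.lt_omega0.1 hlt
  rw [hn, hj.ordMap_natCast] at h2
  exact h2.false

end Elementary

/-! ### A finite axiomatisation of elementarity -/

/-- Elements of the result of one of finitely many set operations with arguments `x` and `y`. -/
def basicOp : Fin 9 → VRank lam → VRank lam → VRank lam → Prop :=
  ![fun x y w => w.1 ∈ x.1 ∨ w.1 ∈ y.1,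
    fun x y w => w.1 ∈ x.1 ∧ ¬ w.1 ∈ y.1,
    fun x _ w => w = x,
    fun x y w => ∃ a b, a.1 ∈ x.1 ∧ b.1 ∈ y.1 ∧ w = pair a b,
    fun x _ w => ∃ a, (pair a w).1 ∈ x.1,
    fun x y w => ∃ a b c, (pair a c).1 ∈ x.1 ∧ b.1 ∈ y.1 ∧ w = pair a (pair b c),
    fun x y w => ∃ a b c, (c.1 ∈ x.1 ∧ a.1 ∈ y.1 ∧ b.1 ∈ y.1 ∧ a.1 ∈ b.1) ∧
      w = pair a (pair b c),
    fun x y w => ∃ a b c, (c.1 ∈ x.1 ∧ a.1 ∈ y.1 ∧ b.1 ∈ y.1 ∧ b.1 ∈ a.1) ∧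
      w = pair a (pair b c),
    fun x y w => ∃ a b c, (c.1 ∈ x.1 ∧ a.1 ∈ y.1 ∧ b.1 ∈ y.1 ∧ a = b) ∧ w = pair a (pair b c)]

theorem FODef.basicOp {ι κ : Type} (n : Fin 9) (i j k : ι) :
    FODef (lam := lam) (κ := κ) fun x _ => VRank.basicOp n (x i) (x j) (x k) := by
  fin_cases n
  · exact (mem k i).or (mem k j)
  · exact (mem k i).and (mem k j).not
  · exact eq k i
  · exact ex (ex ((mem (some none) (some (some i))).and
      ((mem none (some (some j))).and (eqPair (some (some k)) (some none) none))))
  · exact ex (pairMem none (some k) (some i))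
  · exact ex (ex (ex ((pairMem (some (some none)) none (some (some (some i)))).and
      ((mem (some none) (some (some (some j)))).and
        (eqTriple (some (some (some k))) (some (some none)) (some none) none)))))
  · exact ex (ex (ex (((mem none (some (some (some i)))).and
      ((mem (some (some none)) (some (some (some j)))).and
        ((mem (some none) (some (some (some j)))).and (mem (some (some none)) (some none))))).and
      (eqTriple (some (some (some k))) (some (some none)) (some none) none))))
  · exact ex (ex (ex (((mem none (some (some (some i)))).and
      ((mem (some (some none)) (some (some (some j)))).and
        ((mem (some none) (some (some (some j)))).and (mem (some none) (some (some none)))))).and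
      (eqTriple (some (some (some k))) (some (some none)) (some none) none))))
  · exact ex (ex (ex (((mem none (some (some (some i)))).and
      ((mem (some (some none)) (some (some (some j)))).and
        ((mem (some none) (some (some (some j)))).and (eq (some (some none)) (some none))))).and
      (eqTriple (some (some (some k))) (some (some none)) (some none) none))))

/-- A finite list of first-order conditions on a map of `V_λ` which will turn out to imply
elementarity. -/
structure Good (l : VRank lam → VRank lam) : Prop where
  pres : ∀ (n : Fin 9) (x y z : VRank lam), (∀ w : VRank lam, w.1 ∈ z.1 ↔ basicOp n x y w) →
    ∀ w : VRank lam, w.1 ∈ (l z).1 ↔ basicOp n (l x) (l y) w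
  cofinal : ∀ y : VRank lam, ∃ x, y.1 ∈ (l x).1
  omega : ∀ z, IsOmega z → l z = z ∧ ∀ n : VRank lam, n.1 ∈ z.1 → l n = n

theorem mem_graphEmb {l : VRank lam → VRank lam} {z : VRank lam} :
    z ∈ graphEmb l ↔ ∃ x, z = pair x (l x) := by
  simp only [graphEmb, Set.mem_ofPred_eq, Subtype.ext_iff, pair]

@[simp]
theorem pair_mem_graphEmb {l : VRank lam → VRank lam} {x y : VRank lam} :
    pair x y ∈ graphEmb l ↔ y = l x := by
  rw [mem_graphEmb]
  constructor
  · rintro ⟨x', h⟩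
    rw [pair_inj] at h
    rw [h.1, h.2]
  · rintro rfl; exact ⟨x, rfl⟩

theorem Elem.good {j : VRank lam → VRank lam} (hj : Elem j) : Good j where
  pres n x y z h := (hj.iff₃ (R := fun x y z : VRank lam => ∀ w : VRank lam, w.1 ∈ z.1 ↔
    VRank.basicOp n x y w) (FODef.all ((FODef.mem none (some 2)).iff
      (FODef.basicOp n (some 0) (some 1) none))) x y z).1 h
  cofinal y := by
    refine ⟨lev (Order.succ y.1.rank) (hl.out.succ_lt y.rank_lt), ?_⟩
    rw [hj.map_lev, mem_lev]
    exact (Order.lt_succ _).trans_le (hj.le_ordMap (hl.out.succ_lt y.rank_lt))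
  omega z hz := by
    refine ⟨((hj.iff₁ (R := IsOmega) (FODef.isOmega 0) z).1 hz).unique hz, fun n hn => ?_⟩
    obtain ⟨k, rfl⟩ := (hz.mem_iff n).1 hn
    refine hj.map_eq_self (κ := Ordinal.omega0) (fun α hα _ => ?_) _ ?_
    · obtain ⟨m, rfl⟩ := Ordinal.lt_omega0.1 hα
      exact hj.ordMap_natCast m
    · simp [nat]

/-- Mentions only membership in the graph, so that a quantifier over embeddings becomes one over
subsets of $V_\lambda$ with a first-order matrix. -/
theorem exists_good_graph_iff {L : Set (VRank lam)} :
    (∃ l, Good l ∧ graphEmb l = L) ↔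
      (∀ w, w ∈ L → ∃ x y, w = pair x y) ∧
      (∀ x, ∃ y, pair x y ∈ L ∧ ∀ y', pair x y' ∈ L → y' = y) ∧
      (∀ (n : Fin 9) (x y z x' y' z' : VRank lam), pair x x' ∈ L → pair y y' ∈ L → pair z z' ∈ L →
        (∀ w : VRank lam, w.1 ∈ z.1 ↔ basicOp n x y w) →
          ∀ w : VRank lam, w.1 ∈ z'.1 ↔ basicOp n x' y' w) ∧
      (∀ y : VRank lam, ∃ x x' : VRank lam, pair x x' ∈ L ∧ y.1 ∈ x'.1) ∧
      (∀ z, IsOmega z → pair z z ∈ L ∧ ∀ n : VRank lam, n.1 ∈ z.1 → pair n n ∈ L) := by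
  constructor
  · rintro ⟨l, hl', rfl⟩
    refine ⟨fun w hw => ?_, fun x => ⟨l x, by simp, by simp⟩, ?_, fun y => ?_, fun z hz => ?_⟩
    · obtain ⟨x, hx⟩ := mem_graphEmb.1 hw
      exact ⟨x, _, hx⟩
    · intro n x y z x' y' z' hx hy hz
      rw [pair_mem_graphEmb] at hx hy hz
      subst hx hy hz
      exact hl'.pres n x y z
    · obtain ⟨x, hx⟩ := hl'.cofinal y
      exact ⟨x, l x, by simpa using hx⟩
    · simp only [pair_mem_graphEmb]
      exact ⟨(hl'.omega z hz).1.symm, fun n hn => ((hl'.omega z hz).2 n hn).symm⟩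
  · rintro ⟨h1, h2, h3, h4, h5⟩
    choose l hl1 hl2 using h2
    have e : graphEmb l = L := by
      ext w
      rw [mem_graphEmb]
      constructor
      · rintro ⟨x, rfl⟩; exact hl1 x
      · intro hw
        obtain ⟨x, y, rfl⟩ := h1 w hw
        exact ⟨x, by rw [hl2 x y hw]⟩
    refine ⟨l, ⟨fun n x y z => h3 n x y z _ _ _ (hl1 x) (hl1 y) (hl1 z), fun y => ?_,
      fun z hz => ?_⟩, e⟩
    · obtain ⟨x, x', hx, hy⟩ := h4 y
      rw [hl2 x x' hx] at hy
      exact ⟨x, hy⟩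
    · obtain ⟨ha, hb⟩ := h5 z hz
      exact ⟨(hl2 _ _ ha).symm, fun n hn => (hl2 _ _ (hb n hn)).symm⟩

theorem FODef.goodGraph {ι κ : Type} (k : κ) :
    FODef (lam := lam) (ι := ι) fun _ X => ∃ l, Good l ∧ graphEmb l = X k := by
  refine FODef.congr ?_ fun _ _ => exists_good_graph_iff
  refine and ?_ (and ?_ (and ?_ (and ?_ ?_)))
  · exact all ((pred k none).imp (ex (ex (eqPair (some (some none)) (some none) none))))
  · exact all (ex ((pairPred k (some none) none).and
      (all ((pairPred k (some (some none)) none).imp (eq none (some none))))))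
  · refine forall_fin fun n => all (all (all (all (all (all ?_)))))
    exact (pairPred k (some (some (some (some (some none))))) (some (some none))).imp
      ((pairPred k (some (some (some (some none)))) (some none)).imp
      ((pairPred k (some (some (some none))) none).imp
      ((all ((mem none (some (some (some (some none))))).iff
        (FODef.basicOp n (some (some (some (some (some (some none))))))
          (some (some (some (some (some none))))) none))).imp
      (all ((mem none (some none)).iff
        (FODef.basicOp n (some (some (some none))) (some (some none)) none))))))
  · exact all (ex (ex ((pairPred k (some none) none).and (mem (some (some none)) none))))
  · exact all ((FODef.isOmega none).imp ((pairPred k none none).and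
      (all ((mem none (some none)).imp (pairPred k none none)))))

theorem exists_lev_superset (z : VRank lam) :
    ∃ y : VRank lam, ∀ w : VRank lam, w.1.rank ≤ z.1.rank → w.1 ∈ y.1 :=
  ⟨lev _ (hl.out.succ_lt z.rank_lt), fun w hw => by rw [mem_lev]; exact Order.lt_succ_of_le hw⟩

theorem rank_lt_of_pair_mem {a b z : VRank lam} (h : (pair a b).1 ∈ z.1) :
    a.1.rank < z.1.rank ∧ b.1.rank < z.1.rank :=
  ⟨(rank_fst_lt_pair _ _).trans (ZFSet.rank_lt_of_mem h),
    (rank_snd_lt_pair _ _).trans (ZFSet.rank_lt_of_mem h)⟩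

theorem rank_lt_pair (a b : VRank lam) :
    a.1.rank < (pair a b).1.rank ∧ b.1.rank < (pair a b).1.rank :=
  ⟨rank_fst_lt_pair _ _, rank_snd_lt_pair _ _⟩

theorem exists_basicOp (n : Fin 9) (x y : VRank lam) :
    ∃ z : VRank lam, ∀ w : VRank lam, w.1 ∈ z.1 ↔ basicOp n x y w := by
  have triple : ∀ R : VRank lam → VRank lam → VRank lam → Prop,
      (∀ a b c, R a b c → (a.1.rank < x.1.rank ∨ a.1.rank < y.1.rank) ∧
        (b.1.rank < x.1.rank ∨ b.1.rank < y.1.rank) ∧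
        (c.1.rank < x.1.rank ∨ c.1.rank < y.1.rank)) →
      ∃ z : VRank lam, ∀ w : VRank lam, w.1 ∈ z.1 ↔ ∃ a b c, R a b c ∧ w = pair a (pair b c) := by
    intro R hR
    obtain ⟨α, hα, h1, h2⟩ := exists_rank_bound x y
    have hs : ∀ a : VRank lam, (a.1.rank < x.1.rank ∨ a.1.rank < y.1.rank) →
        a.1 ∈ (lev α hα).1 := fun a ha => by
      rw [mem_lev]
      rcases ha with ha | ha
      · exact ha.trans ((Order.lt_succ _).trans h1)
      · exact ha.trans ((Order.lt_succ _).trans h2)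
    obtain ⟨p, hp⟩ := exists_prod (lev α hα) (lev α hα)
    obtain ⟨q, hq⟩ := exists_prod (lev α hα) p
    refine ⟨sep q fun w => ∃ a b c, R a b c ∧ w = pair a (pair b c), fun w => ?_⟩
    rw [mem_sep, and_iff_right_iff_imp]
    rintro ⟨a, b, c, h, rfl⟩
    obtain ⟨ha, hb, hc⟩ := hR a b c h
    exact (hq _).2 ⟨a, _, hs a ha, (hp _).2 ⟨b, c, hs b hb, hs c hc, rfl⟩, rfl⟩
  fin_cases n
  · exact exists_union x y
  · exact ⟨sep x fun w => ¬ w.1 ∈ y.1, fun w => mem_sep⟩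
  · exact exists_sing x
  · exact exists_prod x y
  · exact exists_of_rank_lt x.rank_lt _ fun w ⟨a, h⟩ => (rank_lt_of_pair_mem h).2
  · obtain ⟨z, hz⟩ := triple (fun a b c => (pair a c).1 ∈ x.1 ∧ b.1 ∈ y.1) fun a b c h =>
      ⟨.inl (rank_lt_of_pair_mem h.1).1, .inr (ZFSet.rank_lt_of_mem h.2),
        .inl (rank_lt_of_pair_mem h.1).2⟩
    exact ⟨z, fun w => (hz w).trans (by simp only [and_assoc]; rfl)⟩
  all_goals exact triple _ fun a b c h => ⟨.inr (ZFSet.rank_lt_of_mem h.2.1),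
      .inr (ZFSet.rank_lt_of_mem h.2.2.1), .inl (ZFSet.rank_lt_of_mem h.1)⟩

namespace Good

variable {l : VRank lam → VRank lam} (g : Good l)

include g

theorem map_subset {x y : VRank lam} (h : x.1 ⊆ y.1) : (l x).1 ⊆ (l y).1 := by
  have h1 := g.pres 0 x y y fun w => ⟨Or.inr, fun h' => h'.elim (fun hx => h hx) id⟩
  exact subset_iff.2 fun w hw => (h1 w).2 (Or.inl hw)

theorem map_sing {x z : VRank lam} (h : ∀ w : VRank lam, w.1 ∈ z.1 ↔ w = x) (w : VRank lam) :
    w.1 ∈ (l z).1 ↔ w = l x :=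
  g.pres 2 x x z h w

theorem not_mem_of_disjoint {x y w : VRank lam} (h : ∀ w : VRank lam, w.1 ∈ x.1 → ¬ w.1 ∈ y.1)
    (hx : w.1 ∈ (l x).1) : ¬ w.1 ∈ (l y).1 :=
  ((g.pres 1 x y x fun w => ⟨fun hw => ⟨hw, h w hw⟩, fun hw => hw.1⟩) w).1 hx |>.2

theorem map_pair (x y : VRank lam) : l (pair x y) = pair (l x) (l y) := by
  obtain ⟨a, ha⟩ := exists_sing x
  obtain ⟨b, hb⟩ := exists_sing y
  obtain ⟨c, hc⟩ := exists_sing (pair x y)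
  have h := g.pres 3 a b c (fun w => by
    rw [hc]
    refine ⟨?_, ?_⟩
    · rintro rfl; exact ⟨x, y, (ha x).2 rfl, (hb y).2 rfl, rfl⟩
    · rintro ⟨x', y', hx, hy, rfl⟩; rw [(ha _).1 hx, (hb _).1 hy])
  obtain ⟨x', y', hx, hy, e⟩ := (h (l (pair x y))).1 ((g.map_sing hc _).2 rfl)
  rw [e, (g.map_sing ha _).1 hx, (g.map_sing hb _).1 hy]

theorem mem_ext {A : Set (VRank lam)} {y : VRank lam} :
    y ∈ extendEmb l A ↔ ∃ a : VRank lam, (∀ w : VRank lam, w.1 ∈ a.1 → w ∈ A) ∧ y.1 ∈ (l a).1 := by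
  constructor
  · rintro ⟨α, hα, hy⟩
    refine ⟨_, fun w hw => ?_, hy⟩
    simp only [truncSet, ZFSet.mem_sep] at hw
    exact hw.2.2
  · rintro ⟨a, ha, hy⟩
    refine ⟨_, a.rank_lt, g.map_subset (subset_iff.2 fun w hw => ?_) hy⟩
    simp only [truncSet, ZFSet.mem_sep]
    exact ⟨ZFSet.mem_vonNeumann.2 (ZFSet.rank_lt_of_mem hw), w.2, ha w hw⟩

theorem ext_mono {A B : Set (VRank lam)} (h : A ⊆ B) : extendEmb l A ⊆ extendEmb l B :=
  fun y hy => by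
    obtain ⟨a, ha, hy⟩ := g.mem_ext.1 hy
    exact g.mem_ext.2 ⟨a, fun w hw => h (ha w hw), hy⟩

theorem ext_not_mem {A B : Set (VRank lam)} (h : Disjoint A B) {y : VRank lam}
    (hy : y ∈ extendEmb l A) : y ∉ extendEmb l B := fun hy' => by
  obtain ⟨a, ha, hya⟩ := g.mem_ext.1 hy
  obtain ⟨b, hb, hyb⟩ := g.mem_ext.1 hy'
  exact g.not_mem_of_disjoint (fun w hw hw' => Set.disjoint_left.1 h (ha w hw) (hb w hw')) hya hyb

theorem ext_univ : extendEmb l Set.univ = Set.univ :=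
  Set.eq_univ_of_forall fun y => by
    obtain ⟨x, hx⟩ := g.cofinal y
    exact g.mem_ext.2 ⟨x, fun _ _ => trivial, hx⟩

/-- By cofinality every $y$ lies in some $l(x)$, and $x$ splits into its parts inside and outside
$A$. -/
theorem ext_compl (A : Set (VRank lam)) : extendEmb l Aᶜ = (extendEmb l A)ᶜ := by
  ext y
  refine ⟨g.ext_not_mem disjoint_compl_left, fun hy => ?_⟩
  obtain ⟨x, hx⟩ := g.cofinal y
  have h := (g.pres 0 (sep x (· ∈ A)) (sep x (· ∉ A)) x (fun w => by
    show _ ↔ _ ∨ _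
    rw [mem_sep, mem_sep]; tauto) y).1 hx
  rcases h with h | h
  · exact absurd (g.mem_ext.2 ⟨_, fun w hw => (mem_sep.1 hw).2, h⟩) hy
  · exact g.mem_ext.2 ⟨_, fun w hw => (mem_sep.1 hw).2, h⟩

theorem ext_union (A B : Set (VRank lam)) :
    extendEmb l (A ∪ B) = extendEmb l A ∪ extendEmb l B := by
  refine subset_antisymm (fun y hy => ?_)
    (Set.union_subset (g.ext_mono Set.subset_union_left) (g.ext_mono Set.subset_union_right))
  obtain ⟨a, ha, hy⟩ := g.mem_ext.1 hy
  have h := (g.pres 0 (sep a (· ∈ A)) (sep a (· ∈ B)) a (fun w => by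
    show _ ↔ _ ∨ _
    rw [mem_sep, mem_sep, ← and_or_left]
    exact ⟨fun hw => ⟨hw, ha w hw⟩, fun hw => hw.1⟩) y).1 hy
  exact h.imp (fun h => g.mem_ext.2 ⟨_, fun w hw => (mem_sep.1 hw).2, h⟩)
    (fun h => g.mem_ext.2 ⟨_, fun w hw => (mem_sep.1 hw).2, h⟩)

theorem ext_sdiff (A B : Set (VRank lam)) :
    extendEmb l (A \ B) = extendEmb l A \ extendEmb l B := by
  have : A \ B = (Aᶜ ∪ B)ᶜ := by rw [Set.compl_union, compl_compl]; rfl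
  rw [this, g.ext_compl, g.ext_union, g.ext_compl, Set.compl_union, compl_compl]; rfl

theorem ext_empty : extendEmb l ∅ = ∅ := by
  rw [← Set.compl_univ, g.ext_compl, g.ext_univ]

theorem ext_coe (a : VRank lam) :
    extendEmb l {w | w.1 ∈ a.1} = {w | w.1 ∈ (l a).1} := by
  ext y
  refine g.mem_ext.trans ⟨?_, fun hy => ⟨a, fun w hw => hw, hy⟩⟩
  rintro ⟨b, hb, hy⟩
  exact g.map_subset (subset_iff.2 hb) hy

theorem ext_singleton (x : VRank lam) : extendEmb l {x} = {l x} := by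
  obtain ⟨z, hz⟩ := exists_sing x
  have h := g.ext_coe z
  simp only [hz, g.map_sing hz] at h
  exact h

theorem map_mem_ext {A : Set (VRank lam)} {x : VRank lam} : l x ∈ extendEmb l A ↔ x ∈ A := by
  have hx : l x ∈ extendEmb l {x} := by rw [g.ext_singleton]; rfl
  constructor
  · intro h
    by_contra hxA
    exact g.ext_not_mem (Set.disjoint_singleton_left.2 hxA) hx h
  · intro h
    exact g.ext_mono (Set.singleton_subset_iff.2 h) hx

theorem ext_injective : Function.Injective (extendEmb l) := fun A B h => by
  ext x
  rw [← g.map_mem_ext, h, g.map_mem_ext]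

/-- Code the sequence as $t=\{(n,c)\mid c\in s_n\}$. As $l$ fixes $\omega$ and its elements, $w\in
l(x)$ yields a pair $(n,w)\in l(t)$ with $n$ a natural number. Removing $\{n\}\times s_n$ from $t$
leaves nothing in $\{n\}\times x$, so $w\in l(s_n)$. -/
theorem map_iUnion (hω : Ordinal.omega0 < lam) {s : ℕ → VRank lam} {x : VRank lam}
    (h : ∀ w : VRank lam, w.1 ∈ x.1 ↔ ∃ n, w.1 ∈ (s n).1) (w : VRank lam) :
    w.1 ∈ (l x).1 ↔ ∃ n, w.1 ∈ (l (s n)).1 := by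
  constructor
  swap
  · rintro ⟨n, hn⟩
    exact g.map_subset (subset_iff.2 fun w hw => (h w).2 ⟨n, hw⟩) hn
  intro hw
  obtain ⟨z, hz⟩ := exists_isOmega hω
  obtain ⟨p, hp⟩ := exists_basicOp 3 z x
  let t := sep p fun w => ∃ n, ∃ c : VRank lam, c.1 ∈ (s n).1 ∧ w = pair (nat n) c
  have ht : ∀ {n} {c : VRank lam}, (pair (nat n) c).1 ∈ t.1 ↔ c.1 ∈ (s n).1 := by
    intro n c
    rw [mem_sep]
    constructor
    · rintro ⟨-, m, c', hc, e⟩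
      rw [pair_inj] at e
      rwa [e.2, nat_injective e.1]
    · intro hc
      exact ⟨(hp _).2 ⟨nat n, c, (hz.mem_iff _).2 ⟨n, rfl⟩, (h c).2 ⟨n, hc⟩, rfl⟩, n, c, hc, rfl⟩
  obtain ⟨a, ha⟩ := (g.pres 4 t t x (fun c => by
    rw [h]
    constructor
    · rintro ⟨n, hn⟩; exact ⟨nat n, ht.2 hn⟩
    · rintro ⟨a, ha⟩
      obtain ⟨-, n, c', hc, e⟩ := mem_sep.1 ha
      exact ⟨n, by rw [(pair_inj.1 e).2]; exact hc⟩) w).1 hw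
  have hap := g.map_subset (y := p) (subset_iff.2 fun w hw => (mem_sep.1 hw).1) ha
  obtain ⟨a', w', ha', hw', e⟩ := (g.pres 3 z x p hp _).1 hap
  obtain ⟨rfl, rfl⟩ := pair_inj.1 e
  rw [(g.omega z hz).1, hz.mem_iff] at ha'
  obtain ⟨n, rfl⟩ := ha'
  refine ⟨n, ?_⟩
  have hn : l (nat n) = nat n := (g.omega z hz).2 _ ((hz.mem_iff _).2 ⟨n, rfl⟩)
  obtain ⟨q, hq⟩ := exists_sing (nat n : VRank lam)
  obtain ⟨r, hr⟩ := exists_basicOp 3 q x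
  obtain ⟨r', hr'⟩ := exists_basicOp 3 q (s n)
  have hwr : (pair (nat n) w).1 ∈ (l r).1 :=
    (g.pres 3 q x r hr _).2 ⟨nat n, w, (g.map_sing hq _).2 hn.symm, hw, rfl⟩
  by_contra hws
  have hwr' : ¬ (pair (nat n) w).1 ∈ (l r').1 := fun hmem => by
    obtain ⟨a', w', -, h2, e⟩ := (g.pres 3 q (s n) r' hr' _).1 hmem
    rw [← (pair_inj.1 e).2] at h2
    exact hws h2
  obtain ⟨d, hd⟩ := exists_basicOp 1 t r'
  have hwd : (pair (nat n) w).1 ∈ (l d).1 := (g.pres 1 t r' d hd _).2 ⟨ha, hwr'⟩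
  refine g.not_mem_of_disjoint (fun v hv hv' => ?_) hwd hwr
  obtain ⟨hvt, hvr⟩ := (hd v).1 hv
  obtain ⟨a', c, ha', hc, rfl⟩ := (hr v).1 hv'
  rw [(hq _).1 ha'] at hvt hvr
  exact hvr ((hr' _).2 ⟨nat n, c, (hq _).2 rfl, ht.1 hvt, rfl⟩)

end Good

/-! ### Images of classes under the basic operations -/

/-- The set of pairs with components in `A` and `B`. -/
def sprod (A B : Set (VRank lam)) : Set (VRank lam) := {w | ∃ a ∈ A, ∃ b ∈ B, w = pair a b}

/-- The set of second components of the pairs in `A`. -/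
def dom (A : Set (VRank lam)) : Set (VRank lam) := {c | ∃ a, pair a c ∈ A}

/-- The set of triples obtained from pairs in `A` by inserting an arbitrary middle component. -/
def insMid (A : Set (VRank lam)) : Set (VRank lam) :=
  {w | ∃ a b c, pair a c ∈ A ∧ w = pair a (pair b c)}

/-- The set of triples with last component in `C` and first two components related by `R`. -/
def relTriple (R : VRank lam → VRank lam → Prop) (C : Set (VRank lam)) : Set (VRank lam) :=
  {w | ∃ a b c, (c ∈ C ∧ R a b) ∧ w = pair a (pair b c)}

@[simp]
theorem pair_mem_sprod {A B : Set (VRank lam)} {a b : VRank lam} :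
    pair a b ∈ sprod A B ↔ a ∈ A ∧ b ∈ B := by
  constructor
  · rintro ⟨a', ha, b', hb, e⟩
    obtain ⟨rfl, rfl⟩ := pair_inj.1 e
    exact ⟨ha, hb⟩
  · rintro ⟨ha, hb⟩; exact ⟨a, ha, b, hb, rfl⟩

@[simp]
theorem triple_mem_insMid {A : Set (VRank lam)} {a b c : VRank lam} :
    pair a (pair b c) ∈ insMid A ↔ pair a c ∈ A := by
  constructor
  · rintro ⟨a', b', c', h, e⟩
    simp only [pair_inj] at e
    obtain ⟨rfl, rfl, rfl⟩ := e
    exact h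
  · intro h; exact ⟨a, b, c, h, rfl⟩

@[simp]
theorem triple_mem_relTriple {R : VRank lam → VRank lam → Prop} {C : Set (VRank lam)}
    {a b c : VRank lam} : pair a (pair b c) ∈ relTriple R C ↔ c ∈ C ∧ R a b := by
  constructor
  · rintro ⟨a', b', c', h, e⟩
    simp only [pair_inj] at e
    obtain ⟨rfl, rfl, rfl⟩ := e
    exact h
  · intro h; exact ⟨a, b, c, h, rfl⟩

namespace Good

variable {l : VRank lam → VRank lam} (g : Good l)

include g

theorem sprod_ext_subset (A B : Set (VRank lam)) :
    sprod (extendEmb l A) (extendEmb l B) ⊆ extendEmb l (sprod A B) := by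
  rintro _ ⟨a, ha, b, hb, rfl⟩
  obtain ⟨x, hx, ha⟩ := g.mem_ext.1 ha
  obtain ⟨y, hy, hb⟩ := g.mem_ext.1 hb
  obtain ⟨z, hz⟩ := exists_basicOp 3 x y
  refine g.mem_ext.2 ⟨z, fun w hw => ?_, (g.pres 3 x y z hz _).2 ⟨a, b, ha, hb, rfl⟩⟩
  obtain ⟨a', b', ha', hb', rfl⟩ := (hz w).1 hw
  exact ⟨a', hx _ ha', b', hy _ hb', rfl⟩

/-- One inclusion is computed on sets. The other is the first one for complements, because disjoint
classes have disjoint images. -/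
theorem ext_sprod (A B : Set (VRank lam)) :
    extendEmb l (sprod A B) = sprod (extendEmb l A) (extendEmb l B) := by
  refine subset_antisymm (fun w hw => ?_) (g.sprod_ext_subset A B)
  obtain ⟨z, hz, hwz⟩ := g.mem_ext.1 hw
  obtain ⟨y, hy⟩ := exists_lev_superset z
  obtain ⟨p, hp⟩ := exists_basicOp 3 y y
  have hzp : z.1 ⊆ p.1 := subset_iff.2 fun v hv => by
    obtain ⟨a, -, b, -, rfl⟩ := hz v hv
    exact (hp _).2 ⟨a, b, hy _ (rank_lt_of_pair_mem hv).1.le, hy _ (rank_lt_of_pair_mem hv).2.le, rfl⟩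
  obtain ⟨a, b, -, -, rfl⟩ := (g.pres 3 y y p hp w).1 (g.map_subset hzp hwz)
  rw [pair_mem_sprod]
  by_contra hne
  rw [not_and_or] at hne
  rcases hne with h | h
  · have h' : a ∈ extendEmb l Aᶜ := by rw [g.ext_compl]; exact h
    refine g.ext_not_mem ?_ (g.sprod_ext_subset Aᶜ Set.univ
      (pair_mem_sprod.2 ⟨h', by rw [g.ext_univ]; trivial⟩)) hw
    rw [Set.disjoint_left]
    rintro _ ⟨a, ha, b, hb, rfl⟩ h2
    exact ha (pair_mem_sprod.1 h2).1
  · have h' : b ∈ extendEmb l Bᶜ := by rw [g.ext_compl]; exact h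
    refine g.ext_not_mem ?_ (g.sprod_ext_subset Set.univ Bᶜ
      (pair_mem_sprod.2 ⟨by rw [g.ext_univ]; trivial, h'⟩)) hw
    rw [Set.disjoint_left]
    rintro _ ⟨a, ha, b, hb, rfl⟩ h2
    exact hb (pair_mem_sprod.1 h2).2

theorem exists_triple_of_mem_ext {A C : Set (VRank lam)}
    (hA : A ⊆ sprod Set.univ (sprod Set.univ C)) {w : VRank lam} (hw : w ∈ extendEmb l A) :
    ∃ a b c, c ∈ extendEmb l C ∧ w = pair a (pair b c) := by
  have := g.ext_mono hA hw
  rw [g.ext_sprod, g.ext_sprod] at this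
  obtain ⟨a, -, _, ⟨b, -, c, hc, rfl⟩, rfl⟩ := this
  exact ⟨a, b, c, hc, rfl⟩

theorem insMid_ext_subset (A : Set (VRank lam)) :
    insMid (extendEmb l A) ⊆ extendEmb l (insMid A) := by
  rintro _ ⟨a, b, c, h, rfl⟩
  obtain ⟨x, hx, h⟩ := g.mem_ext.1 h
  obtain ⟨y, hy⟩ := g.cofinal b
  obtain ⟨z, hz⟩ := exists_basicOp 5 x y
  refine g.mem_ext.2 ⟨z, fun w hw => ?_, (g.pres 5 x y z hz _).2 ⟨a, b, c, h, hy, rfl⟩⟩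
  obtain ⟨a', b', c', h', -, rfl⟩ := (hz w).1 hw
  exact ⟨a', b', c', hx _ h', rfl⟩

theorem ext_insMid (A : Set (VRank lam)) :
    extendEmb l (insMid A) = insMid (extendEmb l A) := by
  refine subset_antisymm (fun w hw => ?_) (g.insMid_ext_subset A)
  obtain ⟨a, b, c, -, rfl⟩ := g.exists_triple_of_mem_ext (C := Set.univ) (by
    rintro _ ⟨a, b, c, -, rfl⟩; simp) hw
  rw [triple_mem_insMid]
  by_contra hne
  have h' : pair a c ∈ extendEmb l Aᶜ := by rw [g.ext_compl]; exact hne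
  refine g.ext_not_mem ?_ (g.insMid_ext_subset Aᶜ (triple_mem_insMid.2 h')) hw
  rw [Set.disjoint_left]
  rintro _ ⟨a, b, c, h, rfl⟩ h2
  exact h (triple_mem_insMid.1 h2)

theorem ext_relTriple_of (n : Fin 9) (R : VRank lam → VRank lam → Prop)
    (hR : ∀ x y w : VRank lam, basicOp n x y w ↔
      ∃ a b c, (c.1 ∈ x.1 ∧ a.1 ∈ y.1 ∧ b.1 ∈ y.1 ∧ R a b) ∧ w = pair a (pair b c))
    (C : Set (VRank lam)) : extendEmb l (relTriple R C) = relTriple R (extendEmb l C) := by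
  apply subset_antisymm
  · intro w hw
    obtain ⟨a, b, c, hc, rfl⟩ := g.exists_triple_of_mem_ext (C := C) (by
      rintro _ ⟨a, b, c, h, rfl⟩; simpa using h.1) hw
    rw [triple_mem_relTriple]
    refine ⟨hc, ?_⟩
    obtain ⟨z, hz, hwz⟩ := g.mem_ext.1 hw
    obtain ⟨y, hy⟩ := exists_lev_superset z
    obtain ⟨p, hp⟩ := exists_basicOp n y y
    have hzp : z.1 ⊆ p.1 := subset_iff.2 fun v hv => by
      obtain ⟨a, b, c, h, rfl⟩ := hz v hv
      have h1 := rank_lt_of_pair_mem hv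
      have h2 := rank_lt_pair b c
      exact (hp _).2 ((hR _ _ _).2 ⟨a, b, c, ⟨hy _ (h2.2.trans h1.2).le, hy _ h1.1.le,
        hy _ (h2.1.trans h1.2).le, h.2⟩, rfl⟩)
    obtain ⟨a', b', c', h, e⟩ :=
      (hR _ _ _).1 ((g.pres n y y p hp _).1 (g.map_subset hzp hwz))
    simp only [pair_inj] at e
    obtain ⟨rfl, rfl, rfl⟩ := e
    exact h.2.2.2
  · rintro _ ⟨a, b, c, ⟨hc, h⟩, rfl⟩
    obtain ⟨x, hx, hc⟩ := g.mem_ext.1 hc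
    obtain ⟨y₁, hy₁⟩ := g.cofinal a
    obtain ⟨y₂, hy₂⟩ := g.cofinal b
    obtain ⟨y, hy⟩ := exists_union y₁ y₂
    obtain ⟨z, hz⟩ := exists_basicOp n x y
    refine g.mem_ext.2 ⟨z, fun w hw => ?_, (g.pres n x y z hz _).2 ((hR _ _ _).2
      ⟨a, b, c, ⟨hc, ((g.pres 0 _ _ _ hy) a).2 (Or.inl hy₁),
        ((g.pres 0 _ _ _ hy) b).2 (Or.inr hy₂), h⟩, rfl⟩)⟩
    obtain ⟨a', b', c', h', rfl⟩ := (hR _ _ _).1 ((hz w).1 hw)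
    exact ⟨a', b', c', ⟨hx _ h'.1, h'.2.2.2⟩, rfl⟩

theorem dom_ext_subset (A : Set (VRank lam)) : dom (extendEmb l A) ⊆ extendEmb l (dom A) := by
  rintro c ⟨a, h⟩
  obtain ⟨x, hx, h⟩ := g.mem_ext.1 h
  obtain ⟨z, hz⟩ := exists_basicOp 4 x x
  refine g.mem_ext.2 ⟨z, fun w hw => ?_, (g.pres 4 x x z hz _).2 ⟨a, h⟩⟩
  obtain ⟨a', h'⟩ := (hz w).1 hw
  exact ⟨a', hx _ h'⟩

end Good

/-- `V_λ` is a union of countably many of its levels, and `λ > ω`. -/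
def CofOmega (lam : Ordinal.{u}) : Prop :=
  Ordinal.omega0 < lam ∧ ∃ s : ℕ → Ordinal.{u}, (∀ n, s n < lam) ∧ ∀ α < lam, ∃ n, α < s n

/-- Here countable cofinality enters. Witnesses for a set $x$ of second components may be unbounded
in $V_\lambda$, but $x$ is a countable union of parts with bounded witnesses, and $l$ commutes with
that union. -/
theorem Good.ext_dom (hc : CofOmega lam) {l : VRank lam → VRank lam} (g : Good l)
    (A : Set (VRank lam)) : extendEmb l (dom A) = dom (extendEmb l A) := by
  refine subset_antisymm (fun c hcA => ?_) (g.dom_ext_subset A)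
  obtain ⟨hω, s, hs, hs'⟩ := hc
  obtain ⟨x, hx, hcx⟩ := g.mem_ext.1 hcA
  obtain ⟨n, hn⟩ := (g.map_iUnion hω
    (s := fun n => sep x fun c => ∃ a : VRank lam, a.1.rank < s n ∧ pair a c ∈ A) (x := x)
    (fun w => by
      simp only [mem_sep]
      refine ⟨fun hw => ?_, fun ⟨n, h⟩ => h.1⟩
      obtain ⟨a, ha⟩ := hx w hw
      obtain ⟨n, hn⟩ := hs' _ a.rank_lt
      exact ⟨n, hw, a, hn, ha⟩) c).1 hcx
  obtain ⟨p, hp⟩ := exists_basicOp 3 (lev (s n) (hs n)) x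
  obtain ⟨a, ha⟩ := (g.pres 4 (sep p (· ∈ A)) x _ (fun c => by
    rw [mem_sep]
    constructor
    · rintro ⟨hcx, a, ha, hA⟩
      exact ⟨a, mem_sep.2 ⟨(hp _).2 ⟨a, c, mem_lev.2 ha, hcx, rfl⟩, hA⟩⟩
    · rintro ⟨a, ha⟩
      obtain ⟨h1, h2⟩ := mem_sep.1 ha
      obtain ⟨a', c', ha', hc', e⟩ := (hp _).1 h1
      obtain ⟨rfl, rfl⟩ := pair_inj.1 e
      exact ⟨hc', a, mem_lev.1 ha', h2⟩) c).1 hn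
  exact ⟨a, g.mem_ext.2 ⟨_, fun w hw => (mem_sep.1 hw).2, ha⟩⟩

/-! ### Coded truth sets, and elementarity from `Good` -/

/-- A tuple of elements of `V_λ` coded as an iterated pair. -/
noncomputable def code : {n : ℕ} → (Fin n → VRank lam) → VRank lam
  | 0, _ => nat 0
  | n + 1, x => pair (x (Fin.last n)) (code fun i : Fin n => x i.castSucc)

theorem code_injective : ∀ {n : ℕ}, Function.Injective (code : (Fin n → VRank lam) → VRank lam)
  | 0 => fun _ _ _ => Subsingleton.elim _ _
  | n + 1 => fun x y h => by
    simp only [code, pair_inj] at h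
    have h2 := code_injective h.2
    funext i
    induction i using Fin.lastCases with
    | last => exact h.1
    | cast i => exact congrFun h2 i

/-- The set of codes of tuples with a given property. -/
def codes {n : ℕ} (P : (Fin n → VRank lam) → Prop) : Set (VRank lam) := {w | ∃ x, w = code x ∧ P x}

@[simp]
theorem code_mem_codes {n : ℕ} {P : (Fin n → VRank lam) → Prop} {x : Fin n → VRank lam} :
    code x ∈ codes P ↔ P x := by
  constructor
  · rintro ⟨y, h, hy⟩; rwa [code_injective h]
  · intro h; exact ⟨x, rfl, h⟩

theorem codes_congr {n : ℕ} {P Q : (Fin n → VRank lam) → Prop} (h : ∀ x, P x ↔ Q x) :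
    codes P = codes Q := by
  rw [show P = Q from funext fun x => propext (h x)]

theorem code_snoc {n : ℕ} (x : Fin n → VRank lam) (a : VRank lam) :
    code (Fin.snoc x a : Fin (n + 1) → VRank lam) = pair a (code x) := by
  simp [code]

theorem mem_codes_succ {n : ℕ} {P : (Fin (n + 1) → VRank lam) → Prop} {w : VRank lam} :
    w ∈ codes P ↔ ∃ (a : VRank lam) (x : Fin n → VRank lam),
      w = pair a (code x) ∧ P (Fin.snoc x a : Fin (n + 1) → VRank lam) := by
  constructor
  · rintro ⟨x, rfl, h⟩
    refine ⟨x (Fin.last n), fun i => x i.castSucc, rfl, ?_⟩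
    convert h
    exact Fin.snoc_init_self x
  · rintro ⟨a, x, rfl, h⟩
    exact ⟨_, (code_snoc x a).symm, h⟩

theorem codes_init {n : ℕ} (P : (Fin n → VRank lam) → Prop) :
    codes (fun x : Fin (n + 1) → VRank lam => P fun i => x i.castSucc) =
      sprod Set.univ (codes P) := by
  ext w
  rw [mem_codes_succ]
  simp only [Fin.snoc_castSucc]
  constructor
  · rintro ⟨a, x, rfl, h⟩; simpa using h
  · rintro ⟨a, -, _, ⟨x, rfl, h⟩, rfl⟩; exact ⟨a, x, rfl, h⟩

theorem codes_true_succ (n : ℕ) : codes (lam := lam) (fun _ : Fin (n + 1) → VRank lam => True) =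
    sprod Set.univ (codes fun _ : Fin n → VRank lam => True) :=
  codes_init fun _ => True

theorem codes_last {n : ℕ} (A : Set (VRank lam)) :
    codes (fun x : Fin (n + 1) → VRank lam => x (Fin.last n) ∈ A) =
      sprod A (codes fun _ : Fin n → VRank lam => True) := by
  ext w
  rw [mem_codes_succ]
  simp only [Fin.snoc_last]
  constructor
  · rintro ⟨a, x, rfl, h⟩; simpa using h
  · rintro ⟨a, ha, _, ⟨x, rfl, h⟩, rfl⟩; exact ⟨a, x, rfl, ha⟩

theorem codes_last_last {n : ℕ} (R : VRank lam → VRank lam → Prop) :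
    codes (fun x : Fin (n + 2) → VRank lam => R (x (Fin.last _)) (x (Fin.last n).castSucc)) =
      relTriple R (codes fun _ : Fin n → VRank lam => True) := by
  ext w
  rw [mem_codes_succ]
  simp only [Fin.snoc_last, Fin.snoc_castSucc]
  constructor
  · rintro ⟨a, x, rfl, h⟩
    exact ⟨a, x (Fin.last n), _, ⟨code_mem_codes.2 trivial, h⟩, rfl⟩
  · rintro ⟨a, b, _, ⟨⟨x, rfl, -⟩, h⟩, rfl⟩
    exact ⟨a, Fin.snoc x b, by rw [code_snoc], by simpa using h⟩

theorem codes_last_init {n : ℕ} (R : VRank lam → VRank lam → Prop) (i : Fin n) :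
    codes (fun x : Fin (n + 2) → VRank lam => R (x (Fin.last _)) (x i.castSucc.castSucc)) =
      insMid (codes fun x : Fin (n + 1) → VRank lam => R (x (Fin.last _)) (x i.castSucc)) := by
  ext w
  rw [mem_codes_succ]
  simp only [Fin.snoc_last, Fin.snoc_castSucc]
  constructor
  · rintro ⟨a, x, rfl, h⟩
    refine ⟨a, x (Fin.last n), code fun i : Fin n => x i.castSucc, ?_, rfl⟩
    exact mem_codes_succ.2 ⟨a, _, rfl, by simpa using h⟩
  · rintro ⟨a, b, c, h, rfl⟩
    obtain ⟨a', x, e, hx⟩ := mem_codes_succ.1 h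
    obtain ⟨rfl, rfl⟩ := pair_inj.1 e
    exact ⟨a, Fin.snoc x b, by rw [code_snoc], by simpa using hx⟩

theorem codes_forall {n : ℕ} (P : (Fin (n + 1) → VRank lam) → Prop) :
    codes (fun x : Fin n → VRank lam => ∀ a, P (Fin.snoc x a : Fin (n + 1) → VRank lam)) =
      codes (fun _ : Fin n → VRank lam => True) \
        dom (codes (fun _ : Fin (n + 1) → VRank lam => True) \ codes P) := by
  ext w
  constructor
  · rintro ⟨x, rfl, h⟩
    refine ⟨code_mem_codes.2 trivial, ?_⟩
    rintro ⟨a, -, ha⟩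
    exact ha (mem_codes_succ.2 ⟨a, x, rfl, h a⟩)
  · rintro ⟨⟨x, rfl, -⟩, h⟩
    refine ⟨x, rfl, fun a => ?_⟩
    by_contra hne
    refine h ⟨a, mem_codes_succ.2 ⟨a, x, rfl, trivial⟩, fun hmem => hne ?_⟩
    rw [← code_snoc, code_mem_codes] at hmem
    exact hmem

theorem codes_imp {n : ℕ} (P Q : (Fin n → VRank lam) → Prop) :
    codes (fun x => P x → Q x) = codes (fun _ : Fin n → VRank lam => True) \ (codes P \ codes Q) := by
  ext w
  constructor
  · rintro ⟨x, rfl, h⟩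
    refine ⟨code_mem_codes.2 trivial, fun h' => h'.2 (code_mem_codes.2 (h ?_))⟩
    exact code_mem_codes.1 h'.1
  · rintro ⟨⟨x, rfl, -⟩, h⟩
    refine code_mem_codes.2 fun hP => ?_
    by_contra hQ
    exact h ⟨code_mem_codes.2 hP, fun h' => hQ (code_mem_codes.1 h')⟩

namespace Good

variable {l : VRank lam → VRank lam} (g : Good l)

include g

theorem map_nat_zero : l (nat 0) = nat 0 := by
  have h := g.pres 1 (nat 0) (nat 0) (nat 0) fun w =>
    ⟨fun h => absurd h (not_mem_nat_zero w), fun h => h.1⟩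
  exact ext_mem fun w => iff_of_false (fun hw => ((h w).1 hw).2 hw) (not_mem_nat_zero w)

theorem map_code : ∀ {n : ℕ} (x : Fin n → VRank lam), l (code x) = code fun i => l (x i)
  | 0, _ => g.map_nat_zero
  | n + 1, x => by rw [code, g.map_pair, map_code, code]

theorem ext_codes_true (n : ℕ) : extendEmb l (codes fun _ : Fin n → VRank lam => True) =
    codes fun _ : Fin n → VRank lam => True := by
  induction n with
  | zero =>
    have : codes (lam := lam) (fun _ : Fin 0 → VRank lam => True) = {nat 0} := by
      ext w
      exact ⟨fun ⟨x, h, _⟩ => h, fun h => ⟨Fin.elim0, h, trivial⟩⟩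
    rw [this, g.ext_singleton, g.map_nat_zero]
  | succ n ih => rw [codes_true_succ, g.ext_sprod, g.ext_univ, ih]

theorem ext_codes_mem (A : Set (VRank lam)) {n : ℕ} (i : Fin n) :
    extendEmb l (codes fun x : Fin n → VRank lam => x i ∈ A) =
      codes fun x : Fin n → VRank lam => x i ∈ extendEmb l A := by
  induction n with
  | zero => exact i.elim0
  | succ n ih =>
    induction i using Fin.lastCases with
    | last => rw [codes_last, codes_last, g.ext_sprod, g.ext_codes_true]
    | cast i =>
      rw [codes_init (fun x => x i ∈ A), codes_init (fun x => x i ∈ extendEmb l A), g.ext_sprod,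
        g.ext_univ, ih]

theorem ext_codes_last_rel {R : VRank lam → VRank lam → Prop}
    (hR : ∀ C, extendEmb l (relTriple R C) = relTriple R (extendEmb l C)) {n : ℕ} (i : Fin n) :
    extendEmb l (codes fun x : Fin (n + 1) → VRank lam => R (x (Fin.last n)) (x i.castSucc)) =
      codes fun x : Fin (n + 1) → VRank lam => R (x (Fin.last n)) (x i.castSucc) := by
  induction n with
  | zero => exact i.elim0
  | succ n ih =>
    induction i using Fin.lastCases with
    | last => rw [codes_last_last, hR, g.ext_codes_true]
    | cast i => rw [codes_last_init, g.ext_insMid, ih]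

/-- Induction peels off the newest variable, the head of the code. It may be the left or the right
argument of $R$, whence both orientations are needed; if it is both, the truth value is the constant
`r`. -/
theorem ext_codes_rel {R : VRank lam → VRank lam → Prop} {r : Prop}
    (hR : ∀ C, extendEmb l (relTriple R C) = relTriple R (extendEmb l C))
    (hR' : ∀ C, extendEmb l (relTriple (fun a b => R b a) C) =
      relTriple (fun a b => R b a) (extendEmb l C))
    (hr : ∀ x, R x x ↔ r) {n : ℕ} (i k : Fin n) :
    extendEmb l (codes fun x : Fin n → VRank lam => R (x i) (x k)) =
      codes fun x : Fin n → VRank lam => R (x i) (x k) := by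
  induction n with
  | zero => exact i.elim0
  | succ n ih =>
    induction i using Fin.lastCases with
    | last =>
      induction k using Fin.lastCases with
      | last =>
        simp only [hr]
        by_cases h : r
        · simp only [h]
          exact g.ext_codes_true _
        · have : codes (lam := lam) (fun _ : Fin (n + 1) → VRank lam => r) = ∅ :=
            Set.eq_empty_of_forall_notMem fun w ⟨_, _, h'⟩ => h h'
          rw [this, g.ext_empty]
      | cast k => exact g.ext_codes_last_rel hR k
    | cast i =>
      induction k using Fin.lastCases with
      | last => exact g.ext_codes_last_rel hR' i
      | cast k => rw [codes_init (fun x => R (x i) (x k)), g.ext_sprod, g.ext_univ, ih]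

theorem ext_relTriple_mem (C : Set (VRank lam)) :
    extendEmb l (relTriple (fun a b => a.1 ∈ b.1) C) =
      relTriple (fun a b => a.1 ∈ b.1) (extendEmb l C) :=
  g.ext_relTriple_of 6 _ (fun _ _ _ => Iff.rfl) C

theorem ext_relTriple_mem' (C : Set (VRank lam)) :
    extendEmb l (relTriple (fun a b => b.1 ∈ a.1) C) =
      relTriple (fun a b => b.1 ∈ a.1) (extendEmb l C) :=
  g.ext_relTriple_of 7 _ (fun _ _ _ => Iff.rfl) C

theorem ext_relTriple_eq (C : Set (VRank lam)) :
    extendEmb l (relTriple (fun a b => a = b) C) =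
      relTriple (fun a b => a = b) (extendEmb l C) :=
  g.ext_relTriple_of 8 _ (fun _ _ _ => Iff.rfl) C

theorem ext_relTriple_eq' (C : Set (VRank lam)) :
    extendEmb l (relTriple (fun a b => b = a) C) =
      relTriple (fun a b => b = a) (extendEmb l C) := by
  have h : (fun a b : VRank lam => b = a) = fun a b => a = b :=
    funext fun a => funext fun b => propext eq_comm
  rw [h]
  exact g.ext_relTriple_eq C

end Good

theorem exists_var {p n : ℕ} (t : (setLang p).Term (Empty ⊕ Fin n)) :
    ∃ i : Fin n, t = Language.Term.var (Sum.inr i) := by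
  cases t with
  | var v =>
    rcases v with v | v
    · exact v.elim
    · exact ⟨v, rfl⟩
  | func f _ => exact (nomatch f)

/-- Induction on `φ`: atomic formulas define classes built by the basic operations, implication is a
set difference, and a universal quantifier is the complement of a projection `dom`. -/
theorem Good.ext_codes_realize (hc : CofOmega lam) {l : VRank lam → VRank lam} (g : Good l)
    {p n : ℕ} (φ : (setLang p).BoundedFormula Empty n) (X : Fin p → Set (VRank lam)) :
    extendEmb l (codes fun x => @Language.BoundedFormula.Realize _ _ (rankStructure lam X) _ _ φ
        default x) =
      codes fun x => @Language.BoundedFormula.Realize _ _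
        (rankStructure lam fun i => extendEmb l (X i)) _ _ φ default x := by
  induction φ with
  | falsum =>
    have : ∀ n, codes (lam := lam) (fun _ : Fin n → VRank lam => False) = ∅ := fun n =>
      Set.eq_empty_of_forall_notMem fun w ⟨_, _, h'⟩ => h'
    exact (congrArg _ (this _)).trans (g.ext_empty.trans (this _).symm)
  | equal t₁ t₂ =>
    obtain ⟨i, rfl⟩ := exists_var t₁
    obtain ⟨k, rfl⟩ := exists_var t₂
    exact g.ext_codes_rel (R := fun a b => a = b) (r := True) g.ext_relTriple_eq
      g.ext_relTriple_eq' (fun x => by simp) i k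
  | rel R ts =>
    cases R with
    | mem =>
      obtain ⟨i, hi⟩ := exists_var (ts 0)
      obtain ⟨k, hk⟩ := exists_var (ts 1)
      have key : ∀ (X : Fin p → Set (VRank lam)) x,
          @Language.BoundedFormula.Realize _ _ (rankStructure lam X) _ _
            (Language.BoundedFormula.rel (L := setLang p) (MemRel.mem : MemRel p 2) ts) default x ↔
          (x i).1 ∈ (x k).1 := fun X x => by
        change (@Language.Term.realize _ _ (rankStructure lam X) _ _ (ts 0)).1 ∈
          (@Language.Term.realize _ _ (rankStructure lam X) _ _ (ts 1)).1 ↔ _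
        rw [hi, hk]
        rfl
      rw [codes_congr (key X), codes_congr (key _)]
      exact g.ext_codes_rel (R := fun a b => a.1 ∈ b.1) (r := False) g.ext_relTriple_mem
        g.ext_relTriple_mem' (fun x => by simp [ZFSet.mem_irrefl]) i k
    | pred q =>
      obtain ⟨i, hi⟩ := exists_var (ts 0)
      have key : ∀ (X : Fin p → Set (VRank lam)) x,
          @Language.BoundedFormula.Realize _ _ (rankStructure lam X) _ _
            (Language.BoundedFormula.rel (L := setLang p) (MemRel.pred q : MemRel p 1) ts)
            default x ↔ x i ∈ X q := fun X x => by
        change (@Language.Term.realize _ _ (rankStructure lam X) _ _ (ts 0)) ∈ X q ↔ _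
        rw [hi]
        rfl
      rw [codes_congr (key X), codes_congr (key _)]
      exact g.ext_codes_mem (X q) i
  | imp φ ψ ih₁ ih₂ =>
    refine (congrArg _ (codes_imp _ _)).trans (Eq.trans ?_ (codes_imp _ _).symm)
    rw [g.ext_sdiff, g.ext_sdiff, ih₁, ih₂, g.ext_codes_true]
  | all φ ih =>
    refine (congrArg _ (codes_forall _)).trans (Eq.trans ?_ (codes_forall _).symm)
    rw [g.ext_sdiff, g.ext_dom hc, g.ext_sdiff, ih, g.ext_codes_true, g.ext_codes_true]

theorem Good.realize_iff (hc : CofOmega lam) {l : VRank lam → VRank lam} (g : Good l)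
    {p n : ℕ} (φ : (setLang p).Formula (Fin n)) (X : Fin p → Set (VRank lam))
    (x : Fin n → VRank lam) :
    @Language.Formula.Realize _ _ (rankStructure lam X) _ φ x ↔
      @Language.Formula.Realize _ _ (rankStructure lam fun i => extendEmb l (X i)) _ φ
        fun i => l (x i) := by
  have h := g.ext_codes_realize hc
    (Language.BoundedFormula.relabel (Sum.inr : Fin n → Empty ⊕ Fin n) φ) X
  have h1 := g.map_mem_ext (x := code x) (A := codes fun x =>
    @Language.BoundedFormula.Realize _ _ (rankStructure lam X) _ _
      (Language.BoundedFormula.relabel (Sum.inr : Fin n → Empty ⊕ Fin n) φ) default x)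
  have h2 : ∀ (X : Fin p → Set (VRank lam)) x,
      @Language.BoundedFormula.Realize _ _ (rankStructure lam X) _ _
        (Language.BoundedFormula.relabel (Sum.inr : Fin n → Empty ⊕ Fin n) φ) default x ↔
      @Language.Formula.Realize _ _ (rankStructure lam X) _ φ x := fun X x => by
    let _ := rankStructure lam X
    exact Language.Formula.realize_relabel_sumInr φ
  rw [h, g.map_code] at h1
  erw [code_mem_codes, code_mem_codes, h2, h2] at h1
  exact h1.symm

theorem Good.elem (hc : CofOmega lam) {l : VRank lam → VRank lam} (g : Good l) : Elem l := by
  refine Elem.of_forall fun n φ x => ?_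
  have := g.realize_iff hc φ Fin.elim0 x
  rw [show (fun i : Fin 0 => extendEmb l (Fin.elim0 i)) = Fin.elim0 from funext nofun] at this
  exact this.symm

/-- Elementary maps preserve first-order properties of subsets of `V_λ`. -/
theorem Good.iff (hc : CofOmega lam) {l : VRank lam → VRank lam} (g : Good l) {n p : ℕ}
    {P : (Fin n → VRank lam) → (Fin p → Set (VRank lam)) → Prop} (h : FODef P)
    (x : Fin n → VRank lam) (X : Fin p → Set (VRank lam)) :
    P x X ↔ P (fun i => l (x i)) fun i => extendEmb l (X i) := by
  obtain ⟨φ, hφ⟩ := h p id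
  exact (hφ X x).symm.trans ((g.realize_iff hc φ X x).trans (hφ _ _))

/-! ### Kunen's theorem -/

/-- `g` is (the graph of) an injection of `M` into itself. -/
def IsInjOn (g M : VRank lam) : Prop :=
  (∀ u : VRank lam, u.1 ∈ M.1 → ∃ v : VRank lam, v.1 ∈ M.1 ∧ (pair u v).1 ∈ g.1) ∧
  (∀ u v v' : VRank lam, (pair u v).1 ∈ g.1 → (pair u v').1 ∈ g.1 → v = v') ∧
  ∀ u u' v : VRank lam, (pair u v).1 ∈ g.1 → (pair u' v).1 ∈ g.1 → u = u'

/-- `e` is a function from `z` to `M`. -/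
def IsSeq (e M z : VRank lam) : Prop :=
  (∀ w : VRank lam, w.1 ∈ e.1 → ∃ n u : VRank lam, n.1 ∈ z.1 ∧ u.1 ∈ M.1 ∧ w = pair n u) ∧
  ∀ n : VRank lam, n.1 ∈ z.1 → ∃ u : VRank lam, (pair n u).1 ∈ e.1 ∧
    ∀ u' : VRank lam, (pair n u').1 ∈ e.1 → u' = u

/-- `e'` is the composition of `e` and `g`. -/
def IsComp (e g e' : VRank lam) : Prop :=
  ∀ w : VRank lam, w.1 ∈ e'.1 ↔
    ∃ n u v : VRank lam, ((pair n u).1 ∈ e.1 ∧ (pair u v).1 ∈ g.1) ∧ w = pair n v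

/-- `F` is a function on `z`-sequences of `M` whose restrictions to injective images of `M` are
surjective. -/
def IsJonsson (F M z : VRank lam) : Prop :=
  (∀ e y y' : VRank lam, (pair e y).1 ∈ F.1 → (pair e y').1 ∈ F.1 → y = y') ∧
  ∀ g : VRank lam, IsInjOn g M → ∀ y : VRank lam, y.1 ∈ M.1 → ∃ e e' : VRank lam,
    IsSeq e M z ∧ IsComp e g e' ∧ (pair e' y).1 ∈ F.1

theorem FODef.isJonsson {ι κ : Type} (i j k : ι) :
    FODef (lam := lam) (κ := κ) fun x _ => IsJonsson (x i) (x j) (x k) := by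
  refine and (all (all (all ?_))) (all (imp ?_ (all (imp (mem none (some (some j)))
    (ex (ex (and ?_ (and ?_ ?_))))))))
  · exact (pairMem (some (some none)) (some none) (some (some (some i)))).imp
      ((pairMem (some (some none)) none (some (some (some i)))).imp (eq (some none) none))
  · refine and (all ((mem none (some (some j))).imp (ex ((mem none (some (some (some j)))).and
      (pairMem (some none) none (some (some none))))))) (and (all (all (all ?_)))
      (all (all (all ?_))))
    · exact (pairMem (some (some none)) (some none) (some (some (some none)))).imp
        ((pairMem (some (some none)) none (some (some (some none)))).imp (eq (some none) none))
    · exact (pairMem (some (some none)) none (some (some (some none)))).imp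
        ((pairMem (some none) none (some (some (some none)))).imp (eq (some (some none)) (some none)))
  · refine and (all ((mem none (some (some none))).imp (ex (ex ?_))))
      (all ((mem none (some (some (some (some (some k)))))).imp (ex (and ?_ (all ?_)))))
    · exact (mem (some none) (some (some (some (some (some (some (some k)))))))).and
        ((mem none (some (some (some (some (some (some (some j)))))))).and
          (eqPair (some (some none)) (some none) none))
    · exact pairMem (some none) none (some (some (some none)))
    · exact (pairMem (some (some none)) none (some (some (some (some none))))).imp
        (eq none (some none))
  · exact all ((mem none (some none)).iff (ex (ex (ex
      (((pairMem (some (some none)) (some none) (some (some (some (some (some none)))))).and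
        (pairMem (some none) none (some (some (some (some (some (some (some none)))))))) ).and
          (eqPair (some (some (some none))) (some (some none)) none))))))
  · exact pairMem none (some (some none)) (some (some (some (some i))))

section Kunen

variable {j : VRank lam → VRank lam}

/-- The critical sequence of an embedding. -/
noncomputable def critSeq (j : VRank lam → VRank lam) (n : ℕ) : Ordinal.{u} :=
  (ordMap j)^[n] (critPt j)

theorem critSeq_succ (j : VRank lam → VRank lam) (n : ℕ) :
    critSeq j (n + 1) = ordMap j (critSeq j n) :=
  Function.iterate_succ_apply' _ _ _

theorem Elem.critSeq_lt (hj : Elem j) (hne : j ≠ id) (n : ℕ) : critSeq j n < lam := by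
  induction n with
  | zero => exact (hj.critPt_spec hne).1
  | succ n ih => rw [critSeq_succ]; exact ordMap_lt j ih

theorem Elem.critSeq_lt_succ (hj : Elem j) (hne : j ≠ id) (n : ℕ) :
    critSeq j n < critSeq j (n + 1) := by
  induction n with
  | zero => exact (hj.critPt_spec hne).2.1
  | succ n ih =>
    rw [critSeq_succ, critSeq_succ j (n + 1), hj.ordMap_lt_iff (hj.critSeq_lt hne n)
      (hj.critSeq_lt hne (n + 1))]
    exact ih

theorem Elem.critSeq_strictMono (hj : Elem j) (hne : j ≠ id) : StrictMono (critSeq j) :=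
  strictMono_nat_of_lt_succ (hj.critSeq_lt_succ hne)

theorem exists_isJonsson {μ : Ordinal.{u}} (hμ : μ < lam) {κ : ℕ → Ordinal.{u}}
    (hκ : StrictMono κ) (hsup : ∀ α, α < μ ↔ ∃ n, α < κ n) {z : VRank lam} (hz : IsOmega z) :
    ∃ F : VRank lam, IsJonsson F (lev μ hμ) z := by
  have hκμ : ∀ n, κ n < μ := fun n => (hsup _).2 ⟨n + 1, hκ n.lt_succ_self⟩
  have hlim : Order.IsSuccLimit μ := by
    refine ⟨fun h => ?_, fun α hα => ?_⟩
    · exact (hκμ 0).not_ge (h (hκμ 0).le)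
    · obtain ⟨n, hn⟩ := (hsup α).1 hα.lt
      exact hα.2 hn (hκμ n)
  have hω : Ordinal.omega0 ≤ μ := Ordinal.omega0_le_of_isSuccLimit hlim
  let M := lev μ hμ
  let T := {w : VRank lam // w.1 ∈ M.1}
  have hT : ∀ t : T, t.1.1.rank < μ := fun t => mem_lev.1 t.2
  have hinf : Infinite T := by
    refine Infinite.of_injective (fun n : ℕ => (⟨nat n, mem_lev.2 ?_⟩ : T)) fun m n h => ?_
    · rw [nat, Ordinal.rank_toZFSet]
      exact (Ordinal.natCast_lt_omega0 n).trans_le hω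
    · exact nat_injective (congrArg Subtype.val h)
  -- As the $\kappa_n$ are cofinal in $\mu$, the map $A\mapsto(A\cap V_{\kappa_n})_n$ injects the
  -- subsets of $V_\mu$ into its $\omega$-sequences.
  let e : Set T → ℕ → T := fun A n =>
    ⟨sep (lev (κ n) ((hκμ n).trans hμ)) fun w => ∃ h : w.1 ∈ M.1, (⟨w, h⟩ : T) ∈ A, mem_lev.2 (by
      refine lt_of_le_of_lt (ZFSet.subset_vonNeumann.1 ?_) (hκμ n)
      exact (subset_iff (y := lev (κ n) ((hκμ n).trans hμ))).2 fun w hw => (mem_sep.1 hw).1)⟩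
  have he : Function.Injective e := fun A B h => by
    ext ⟨w, hw⟩
    obtain ⟨n, hn⟩ := (hsup _).1 (mem_lev.1 hw)
    have h1 := congrArg (fun f => w.1 ∈ (f n).1.1) h
    simp only [e, mem_sep, mem_lev, hn, hw, true_and, exists_true_left] at h1
    exact iff_of_eq h1
  obtain ⟨F, hF⟩ := exists_jonsson he
  have hseq : ∀ t : ℕ → T, ∃ s : VRank lam,
      s.1 ⊆ M.1 ∧ ∀ w : VRank lam, w.1 ∈ s.1 ↔ ∃ n, w = pair (nat n) (t n).1 := fun t => by
    obtain ⟨s, hs⟩ := exists_of_rank_lt hμ (fun w => ∃ n, w = pair (nat n) (t n).1) (by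
      rintro _ ⟨n, rfl⟩
      refine rank_pair_lt hlim ?_ (hT _)
      rw [nat, Ordinal.rank_toZFSet]
      exact (Ordinal.natCast_lt_omega0 n).trans_le hω)
    refine ⟨s, subset_iff.2 fun w hw => ?_, hs⟩
    obtain ⟨n, rfl⟩ := (hs w).1 hw
    refine mem_lev.2 (rank_pair_lt hlim ?_ (hT _))
    rw [nat, Ordinal.rank_toZFSet]
    exact (Ordinal.natCast_lt_omega0 n).trans_le hω
  choose s hsM hs using hseq
  have hsmem : ∀ t n u, (pair (nat n) u).1 ∈ (s t).1 ↔ u = (t n).1 := fun t n u => by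
    rw [hs]
    constructor
    · rintro ⟨m, h⟩
      rw [pair_inj] at h
      rw [h.2, nat_injective h.1]
    · rintro rfl; exact ⟨n, rfl⟩
  have hsinj : Function.Injective s := fun t t' h => funext fun n =>
    Subtype.ext ((hsmem t' n _).1 (h ▸ (hsmem t n _).2 rfl))
  obtain ⟨q, hq⟩ := exists_pow M
  obtain ⟨p, hp⟩ := exists_prod q M
  refine ⟨sep p fun w => ∃ t, w = pair (s t) (F t).1, ?_, ?_⟩
  · intro x y y' h h'
    obtain ⟨-, t, ht⟩ := mem_sep.1 h
    obtain ⟨-, t', ht'⟩ := mem_sep.1 h'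
    rw [pair_inj] at ht ht'
    rw [ht.2, ht'.2, hsinj (ht.1.symm.trans ht'.1)]
  · rintro g ⟨hg1, hg2, hg3⟩ y hy
    choose f hfM hfg using hg1
    let f' : T → T := fun t => ⟨f t.1 t.2, hfM t.1 t.2⟩
    have hf' : Function.Injective f' := fun a b h => by
      have h' : f a.1 a.2 = f b.1 b.2 := congrArg Subtype.val h
      exact Subtype.ext (hg3 _ _ _ (hfg a.1 a.2) (h' ▸ hfg b.1 b.2))
    obtain ⟨t, ht⟩ := hF f' hf' ⟨y, hy⟩
    refine ⟨s t, s (f' ∘ t), ⟨fun w hw => ?_, fun n hn => ?_⟩, fun w => ?_, ?_⟩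
    · obtain ⟨n, rfl⟩ := (hs t w).1 hw
      exact ⟨nat n, _, (hz.mem_iff _).2 ⟨n, rfl⟩, (t n).2, rfl⟩
    · obtain ⟨m, rfl⟩ := (hz.mem_iff n).1 hn
      exact ⟨(t m).1, (hsmem t m _).2 rfl, fun u' hu' => (hsmem t m u').1 hu'⟩
    · rw [hs]
      constructor
      · rintro ⟨n, rfl⟩
        exact ⟨nat n, (t n).1, _, ⟨(hsmem t n _).2 rfl, hfg _ _⟩, rfl⟩
      · rintro ⟨n, u, v, ⟨hnu, huv⟩, rfl⟩
        obtain ⟨m, hm⟩ := (hs t _).1 hnu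
        obtain ⟨rfl, rfl⟩ := pair_inj.1 hm
        exact ⟨m, by rw [hg2 _ _ _ huv (hfg _ (t m).2)]; rfl⟩
    · rw [mem_sep]
      refine ⟨(hp _).2 ⟨_, _, (hq _).2 (hsM _), hy, rfl⟩, f' ∘ t, ?_⟩
      rw [ht]

/-- Kunen's theorem: the critical sequence of a nontrivial embedding is cofinal in `λ`. -/
theorem Elem.exists_lt_critSeq (hj : Elem j) (hne : j ≠ id) {α : Ordinal.{u}} (hα : α < lam) :
    ∃ n, α < critSeq j n := by
  by_contra! hbd
  have hmono := hj.critSeq_strictMono hne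
  let μ := ⨆ n, critSeq j n
  have hsup : ∀ β, β < μ ↔ ∃ n, β < critSeq j n := fun β => Ordinal.lt_iSup_iff
  have hμ : μ < lam := (Ordinal.iSup_le hbd).trans_lt hα
  have hω := hj.omega0_lt hne
  obtain ⟨z, hz⟩ := exists_isOmega hω
  obtain ⟨F, hF⟩ := exists_isJonsson hμ hmono hsup hz
  have g := hj.good
  -- The map $j$ shifts the critical sequence and commutes with countable unions.
  have hjM : j (lev μ hμ) = lev μ hμ := by
    refine ext_mem fun w => ?_
    rw [g.map_iUnion hω (s := fun n => lev (critSeq j n) (hj.critSeq_lt hne n)) (fun w => by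
      simp only [mem_lev]; exact hsup _) w]
    simp only [hj.map_lev, mem_lev, ← critSeq_succ, hsup]
    exact ⟨fun ⟨n, h⟩ => ⟨n + 1, h⟩, fun ⟨n, h⟩ => ⟨n, h.trans (hmono n.lt_succ_self)⟩⟩
  have hjF := (hj.iff₃ (R := IsJonsson) (FODef.isJonsson 0 1 2) F (lev μ hμ) z).1 hF
  rw [hjM, (g.omega z hz).1] at hjF
  obtain ⟨hκ, hκ', hfix⟩ := hj.critPt_spec hne
  have hjmem : ∀ u : VRank lam, u.1 ∈ (lev μ hμ).1 → (j u).1 ∈ (lev μ hμ).1 := fun u hu => by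
    rw [← hjM, hj.mem_iff]; exact hu
  obtain ⟨p, hp⟩ := exists_prod (lev μ hμ) (lev μ hμ)
  -- The injection $j\restriction V_\mu$, a set in $V_\lambda$. Since $j(F)$ is again a Jónsson
  -- function on $V_\mu$, it takes the value $V_{\operatorname{crit}(j)}$ at some $j\circ e$.
  let G := sep p fun w => ∃ u, w = pair u (j u)
  have hG : ∀ u v : VRank lam, (pair u v).1 ∈ G.1 ↔ u.1 ∈ (lev μ hμ).1 ∧ v = j u := by
    intro u v
    rw [mem_sep]
    constructor
    · rintro ⟨h1, u', h2⟩
      obtain ⟨a, b, ha, hb, e⟩ := (hp _).1 h1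
      rw [pair_inj] at e h2
      rw [e.1, h2.2, ← h2.1, e.1]
      exact ⟨ha, rfl⟩
    · rintro ⟨hu, rfl⟩
      exact ⟨(hp _).2 ⟨u, _, hu, hjmem u hu, rfl⟩, u, rfl⟩
  have hy : (lev (critPt j) hκ).1 ∈ (lev μ hμ).1 := by
    rw [mem_lev, hsup]
    exact ⟨1, by simpa [lev, critSeq] using hκ'⟩
  obtain ⟨e, e', he, hee', hmem⟩ := hjF.2 G
    ⟨fun u hu => ⟨j u, hjmem u hu, (hG _ _).2 ⟨hu, rfl⟩⟩,
      fun u v v' h h' => ((hG _ _).1 h).2.trans ((hG _ _).1 h').2.symm,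
      fun u u' v h h' => hj.injective (((hG _ _).1 h).2.symm.trans ((hG _ _).1 h').2)⟩
    _ hy
  -- As $j$ fixes every natural number, $j\circ e=j(e)$ for an $\omega$-sequence $e$.
  have hje : j e = e' := by
    have hnat : ∀ n : ℕ, (nat n : VRank lam).1 ∈ z.1 := fun n => (hz.mem_iff _).2 ⟨n, rfl⟩
    choose t ht1 ht2 using fun n => he.2 (nat n) (hnat n)
    choose s hs using fun n => exists_sing (pair (nat n) (t n))
    refine ext_mem fun w => ?_
    rw [g.map_iUnion hω (s := s) (fun w => by
      simp only [hs]
      constructor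
      · intro hw
        obtain ⟨n, u, hn, -, rfl⟩ := he.1 w hw
        obtain ⟨m, rfl⟩ := (hz.mem_iff n).1 hn
        exact ⟨m, by rw [ht2 m u hw]⟩
      · rintro ⟨n, rfl⟩; exact ht1 n) w, hee' w]
    constructor
    · rintro ⟨n, hn⟩
      rw [g.map_sing (hs n), g.map_pair, (g.omega z hz).2 _ (hnat n)] at hn
      refine ⟨nat n, t n, j (t n), ⟨ht1 n, (hG _ _).2 ⟨?_, rfl⟩⟩, hn⟩
      obtain ⟨n', u, -, hu, e⟩ := he.1 _ (ht1 n)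
      rw [(pair_inj.1 e).2]; exact hu
    · rintro ⟨n, u, v, ⟨hnu, huv⟩, rfl⟩
      obtain ⟨n', u', hn', -, e⟩ := he.1 _ hnu
      obtain ⟨rfl, rfl⟩ := pair_inj.1 e
      obtain ⟨m, rfl⟩ := (hz.mem_iff n).1 hn'
      refine ⟨m, (g.map_sing (hs m) _).2 ?_⟩
      rw [g.map_pair, (g.omega z hz).2 _ (hnat m), ((hG _ _).1 huv).2, ht2 m u hnu]
  rw [← hje] at hmem
  -- Now $V_{\operatorname{crit}(j)}=j(F)(j(e))=j(F(e))$ would be in the range of $j$, although no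
  -- ordinal is sent to the critical point.
  obtain ⟨y, hy⟩ := (hj.iff₂ (R := fun e F : VRank lam => ∃ y, (pair e y).1 ∈ F.1)
    (FODef.ex (FODef.pairMem (some 0) none (some 1))) e F).2 ⟨_, hmem⟩
  have hy' : (pair (j e) (j y)).1 ∈ (j F).1 := by rw [← hj.map_pair, hj.mem_iff]; exact hy
  have hyeq := hjF.1 _ _ _ hmem hy'
  obtain ⟨β, hβ, rfl⟩ := isLev_iff.1 ((hj.iff₁ (R := IsLev) (FODef.isLev 0) y).2
    (isLev_iff.2 ⟨_, hκ, hyeq.symm⟩))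
  rw [hj.map_lev, lev_inj] at hyeq
  rcases lt_or_ge β (critPt j) with hlt | hge
  · rw [hfix β hlt] at hyeq
    exact hlt.ne' hyeq
  · exact (hκ'.trans_le ((hj.ordMap_le_iff hκ hβ).2 hge)).ne hyeq

theorem Elem.cofOmega (hj : Elem j) (hne : j ≠ id) : CofOmega lam :=
  ⟨hj.omega0_lt hne, critSeq j, hj.critSeq_lt hne, fun _ hα => hj.exists_lt_critSeq hne hα⟩

/-- An embedding maps some ordinal below `θ` to or beyond `θ` if its critical point is below `θ`. -/
theorem Elem.exists_le_ordMap (hj : Elem j) (hne : j ≠ id) {θ : Ordinal.{u}} (hθ : θ < lam)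
    (h : critPt j < θ) : ∃ σ < θ, θ ≤ ordMap j σ := by
  by_contra! hlt
  obtain ⟨n, hn⟩ := hj.exists_lt_critSeq hne hθ
  have : ∀ n, critSeq j n < θ := fun n => by
    induction n with
    | zero => exact h
    | succ n ih => rw [critSeq_succ]; exact hlt _ ih
  exact (this n).not_gt hn

end Kunen

/-! ### The $\Sigma^1_m$ hierarchy of predicates -/

theorem FODef.exs {ι κ β : Type} [Finite β]
    {P : (ι → VRank lam) → (κ → Set (VRank lam)) → (β → VRank lam) → Prop}
    (h : FODef fun (x : ι ⊕ β → VRank lam) X => P (fun i => x (.inl i)) X fun b => x (.inr b)) :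
    FODef fun x X => ∃ y, P x X y := fun p g => by
  obtain ⟨φ, hφ⟩ := h p g
  refine ⟨φ.iExs β, fun X x => ?_⟩
  let _ := rankStructure lam X
  rw [Language.Formula.realize_iExs]
  simp only [hφ X]
  rfl

/-- Reindexing of predicate symbols. -/
def setLangMap {p q : ℕ} (g : Fin p → Fin q) : setLang p →ᴸ setLang q where
  onFunction := fun _ f => nomatch f
  onRelation := fun _ r => match r with
    | .mem => (.mem : MemRel q 2)
    | .pred i => (.pred (g i) : MemRel q 1)

theorem FODef.of_formula {n p : ℕ} (φ : (setLang p).Formula (Fin n)) :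
    FODef (lam := lam) fun x X =>
      @Language.Formula.Realize (setLang p) (VRank lam) (rankStructure lam X) _ φ x := fun q g => by
  refine ⟨(setLangMap g).onFormula φ, fun X x => ?_⟩
  let _ := rankStructure lam X
  let _ := rankStructure lam fun i => X (g i)
  have : (setLangMap g).IsExpansionOn (VRank lam) :=
    ⟨fun f => (nomatch f), fun R x => by cases R <;> rfl⟩
  exact Language.LHom.realize_onFormula (setLangMap g) φ

/-- `Lev true m P` says that `P` is `Σ¹_m` over `V_λ`, and `Lev false m P` that `P` is `Π¹_m`. -/
def Lev : Bool → ℕ → ∀ {κ : Type}, ((κ → Set (VRank lam)) → Prop) → Prop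
  | _, 0, κ, P => FODef (ι := Empty) (κ := κ) fun _ X => P X
  | true, m + 1, κ, P => ∃ (β : Type) (_ : Finite β) (R : (κ ⊕ β → Set (VRank lam)) → Prop),
      Lev false m R ∧ ∀ E, P E ↔ ∃ Y : β → Set (VRank lam), R (Sum.elim E Y)
  | false, m + 1, κ, P => ∃ (β : Type) (_ : Finite β) (R : (κ ⊕ β → Set (VRank lam)) → Prop),
      Lev true m R ∧ ∀ E, P E ↔ ∀ Y : β → Set (VRank lam), R (Sum.elim E Y)

namespace Lev

variable {κ κ' : Type} {b : Bool} {m : ℕ} {P Q : (κ → Set (VRank lam)) → Prop}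

theorem congr (h : Lev b m P) (e : ∀ E, Q E ↔ P E) : Lev b m Q := by
  rwa [show Q = P from funext fun E => propext (e E)]

theorem rename (h : Lev b m P) (f : κ → κ') : Lev b m fun E => P fun k => E (f k) := by
  induction m generalizing b κ κ' with
  | zero => cases b <;> exact FODef.rename (ι' := Empty) h id f
  | succ m ih =>
    cases b
    all_goals
      obtain ⟨β, hβ, R, hR, e⟩ := h
      refine ⟨β, hβ, _, ih hR (Sum.map f id), fun E => (e _).trans ?_⟩
    · refine forall_congr' fun Y => iff_of_eq (congrArg R ?_)
      funext k; rcases k with k | k <;> rfl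
    · refine exists_congr fun Y => iff_of_eq (congrArg R ?_)
      funext k; rcases k with k | k <;> rfl

theorem not (h : Lev b m P) : Lev (!b) m fun E => ¬ P E := by
  induction m generalizing b κ with
  | zero => cases b <;> exact FODef.not h
  | succ m ih =>
    cases b
    all_goals
      obtain ⟨β, hβ, R, hR, e⟩ := h
      exact ⟨β, hβ, _, ih hR, fun E => (not_congr (e E)).trans (by simp)⟩

theorem switch (h : Lev b m P) : Lev (!b) (m + 1) P := by
  cases b
  · exact ⟨Empty, inferInstance, _, h.rename Sum.inl, fun E => by simp⟩
  · exact ⟨Empty, inferInstance, _, h.rename Sum.inl, fun E => by simp⟩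

theorem succ (h : Lev b m P) : Lev b (m + 1) P := by
  induction m generalizing b κ with
  | zero =>
    cases b
    · exact switch (b := true) (m := 0) (P := P) h
    · exact switch (b := false) (m := 0) (P := P) h
  | succ m ih =>
    cases b
    all_goals
      obtain ⟨β, hβ, R, hR, e⟩ := h
      exact ⟨β, hβ, R, ih hR, e⟩

theorem mono (h : Lev b m P) {n : ℕ} (hn : m ≤ n) : Lev b n P := by
  induction n, hn using Nat.le_induction with
  | base => exact h
  | succ n _ ih => exact ih.succ

theorem fo (b : Bool) (m : ℕ) (h : FODef (ι := Empty) fun _ X => P X) : Lev b m P :=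
  mono (m := 0) (by cases b <;> exact h) (Nat.zero_le m)

theorem and (h : Lev b m P) (h' : Lev b m Q) : Lev b m fun E => P E ∧ Q E := by
  induction m generalizing b κ with
  | zero => cases b <;> exact FODef.and h h'
  | succ m ih =>
    cases b
    all_goals
      obtain ⟨β, hβ, R, hR, e⟩ := h
      obtain ⟨β', hβ', R', hR', e'⟩ := h'
      refine ⟨β ⊕ β', inferInstance, _, ih (hR.rename (Sum.map id Sum.inl))
        (hR'.rename (Sum.map id Sum.inr)), fun E => ?_⟩
      have h1 : ∀ Y : β ⊕ β' → Set (VRank lam),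
          (fun k => Sum.elim E Y (Sum.map id Sum.inl k)) = Sum.elim E fun k => Y (.inl k) :=
        fun Y => by funext k; rcases k with k | k <;> rfl
      have h2 : ∀ Y : β ⊕ β' → Set (VRank lam),
          (fun k => Sum.elim E Y (Sum.map id Sum.inr k)) = Sum.elim E fun k => Y (.inr k) :=
        fun Y => by funext k; rcases k with k | k <;> rfl
      simp only [e, e', h1, h2]
    · exact ⟨fun h Y => ⟨h.1 _, h.2 _⟩,
        fun h => ⟨fun Y => (h (Sum.elim Y fun _ => ∅)).1, fun Y => (h (Sum.elim (fun _ => ∅) Y)).2⟩⟩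
    · exact ⟨fun ⟨⟨Y, hY⟩, Y', hY'⟩ => ⟨Sum.elim Y Y', hY, hY'⟩,
        fun ⟨Y, h, h'⟩ => ⟨⟨_, h⟩, _, h'⟩⟩

theorem or (h : Lev b m P) (h' : Lev b m Q) : Lev b m fun E => P E ∨ Q E := by
  have := (h.not.and h'.not).not
  rw [Bool.not_not] at this
  exact this.congr fun E => by tauto

theorem exs {β : Type} [Finite β] {P : (κ → Set (VRank lam)) → (β → Set (VRank lam)) → Prop}
    (h : Lev true (m + 1) fun E : κ ⊕ β → Set (VRank lam) =>
      P (fun k => E (.inl k)) fun k => E (.inr k)) :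
    Lev true (m + 1) fun E => ∃ Y, P E Y := by
  obtain ⟨γ, hγ, R, hR, e⟩ := h
  refine ⟨β ⊕ γ, inferInstance, _, hR.rename (Equiv.sumAssoc κ β γ), fun E => ?_⟩
  have h1 : ∀ (Y : β → Set (VRank lam)) (Z : γ → Set (VRank lam)),
      (fun k => Sum.elim E (Sum.elim Y Z) ((Equiv.sumAssoc κ β γ) k)) =
        Sum.elim (Sum.elim E Y) Z := fun Y Z => by
    funext k; rcases k with (k | k) | k <;> rfl
  constructor
  · rintro ⟨Y, hY⟩
    obtain ⟨Z, hZ⟩ := (e (Sum.elim E Y)).1 hY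
    exact ⟨Sum.elim Y Z, by rw [h1]; exact hZ⟩
  · rintro ⟨Y, hY⟩
    rw [← Sum.elim_comp_inl_inr Y, h1] at hY
    exact ⟨_, (e (Sum.elim E _)).2 ⟨_, hY⟩⟩

theorem alls {β : Type} [Finite β] {P : (κ → Set (VRank lam)) → (β → Set (VRank lam)) → Prop}
    (h : Lev false (m + 1) fun E : κ ⊕ β → Set (VRank lam) =>
      P (fun k => E (.inl k)) fun k => E (.inr k)) :
    Lev false (m + 1) fun E => ∀ Y, P E Y :=
  (not (exs (P := fun E Y => ¬ P E Y) h.not)).congr fun E => by simp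

theorem ex {P : (κ → Set (VRank lam)) → Set (VRank lam) → Prop}
    (h : Lev true (m + 1) fun E : κ ⊕ Unit → Set (VRank lam) =>
      P (fun k => E (.inl k)) (E (.inr ()))) :
    Lev true (m + 1) fun E => ∃ Y, P E Y :=
  (exs (P := fun E Y => P E (Y ())) h).congr fun _ =>
    ⟨fun ⟨Y, hY⟩ => ⟨fun _ => Y, hY⟩, fun ⟨Y, hY⟩ => ⟨Y (), hY⟩⟩

theorem all {P : (κ → Set (VRank lam)) → Set (VRank lam) → Prop}
    (h : Lev false (m + 1) fun E : κ ⊕ Unit → Set (VRank lam) =>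
      P (fun k => E (.inl k)) (E (.inr ()))) :
    Lev false (m + 1) fun E => ∀ Y, P E Y :=
  (not (ex (P := fun E Y => ¬ P E Y) h.not)).congr fun E => by simp

theorem forall_list {α : Type*} {R : α → (κ → Set (VRank lam)) → Prop} (L : List α)
    (h : ∀ a ∈ L, Lev b m (R a)) : Lev b m fun E => ∀ a ∈ L, R a E := by
  induction L with
  | nil => exact (fo b m FODef.true').congr fun E => by simp
  | cons a L ih =>
    exact ((h a (by simp)).and (ih fun c hc => h c (by simp [hc]))).congr fun E => by simp

end Lev

/-! ### Translation between predicates and formulas -/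

/-- The `q` new quantifiers bind the variables with index below `q`, which is why the free ones sit
at `i.addNat q`. -/
theorem exists_quantified {m p q : ℕ} {φ : SOFormula 0 (p + q)}
    (h : φ.IsLevel true (m + 1)) : ∃ ψ : SOFormula 0 p, ψ.IsLevel true (m + 1) ∧
      ∀ (x : Fin 0 → VRank lam) (X : Fin p → Set (VRank lam)), ψ.Sat x X ↔
        ∃ Z : Fin (p + q) → Set (VRank lam), (∀ i : Fin p, Z (i.addNat q) = X i) ∧ φ.Sat x Z := by
  induction q with
  | zero =>
    refine ⟨φ, h, fun x X => ⟨fun hX => ⟨X, fun i => rfl, hX⟩, ?_⟩⟩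
    rintro ⟨Z, hZ, hφ⟩
    rwa [show X = Z from funext fun i => (hZ i).symm]
  | succ q ih =>
    obtain ⟨ψ, hψ, e⟩ := ih (φ := .ex φ) (.ex h)
    refine ⟨ψ, hψ, fun x X => (e x X).trans ?_⟩
    constructor
    · rintro ⟨Z, hZ, Y, hY⟩
      exact ⟨_, fun i => hZ i, hY⟩
    · rintro ⟨Z, hZ, hφ⟩
      refine ⟨fun i => Z i.succ, fun i => hZ i, Z 0, ?_⟩
      have : (Fin.cons (Z 0) fun i => Z i.succ : Fin (p + q + 1) → Set (VRank lam)) = Z :=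
        Fin.cons_self_tail Z
      rw [this]
      exact hφ

theorem exists_quantified_all {m p q : ℕ} {φ : SOFormula 0 (p + q)}
    (h : φ.IsLevel false (m + 1)) : ∃ ψ : SOFormula 0 p, ψ.IsLevel false (m + 1) ∧
      ∀ (x : Fin 0 → VRank lam) (X : Fin p → Set (VRank lam)), ψ.Sat x X ↔
        ∀ Z : Fin (p + q) → Set (VRank lam), (∀ i : Fin p, Z (i.addNat q) = X i) → φ.Sat x Z := by
  induction q with
  | zero =>
    refine ⟨φ, h, fun x X => ⟨fun hX Z hZ => ?_, fun hX => hX X fun i => rfl⟩⟩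
    rwa [show Z = X from funext fun i => hZ i]
  | succ q ih =>
    obtain ⟨ψ, hψ, e⟩ := ih (φ := .all φ) (.all h)
    refine ⟨ψ, hψ, fun x X => (e x X).trans ?_⟩
    constructor
    · intro hX Z hZ
      have := hX (fun i => Z i.succ) (fun i => hZ i) (Z 0)
      rwa [show (Fin.cons (Z 0) fun i => Z i.succ : Fin (p + q + 1) → Set (VRank lam)) = Z from
        Fin.cons_self_tail Z] at this
    · intro hX Z hZ Y
      exact hX _ fun i => hZ i

theorem exists_merge {p q : ℕ} (X : Fin p → Set (VRank lam)) (Y : Fin q → Set (VRank lam)) :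
    ∃ Z : Fin (p + q) → Set (VRank lam), (∀ i : Fin p, Z (i.addNat q) = X i) ∧
      ∀ i : Fin q, Z (i.castLE (Nat.le_add_left q p)) = Y i := by
  refine ⟨fun i => if h : i.1 < q then Y ⟨i.1, h⟩ else X ⟨i.1 - q, by omega⟩, fun i => ?_,
    fun i => ?_⟩
  · simp
  · simp

theorem Lev.exists_formula {b : Bool} {m : ℕ} {κ : Type} {P : (κ → Set (VRank lam)) → Prop}
    (h : Lev b m P) {p : ℕ} (g : κ → Fin p) : ∃ φ : SOFormula 0 p, φ.IsLevel b m ∧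
      ∀ (x : Fin 0 → VRank lam) (X : Fin p → Set (VRank lam)),
        φ.Sat x X ↔ P fun k => X (g k) := by
  induction m generalizing b κ p with
  | zero =>
    have h' : FODef (ι := Empty) fun _ X => P X := by cases b <;> exact h
    obtain ⟨φ, hφ⟩ := (h'.rename (nofun : Empty → Fin 0) id) p g
    exact ⟨.fo φ, .fo b φ, fun x X => hφ X x⟩
  | succ m ih =>
    cases b
    all_goals
      obtain ⟨β, hβ, R, hR, e⟩ := h
      obtain ⟨q, ⟨f⟩⟩ := Finite.exists_equiv_fin β
      obtain ⟨φ, hφ, e'⟩ := ih hR (p := p + q)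
        (Sum.elim (fun k => (g k).addNat q) fun k => (f k).castLE (Nat.le_add_left q p))
    · obtain ⟨ψ, hψ, e''⟩ := exists_quantified_all (lam := lam) (.switch hφ)
      refine ⟨ψ, hψ, fun x X => (e'' x X).trans (Iff.trans ?_ (e _).symm)⟩
      constructor
      · intro hX Y
        obtain ⟨Z, hZ, hZ'⟩ := exists_merge X fun i => Y (f.symm i)
        refine (iff_of_eq (congrArg R ?_)).1 ((e' x Z).1 (hX Z hZ))
        funext k
        rcases k with k | k
        · exact hZ _
        · simpa using hZ' (f k)
      · intro hX Z hZ
        refine (e' x Z).2 ((iff_of_eq (congrArg R ?_)).1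
          (hX fun k => Z ((f k).castLE (Nat.le_add_left q p))))
        funext k
        rcases k with k | k
        · exact (hZ _).symm
        · rfl
    · obtain ⟨ψ, hψ, e''⟩ := exists_quantified (lam := lam) (.switch hφ)
      refine ⟨ψ, hψ, fun x X => (e'' x X).trans (Iff.trans ?_ (e _).symm)⟩
      constructor
      · rintro ⟨Z, hZ, h⟩
        refine ⟨fun k => Z ((f k).castLE (Nat.le_add_left q p)),
          (iff_of_eq (congrArg R ?_)).1 ((e' x Z).1 h)⟩
        funext k
        rcases k with k | k
        · exact hZ _
        · rfl
      · rintro ⟨Y, hY⟩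
        obtain ⟨Z, hZ, hZ'⟩ := exists_merge X fun i => Y (f.symm i)
        refine ⟨Z, hZ, (e' x Z).2 ((iff_of_eq (congrArg R ?_)).1 hY)⟩
        funext k
        rcases k with k | k
        · exact (hZ _).symm
        · simpa using (hZ' (f k)).symm

/-- The extension of $l$ sends $\{x\}$ to $\{l(x)\}$, so first-order parameters are traded for
singletons and only class variables remain to be studied. -/
theorem exists_lev {n p m : ℕ} {b : Bool} {φ : SOFormula n p} (h : φ.IsLevel b m) :
    ∃ P : (Fin p ⊕ Fin n → Set (VRank lam)) → Prop, Lev b m P ∧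
      ∀ x X, P (Sum.elim X fun i => {x i}) ↔ φ.Sat x X := by
  induction h with
  | @fo b p φ =>
    refine ⟨fun E => ∃ x : Fin n → VRank lam, (∀ i, x i ∈ E (.inr i)) ∧
      (SOFormula.fo φ).Sat x fun i => E (.inl i), .fo b 0 (FODef.exs ?_), fun x X => ?_⟩
    · exact (FODef.forall_fin fun i => FODef.pred (Sum.inr i) (Sum.inr i)).and
        ((FODef.of_formula φ).rename Sum.inr Sum.inl)
    · constructor
      · rintro ⟨y, hy, h⟩
        rwa [show x = y from funext fun i => (hy i).symm]
      · exact fun h => ⟨x, fun i => rfl, h⟩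
  | switch _ ih =>
    obtain ⟨P, hP, e⟩ := ih
    exact ⟨P, hP.switch, e⟩
  | @ex m p φ _ ih =>
    obtain ⟨P, hP, e⟩ := ih
    refine ⟨_, Lev.ex (P := fun E Y => P (Sum.elim (Fin.cons Y fun i => E (.inl i))
      fun i => E (.inr i))) ((hP.rename (Sum.elim (Fin.cons (.inr ()) fun i => .inl (.inl i))
        fun i => .inl (.inr i))).congr fun E => iff_of_eq (congrArg P ?_)),
        fun x X => exists_congr fun Y => e x _⟩
    funext k
    rcases k with k | k
    · cases k using Fin.cases <;> rfl
    · rfl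
  | @all m p φ _ ih =>
    obtain ⟨P, hP, e⟩ := ih
    refine ⟨_, Lev.all (P := fun E Y => P (Sum.elim (Fin.cons Y fun i => E (.inl i))
      fun i => E (.inr i))) ((hP.rename (Sum.elim (Fin.cons (.inr ()) fun i => .inl (.inl i))
        fun i => .inl (.inr i))).congr fun E => iff_of_eq (congrArg P ?_)),
        fun x X => forall_congr' fun Y => e x _⟩
    funext k
    rcases k with k | k
    · cases k using Fin.cases <;> rfl
    · rfl

/-! ### Inverse limits -/

section InverseLimits

theorem Good.comp (hc : CofOmega lam) {l l' : VRank lam → VRank lam} (g : Good l) (g' : Good l') :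
    Good (l ∘ l') := by
  obtain ⟨e, rfl⟩ := g.elem hc
  obtain ⟨e', rfl⟩ := g'.elem hc
  exact Elem.good ⟨e.comp e', rfl⟩

theorem Good.ext_comp (hc : CofOmega lam) {l l' : VRank lam → VRank lam} (g : Good l)
    (g' : Good l') (A : Set (VRank lam)) :
    extendEmb (l ∘ l') A = extendEmb l (extendEmb l' A) := by
  have h : ∀ A, extendEmb (l ∘ l') A ⊆ extendEmb l (extendEmb l' A) := by
    intro A y hy
    obtain ⟨a, ha, hy⟩ := (g.comp hc g').mem_ext.1 hy
    exact g.mem_ext.2 ⟨l' a, fun w hw => g'.mem_ext.2 ⟨a, ha, hw⟩, hy⟩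
  refine (h A).antisymm fun y hy => ?_
  by_contra hn
  have := h Aᶜ (by rw [(g.comp hc g').ext_compl]; exact hn)
  rw [g'.ext_compl, g.ext_compl] at this
  exact this hy

theorem good_id : Good (id : VRank lam → VRank lam) :=
  Elem.good ⟨Language.ElementaryEmbedding.refl _ _, rfl⟩

theorem good_compUpTo (hc : CofOmega lam) {k : ℕ → VRank lam → VRank lam} (g : ∀ n, Good (k n)) :
    ∀ n, Good (compUpTo k n)
  | 0 => g 0
  | n + 1 => (good_compUpTo hc g n).comp hc (g (n + 1))

theorem compUpTo_succ (k : ℕ → VRank lam → VRank lam) (n : ℕ) :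
    compUpTo k (n + 1) = k 0 ∘ compUpTo (fun i => k (i + 1)) n := by
  induction n with
  | zero => rfl
  | succ n ih =>
    rw [compUpTo, ih, compUpTo]
    rfl

/-- `K` is the pointwise eventual value of the finite compositions of `k`. -/
def Lim (k : ℕ → VRank lam → VRank lam) (K : VRank lam → VRank lam) : Prop :=
  ∀ a, ∃ N, ∀ n, N ≤ n → compUpTo k n a = K a

/-- A sequence of embeddings that fix larger and larger parts `B n` of `V_λ` pointwise. -/
structure Chain (k : ℕ → VRank lam → VRank lam) (B : ℕ → Set (VRank lam)) : Prop where
  good : ∀ n, Good (k n)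
  fix : ∀ n, ∀ b ∈ B n, k n b = b
  ext : ∀ n, extendEmb (k n) (B n) = B n
  eventually : ∀ a : VRank lam, ∃ N, ∀ n, N ≤ n →
    a ∈ B n ∧ ∀ w : VRank lam, w.1 ∈ a.1 → w ∈ B n

variable {k l : ℕ → VRank lam → VRank lam} {K L : VRank lam → VRank lam}
  {B : ℕ → Set (VRank lam)}

theorem Chain.exists_lim (c : Chain k B) : ∃ K, Lim k K := by
  have : ∀ a, ∃ y, ∃ N, ∀ n, N ≤ n → compUpTo k n a = y := by
    intro a
    obtain ⟨N, hN⟩ := c.eventually a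
    refine ⟨compUpTo k N a, N, fun n hn => ?_⟩
    induction n, hn using Nat.le_induction with
    | base => rfl
    | succ n hn ih =>
      rw [← ih, compUpTo, Function.comp_apply, c.fix _ _ (hN (n + 1) (by omega)).1]
  choose K hK using this
  exact ⟨K, hK⟩

theorem Chain.shift (c : Chain k B) (s : ℕ) :
    Chain (fun n => k (n + s)) fun n => B (n + s) where
  good n := c.good _
  fix n := c.fix _
  ext n := c.ext _
  eventually a := by
    obtain ⟨N, hN⟩ := c.eventually a
    exact ⟨N, fun n hn => hN _ (by omega)⟩

theorem Lim.unique (h : Lim k K) (h' : Lim k L) : K = L := by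
  funext a
  obtain ⟨N, hN⟩ := h a
  obtain ⟨N', hN'⟩ := h' a
  rw [← hN (max N N') (le_max_left _ _), hN' _ (le_max_right _ _)]

theorem Lim.cons (h : Lim (fun n => k (n + 1)) K) : Lim k (k 0 ∘ K) := by
  intro a
  obtain ⟨N, hN⟩ := h a
  refine ⟨N + 1, fun n hn => ?_⟩
  obtain ⟨n, rfl⟩ : ∃ m, n = m + 1 := ⟨n - 1, by omega⟩
  rw [compUpTo_succ, Function.comp_apply, Function.comp_apply, hN n (by omega)]

theorem Lim.shift_eq {n : ℕ} (h : Lim (fun i => k (i + n)) K)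
    (h' : Lim (fun i => k (i + (n + 1))) L) : K = k n ∘ L := by
  have e : (fun i => k (i + (n + 1))) = fun i => k (i + 1 + n) := by
    funext i
    rw [add_assoc i 1 n, add_comm 1 n]
  rw [e] at h'
  simpa using h.unique (Lim.cons (k := fun i => k (i + n)) h')

/-- On any finite tuple $K$ agrees with a sufficiently long finite composition. -/
theorem Lim.good (hc : CofOmega lam) (g : ∀ n, Good (k n)) (h : Lim k K) : Good K := by
  refine Elem.good (Elem.of_forall fun n φ x => ?_)
  choose N hN using fun i => h (x i)
  have : K ∘ x = compUpTo k (Finset.univ.sup N) ∘ x := by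
    funext i
    exact (hN i _ (Finset.le_sup (Finset.mem_univ i))).symm
  obtain ⟨e, he⟩ := (good_compUpTo hc g (Finset.univ.sup N)).elem hc
  rw [this, ← he]
  exact e.map_formula φ x

/-- The sets of points that are eventually in `Y n`. -/
def limSet (Y : ℕ → Set (VRank lam)) : Set (VRank lam) := {y | ∃ N, ∀ n, N ≤ n → y ∈ Y n}

theorem ext_compUpTo (hc : CofOmega lam) (g : ∀ n, Good (k n)) {Y : ℕ → Set (VRank lam)}
    (hY : ∀ n, extendEmb (k n) (Y (n + 1)) = Y n) (n : ℕ) :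
    extendEmb (compUpTo k n) (Y (n + 1)) = Y 0 := by
  induction n with
  | zero => exact hY 0
  | succ n ih => rw [compUpTo, (good_compUpTo hc g n).ext_comp hc (g _), hY, ih]

theorem Lim.ext_subset (hc : CofOmega lam) (g : ∀ n, Good (k n)) (h : Lim k K)
    {Y : ℕ → Set (VRank lam)} (hY : ∀ n, extendEmb (k n) (Y (n + 1)) = Y n) {A : Set (VRank lam)}
    (hA : ∀ a : VRank lam, (∀ w : VRank lam, w.1 ∈ a.1 → w ∈ A) →
      ∃ N, ∀ n, N ≤ n → ∀ w : VRank lam, w.1 ∈ a.1 → w ∈ Y n) :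
    extendEmb K A ⊆ Y 0 := by
  intro y hy
  obtain ⟨a, ha, hy⟩ := (h.good hc g).mem_ext.1 hy
  obtain ⟨N, hN⟩ := hA a ha
  obtain ⟨N', hN'⟩ := h a
  rw [← ext_compUpTo hc g hY (max N N')]
  refine (good_compUpTo hc g _).mem_ext.2 ⟨a, hN _ (by omega), ?_⟩
  rwa [hN' _ (le_max_right _ _)]

/-- Since $k_n(w)=w$, membership of $w$ in $Y_{n+1}$ is membership of $w$ in $k_n\cdot Y_{n+1}=Y_n$.
-/
theorem Chain.mem_iff (c : Chain k B) {Y : ℕ → Set (VRank lam)}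
    (hY : ∀ n, extendEmb (k n) (Y (n + 1)) = Y n) {N : ℕ} {w : VRank lam}
    (hw : ∀ n, N ≤ n → w ∈ B n) {n : ℕ} (hn : N ≤ n) : w ∈ Y n ↔ w ∈ Y N := by
  induction n, hn using Nat.le_induction with
  | base => rfl
  | succ n hn ih =>
    rw [← ih, ← (c.good n).map_mem_ext, hY, c.fix n w (hw n hn)]

/-- A class that can be pulled back successively through all the $k_n$ is in the range of the limit.
Of the two inclusions, the second is the first one for complements. -/
theorem Chain.ext_limSet (hc : CofOmega lam) (c : Chain k B) (h : Lim k K)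
    {Y : ℕ → Set (VRank lam)} (hY : ∀ n, extendEmb (k n) (Y (n + 1)) = Y n) :
    extendEmb K (limSet Y) = Y 0 := by
  have key : ∀ {w : VRank lam} {N : ℕ}, (∀ n, N ≤ n → w ∈ B n) →
      ∀ n, N ≤ n → (w ∈ limSet Y ↔ w ∈ Y n) := by
    intro w N hw n hn
    rw [c.mem_iff hY hw hn]
    constructor
    · rintro ⟨M, hM⟩
      exact (c.mem_iff hY hw (le_max_left N M)).1 (hM _ (le_max_right _ _))
    · exact fun h => ⟨N, fun n hn => (c.mem_iff hY hw hn).2 h⟩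
  apply subset_antisymm
  · refine h.ext_subset hc c.good hY fun a ha => ?_
    obtain ⟨N, hN⟩ := c.eventually a
    exact ⟨N, fun n hn w hw => (key (fun n hn => (hN n hn).2 w hw) n hn).1 (ha w hw)⟩
  · have := h.ext_subset hc c.good (Y := fun n => (Y n)ᶜ) (A := (limSet Y)ᶜ)
      (fun n => by rw [(c.good n).ext_compl, hY]) (fun a ha => by
        obtain ⟨N, hN⟩ := c.eventually a
        exact ⟨N, fun n hn w hw h' =>
          ha w hw ((key (fun n hn => (hN n hn).2 w hw) n hn).2 h')⟩)
    rwa [(h.good hc c.good).ext_compl, Set.compl_subset_compl] at this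

end InverseLimits

/-! ### Reflection of $\Sigma^1_m$ properties -/

/-- `Y` is the image of `X` under the extension of the map with graph `L`. -/
def IsImage (L X Y : Set (VRank lam)) : Prop :=
  ∀ y, y ∈ Y ↔ ∃ a b, pair a b ∈ L ∧ (∀ w : VRank lam, w.1 ∈ a.1 → w ∈ X) ∧ y.1 ∈ b.1

theorem Good.isImage_iff {l : VRank lam → VRank lam} (g : Good l) {X Y : Set (VRank lam)} :
    IsImage (graphEmb l) X Y ↔ extendEmb l X = Y := by
  have h : ∀ y, (∃ a b, pair a b ∈ graphEmb l ∧ (∀ w : VRank lam, w.1 ∈ a.1 → w ∈ X) ∧ y.1 ∈ b.1) ↔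
      y ∈ extendEmb l X := fun y => by
    rw [g.mem_ext]
    constructor
    · rintro ⟨a, b, hb, ha, hy⟩
      rw [pair_mem_graphEmb] at hb
      exact ⟨a, ha, hb ▸ hy⟩
    · rintro ⟨a, ha, hy⟩
      exact ⟨a, l a, pair_mem_graphEmb.2 rfl, ha, hy⟩
  simp only [IsImage, h]
  exact ⟨fun h => (Set.ext h).symm, by rintro rfl y; rfl⟩

theorem FODef.isImage {ι κ : Type} (i j k : κ) :
    FODef (lam := lam) (ι := ι) fun _ X => IsImage (X i) (X j) (X k) :=
  all (iff (pred k none) (ex (ex ((pairPred i (some none) none).and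
    ((all (imp (mem none (some (some none))) (pred j none))).and
      (mem (some (some none)) none))))))

theorem FODef.forall_finite {ι κ β : Type} [Finite β]
    {R : β → (ι → VRank lam) → (κ → Set (VRank lam)) → Prop}
    (h : ∀ i, FODef (R i)) : FODef fun x X => ∀ i, R i x X := by
  obtain ⟨q, ⟨f⟩⟩ := Finite.exists_equiv_fin β
  exact (forall_fin fun i => h (f.symm i)).congr fun x X =>
    ⟨fun h i => h _, fun h i => by simpa using h (f i)⟩

/-- `l` reflects `P`. -/
def Down (l : VRank lam → VRank lam) {κ : Type} (P : (κ → Set (VRank lam)) → Prop) : Prop :=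
  ∀ E, P (fun k => extendEmb l (E k)) → P E

/-- `Down` as a property of the graph of a map. -/
def DownRel (L : Set (VRank lam)) {κ : Type} (P : (κ → Set (VRank lam)) → Prop) : Prop :=
  ∀ E E' : κ → Set (VRank lam), (∀ k, IsImage L (E k) (E' k)) → P E' → P E

theorem Good.downRel_iff {l : VRank lam → VRank lam} (g : Good l) {κ : Type}
    {P : (κ → Set (VRank lam)) → Prop} : DownRel (graphEmb l) P ↔ Down l P := by
  simp only [DownRel, g.isImage_iff]
  exact ⟨fun h E hE => h E _ (fun k => rfl) hE, fun h E E' e hE => h E (by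
    rwa [show (fun k => extendEmb l (E k)) = E' from funext e])⟩

/-- Behind the universal quantifiers over $E$ and $E'$ stand the $\Pi^1_m$ statement $\neg P(E')$
and the $\Sigma^1_m$ statement $P(E)$; both are $\Pi^1_{m+1}$. -/
theorem Lev.downRel {κ κ' : Type} [Finite κ] {P : (κ → Set (VRank lam)) → Prop} {m : ℕ}
    (h : Lev true m P) (i : κ') :
    Lev false (m + 1) fun E : κ' → Set (VRank lam) => DownRel (E i) P := by
  refine alls (P := fun E W => ∀ E' : κ → Set (VRank lam),
    (∀ k, IsImage (E i) (W k) (E' k)) → P E' → P W) (alls (P := fun (E : κ' ⊕ κ → Set (VRank lam)) W' =>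
    (∀ k, IsImage (E (.inl i)) (E (.inr k)) (W' k)) → P W' → P fun k => E (.inr k)) ?_)
  refine (((fo false (m + 1) (FODef.forall_finite fun k => FODef.isImage (.inl (.inl i))
    (.inl (.inr k)) (.inr k)).not).or ((h.rename Sum.inr).not.succ)).or
      (h.rename fun k => .inl (.inr k)).switch).congr fun E => ?_
  tauto

theorem Good.down_of_foDef (hc : CofOmega lam) {l : VRank lam → VRank lam} (g : Good l) {κ : Type}
    [Finite κ] {P : (κ → Set (VRank lam)) → Prop} (h : FODef (ι := Empty) fun _ X => P X) :
    Down l P := by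
  intro E hE
  obtain ⟨q, ⟨f⟩⟩ := Finite.exists_equiv_fin κ
  have := (g.iff hc (h.rename (nofun : Empty → Fin 0) f) nofun fun i => E (f.symm i)).2
  simp only [Equiv.symm_apply_apply] at this
  exact this hE

/-- `l` reflects all `Σ¹_m` properties. -/
def DownAll (m : ℕ) (l : VRank lam → VRank lam) : Prop :=
  ∀ (κ : Type) [Finite κ] (P : (κ → Set (VRank lam)) → Prop), Lev true m P → Down l P

theorem DownAll.mono {m n : ℕ} {l : VRank lam → VRank lam} (h : DownAll n l) (hn : m ≤ n) :
    DownAll m l := fun κ _ P hP => h κ P (hP.mono hn)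

/-- There is an embedding `l` sending `A` to `A'`, having `Y` in its range, fixing `B` pointwise
and mapping `B` to itself, and reflecting all properties in `F`. -/
def Squares (F : List (Σ κ : Type, ((κ → Set (VRank lam)) → Prop))) {κ β : Type}
    (A A' : κ → Set (VRank lam)) (Y : β → Set (VRank lam)) (B : Set (VRank lam)) : Prop :=
  ∃ l, Good l ∧ ∃ Y' : β → Set (VRank lam), (∀ k, extendEmb l (A k) = A' k) ∧
    (∀ b, extendEmb l (Y' b) = Y b) ∧ (∀ b ∈ B, l b = b) ∧ extendEmb l B = B ∧
    ∀ f ∈ F, Down l f.2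

/-- Reflecting a $\Sigma^1_c$ property is $\Pi^1_{c+1}=\Pi^1_m$, and the graph of `l` and the
preimages `Y'` are quantified existentially in front. -/
theorem Lev.squares {F : List (Σ κ : Type, ((κ → Set (VRank lam)) → Prop))} {m : ℕ}
    (hF : ∀ f ∈ F, Finite f.1 ∧ ∃ c, m = c + 1 ∧ Lev true c f.2) {κ β : Type} [Finite κ] [Finite β] :
    Lev true (m + 1) fun E : (κ ⊕ κ) ⊕ (β ⊕ Unit) → Set (VRank lam) =>
      Squares F (fun k => E (.inl (.inl k))) (fun k => E (.inl (.inr k)))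
        (fun b => E (.inr (.inl b))) (E (.inr (.inr ()))) := by
  refine (ex (P := fun E L => ∃ Y' : β → Set (VRank lam), ((∃ l, Good l ∧ graphEmb l = L) ∧
    (∀ k, IsImage L (E (.inl (.inl k))) (E (.inl (.inr k)))) ∧
    (∀ b, IsImage L (Y' b) (E (.inr (.inl b)))) ∧
    (∀ b, b ∈ E (.inr (.inr ())) → pair b b ∈ L) ∧
    IsImage L (E (.inr (.inr ()))) (E (.inr (.inr ())))) ∧ ∀ f ∈ F, DownRel L f.2)
    (exs (P := fun (E : ((κ ⊕ κ) ⊕ (β ⊕ Unit)) ⊕ Unit → Set (VRank lam)) Y' => ((∃ l, Good l ∧ graphEmb l = E (.inr ())) ∧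
    (∀ k, IsImage (E (.inr ())) (E (.inl (.inl (.inl k)))) (E (.inl (.inl (.inr k))))) ∧
    (∀ b, IsImage (E (.inr ())) (Y' b) (E (.inl (.inr (.inl b))))) ∧
    (∀ b, b ∈ E (.inl (.inr (.inr ()))) → pair b b ∈ E (.inr ())) ∧
    IsImage (E (.inr ())) (E (.inl (.inr (.inr ())))) (E (.inl (.inr (.inr ()))))) ∧
      ∀ f ∈ F, DownRel (E (.inr ())) f.2) (and ?_ ?_))).congr fun E => ?_
  · exact fo _ _ ((FODef.goodGraph _).and ((FODef.forall_finite fun k =>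
      FODef.isImage _ _ _).and ((FODef.forall_finite fun b => FODef.isImage _ _ _).and
      ((FODef.all (FODef.imp (FODef.pred _ none) (FODef.pairPred _ none none))).and
        (FODef.isImage _ _ _)))))
  · refine forall_list F fun f hf => ?_
    obtain ⟨hfin, c, rfl, hc⟩ := hF f hf
    exact (hc.downRel (Sum.inl (Sum.inr ()))).switch
  · constructor
    · rintro ⟨l, g, Y', h1, h2, h3, h4, h5⟩
      refine ⟨graphEmb l, Y', ⟨⟨l, g, rfl⟩, fun k => g.isImage_iff.2 (h1 k),
        fun b => g.isImage_iff.2 (h2 b), fun b hb => pair_mem_graphEmb.2 (h3 b hb).symm,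
        g.isImage_iff.2 h4⟩, fun f hf => g.downRel_iff.2 (h5 f hf)⟩
    · rintro ⟨L, Y', ⟨⟨l, g, rfl⟩, h1, h2, h3, h4⟩, h5⟩
      exact ⟨l, g, Y', fun k => g.isImage_iff.1 (h1 k), fun b => g.isImage_iff.1 (h2 b),
        fun b hb => (pair_mem_graphEmb.1 (h3 b hb)).symm, g.isImage_iff.1 h4,
        fun f hf => g.downRel_iff.1 (h5 f hf)⟩

/-- For every `Σ¹_{2a}` property there are finitely many `Σ¹_{2a-1}` properties such that an
inverse limit of embeddings reflecting the latter reflects the former. -/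
theorem exists_reflecting_list (hc : CofOmega lam) (a : ℕ) {κ : Type} [Finite κ]
    {P : (κ → Set (VRank lam)) → Prop} (h : Lev true (2 * a) P) :
    ∃ F : List (Σ κ : Type, ((κ → Set (VRank lam)) → Prop)),
      (∀ f ∈ F, Finite f.1 ∧ ∃ c, 2 * a = c + 1 ∧ Lev true c f.2) ∧
      ∀ {k : ℕ → VRank lam → VRank lam} {B : ℕ → Set (VRank lam)} {K : VRank lam → VRank lam},
        Chain k B → Lim k K → (∀ n, ∀ f ∈ F, Down (k n) f.2) → Down K P := by
  induction a generalizing κ with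
  | zero => exact ⟨[], by simp, fun c hK _ => (hK.good hc c.good).down_of_foDef hc h⟩
  | succ a ih =>
    obtain ⟨β, hβ, R, ⟨γ, hγ, T, hT, eT⟩, eR⟩ := h
    obtain ⟨F, hF, hFT⟩ := ih hT
    -- To the list for the matrix `T` only the replacement property `Squares F` is added. It is
    -- $\Sigma^1_{2a+1}$, exactly one level below that of `P`.
    refine ⟨⟨(κ ⊕ κ) ⊕ (β ⊕ Unit), fun E => Squares F (fun k => E (.inl (.inl k)))
      (fun k => E (.inl (.inr k))) (fun b => E (.inr (.inl b))) (E (.inr (.inr ())))⟩ :: F, ?_, ?_⟩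
    · rw [List.forall_mem_cons]
      refine ⟨⟨inferInstanceAs (Finite ((κ ⊕ κ) ⊕ (β ⊕ Unit))), 2 * a + 1, by ring,
        Lev.squares hF⟩, fun f hf => ?_⟩
      obtain ⟨hfin, c, hac, hf⟩ := hF f hf
      exact ⟨hfin, 2 * a + 1, by ring, hf.mono (by omega)⟩
    · intro k B K c hK hD E hE
      obtain ⟨Y, hY⟩ := (eR _).1 hE
      -- The tails $K_n=k_n\circ k_{n+1}\circ\cdots$; thus $k_n$ carries $K_{n+1}\cdot E$ to
      -- $K_n\cdot E$.
      choose Kt hKt using fun n => (c.shift n).exists_lim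
      have hKt0 : Kt 0 = K := (hKt 0).unique hK
      have hKts : ∀ n, Kt n = k n ∘ Kt (n + 1) := fun n => (hKt n).shift_eq (hKt (n + 1))
      have hX : ∀ n i, extendEmb (k n) (extendEmb (Kt (n + 1)) (E i)) = extendEmb (Kt n) (E i) :=
        fun n i => by
          rw [hKts n, (c.good n).ext_comp hc ((hKt (n + 1)).good hc (c.shift (n + 1)).good)]
      -- The image of this statement under `k n` is witnessed by `k n` itself, with `W` as the
      -- required preimage of `extendEmb (k n) (W b)`; then `k n` reflects it. The parameter `B n`
      -- survives because it is its own image.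
      have hS : ∀ n (W : β → Set (VRank lam)), Squares F (fun i => extendEmb (Kt (n + 1)) (E i))
          (fun i => extendEmb (Kt n) (E i)) W (B n) := by
        intro n W
        refine hD n _ (List.mem_cons_self ..) (Sum.elim (Sum.elim (fun i => extendEmb (Kt (n + 1)) (E i))
          fun i => extendEmb (Kt n) (E i)) (Sum.elim W fun _ => B n)) ?_
        refine ⟨k n, c.good n, W, fun i => congrArg _ (hX n i), fun b => rfl, ?_, ?_,
          fun f hf => hD n f (List.mem_cons_of_mem _ hf)⟩
        · simp only [Sum.elim_inr, c.ext]; exact c.fix n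
        · simp only [Sum.elim_inr, c.ext]
      choose l gl W' hl1 hl2 hl3 hl4 hl5 using hS
      -- The witness $Y$ is pulled back step by step; the $n$-th replacement embedding depends on
      -- the class reached so far.
      let Ys : ℕ → β → Set (VRank lam) := fun n => Nat.rec Y (fun n W => W' n W) n
      have c' : Chain (fun n => l n (Ys n)) B := ⟨fun n => gl _ _, fun n => hl3 _ _,
        fun n => hl4 _ _, c.eventually⟩
      obtain ⟨L, hL⟩ := c'.exists_lim
      have hYs : ∀ b, extendEmb L (limSet fun n => Ys n b) = Y b := fun b =>
        c'.ext_limSet hc hL (Y := fun n => Ys n b) fun n => hl2 n (Ys n) b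
      -- The classes $K_n\cdot E$ are coherent for the old and for the new chain. Their limit is
      -- $E$, so $K$ and $L$ both send it to $K\cdot E$.
      have hEs : ∀ i, limSet (fun n => extendEmb (Kt n) (E i)) = E i := fun i => by
        apply (hK.good hc c.good).ext_injective
        rw [c.ext_limSet hc hK (Y := fun n => extendEmb (Kt n) (E i)) fun n => hX n i, hKt0]
      have hLE : ∀ i, extendEmb L (E i) = extendEmb K (E i) := fun i => by
        have := c'.ext_limSet hc hL (Y := fun n => extendEmb (Kt n) (E i)) fun n => hl1 n (Ys n) i
        rwa [hEs, hKt0] at this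
      refine (eR E).2 ⟨fun b => limSet fun n => Ys n b, (eT _).2 fun Z => ?_⟩
      refine hFT c' hL (fun n => hl5 _ _) _ ?_
      have := (eT _).1 hY fun i => extendEmb L (Z i)
      refine (iff_of_eq (congrArg T ?_)).1 this
      funext i
      rcases i with (i | i) | i
      · exact (hLE i).symm
      · exact (hYs i).symm
      · rfl

theorem Chain.downAll (hc : CofOmega lam) {k : ℕ → VRank lam → VRank lam}
    {B : ℕ → Set (VRank lam)} {K : VRank lam → VRank lam} (c : Chain k B) (hK : Lim k K) {a : ℕ}
    (h : ∀ n, DownAll (2 * a + 1) (k n)) : DownAll (2 * a + 2) K := by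
  intro κ _ P hP
  obtain ⟨F, hF, hFP⟩ := exists_reflecting_list hc (a + 1) hP
  refine hFP c hK fun n f hf => ?_
  obtain ⟨hfin, c, hac, hf⟩ := hF f hf
  exact h n _ _ (hf.mono (by omega))

/-- View $j$ as the inverse limit $j\circ\mathrm{id}\circ\mathrm{id}\circ\cdots$, with
$B_0=\emptyset$ and $B_n=V_\lambda$ afterwards. -/
theorem DownAll.succ (hc : CofOmega lam) {j : VRank lam → VRank lam} (g : Good j) {a : ℕ}
    (h : DownAll (2 * a + 1) j) : DownAll (2 * a + 2) j := by
  have hid : ∀ A : Set (VRank lam), extendEmb id A = A := fun A => by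
    have := good_id.ext_comp hc good_id A
    exact (good_id.ext_injective this).symm
  have c : Chain (fun n => Nat.casesOn n j fun _ => id)
      fun n => Nat.casesOn n ∅ fun _ => (Set.univ : Set (VRank lam)) := by
    refine ⟨fun n => ?_, fun n => ?_, fun n => ?_, fun a => ⟨1, fun n hn => ?_⟩⟩
    · cases n
      exacts [g, good_id]
    · cases n
      · exact fun b hb => hb.elim
      · exact fun b _ => rfl
    · cases n
      exacts [g.ext_empty, good_id.ext_univ]
    · obtain ⟨n, rfl⟩ : ∃ m, n = m + 1 := ⟨n - 1, by omega⟩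
      exact ⟨trivial, fun _ _ => trivial⟩
  refine c.downAll hc (K := j) (fun a => ⟨0, fun n _ => ?_⟩) fun n => ?_
  · induction n with
    | zero => rfl
    | succ n ih => exact ih (Nat.zero_le n)
  · cases n
    · exact h
    · exact fun κ _ P hP E hE => by simpa only [hid] using hE

/-- That $j\cdot k$ fails to reflect a $\Sigma^1_{2a+1}$ property is a $\Sigma^1_{2a+2}$ statement
about the image of the graph of $k$. By `DownAll.succ`, $j$ reflects it to the same failure for $k$.
-/
theorem DownAll.apply (hc : CofOmega lam) {j k h : VRank lam → VRank lam} (gj : Good j)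
    (gk : Good k) (gh : Good h) (e : graphEmb h = extendEmb j (graphEmb k)) {a : ℕ}
    (hj : DownAll (2 * a + 1) j) (hk : DownAll (2 * a + 1) k) : DownAll (2 * a + 1) h := by
  intro κ _ P hP
  by_contra hn
  rw [← gh.downRel_iff, e] at hn
  exact hj.succ hc gj Unit _ (hP.downRel ()).not (fun _ => graphEmb k) hn (gk.downRel_iff.2 (hk κ P hP))

theorem downAll_of_sigmaElementary {m : ℕ} {j : VRank lam → VRank lam} (h : SigmaElementary m j) :
    DownAll m j := by
  intro κ _ P hP E hE
  obtain ⟨q, ⟨f⟩⟩ := Finite.exists_equiv_fin κ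
  obtain ⟨φ, hφ, e⟩ := hP.exists_formula f
  have := (h 0 q φ hφ nofun fun i => E (f.symm i)).2 ((e _ _).2 (by simpa using hE))
  simpa using (e _ _).1 this

/-- Push the existential witnesses forward. If the matrix failed at the images, its negation, of a
lower $\Sigma^1$ level, would be reflected. -/
theorem DownAll.up {m : ℕ} {l : VRank lam → VRank lam} (h : DownAll m l) {κ : Type} [Finite κ]
    {P : (κ → Set (VRank lam)) → Prop} (hP : Lev true m P) {E : κ → Set (VRank lam)} (hE : P E) :
    P fun k => extendEmb l (E k) := by
  cases m with
  | zero =>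
    by_contra hn
    exact h κ _ (Lev.not (b := false) (m := 0) (P := P) hP) E hn hE
  | succ m =>
    obtain ⟨β, hβ, R, hR, e⟩ := hP
    obtain ⟨Y, hY⟩ := (e E).1 hE
    refine (e _).2 ⟨fun b => extendEmb l (Y b), ?_⟩
    by_contra hn
    refine h _ _ hR.not.succ (Sum.elim E Y) ?_ hY
    refine fun h => hn ((iff_of_eq (congrArg R ?_)).1 h)
    funext k
    rcases k with k | k <;> rfl

theorem DownAll.sigmaElementary {m : ℕ} {l : VRank lam → VRank lam} (g : Good l)
    (h : DownAll m l) : SigmaElementary m l := by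
  intro n p φ hφ x X
  obtain ⟨P, hP, e⟩ := exists_lev (lam := lam) hφ
  have h1 : (fun k => extendEmb l (Sum.elim X (fun i => {x i}) k)) =
      Sum.elim (fun i => extendEmb l (X i)) fun i => {l (x i)} := by
    funext k
    rcases k with k | k
    · rfl
    · exact g.ext_singleton _
  rw [← e, ← e, ← h1]
  exact ⟨h.up hP, h _ P hP _⟩

theorem Good.exists_apply (hc : CofOmega lam) {j k : VRank lam → VRank lam} (g : Good j)
    (g' : Good k) : ∃ h, Good h ∧ graphEmb h = extendEmb j (graphEmb k) :=
  (g.iff hc (FODef.goodGraph (ι := Fin 0) (0 : Fin 1)) nofun fun _ => graphEmb k).1 ⟨k, g', rfl⟩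

theorem Good.apply_map {j k h : VRank lam → VRank lam} (g : Good j)
    (e : graphEmb h = extendEmb j (graphEmb k)) (x : VRank lam) : h (j x) = j (k x) := by
  have : j (pair x (k x)) ∈ extendEmb j (graphEmb k) := g.map_mem_ext.2 (pair_mem_graphEmb.2 rfl)
  rw [g.map_pair, ← e, pair_mem_graphEmb] at this
  exact this.symm

theorem Good.apply_fix (hc : CofOmega lam) {j k h : VRank lam → VRank lam} (g : Good j)
    (e : graphEmb h = extendEmb j (graphEmb k)) {v : VRank lam}
    (hv : ∀ x : VRank lam, x.1 ∈ v.1 → k x = x) (x : VRank lam) (hx : x.1 ∈ (j v).1) : h x = x := by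
  have := (g.iff hc (P := fun (x : Fin 1 → VRank lam) (X : Fin 1 → Set (VRank lam)) =>
    ∀ y : VRank lam, y.1 ∈ (x 0).1 → pair y y ∈ X 0)
    (FODef.all ((FODef.mem none (some 0)).imp (FODef.pairPred 0 none none)))
    (fun _ => v) fun _ => graphEmb k).1 (fun y hy => pair_mem_graphEmb.2 (hv y hy).symm) x hx
  rw [← e, pair_mem_graphEmb] at this
  exact this.symm

/-! ### Right powers and their inverse limits -/

section RightPowers

variable {j : VRank lam → VRank lam} {r : ℕ → VRank lam → VRank lam}

theorem Elem.exists_isRightPowers (hj : Elem j) (hc : CofOmega lam) :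
    ∃ r, IsRightPowers j r ∧ ∀ n, Good (r n) := by
  choose f hf hf' using fun l : {l : VRank lam → VRank lam // Good l} => l.2.exists_apply hc l.2
  let r : ℕ → {l : VRank lam → VRank lam // Good l} :=
    fun n => Nat.rec ⟨j, hj.good⟩ (fun _ l => ⟨f l, hf l⟩) n
  exact ⟨fun n => (r n).1, ⟨rfl, fun n => hf' _⟩, fun n => (r n).2⟩

variable (hj : Elem j) (hne : j ≠ id) (hr : IsRightPowers j r) (g : ∀ n, Good (r n))

include hj hne hr g

/-- With $f=j^{(n)}$, the map $f\cdot f$ fixes $f(V_{\kappa_n})=V_{\kappa_{n+1}}$ pointwise, and by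
$(f\cdot f)(f(x))=f(f(x))$ it moves $\kappa_{m+1}=f(\kappa_m)$ to $f(\kappa_{m+1})$. -/
theorem rightPowers_spec (n : ℕ) : (∀ x : VRank lam, x.1.rank < critSeq j n → r n x = x) ∧
    ∀ m, n ≤ m → ordMap (r n) (critSeq j m) = critSeq j (m + 1) := by
  have hc := hj.cofOmega hne
  induction n with
  | zero =>
    rw [hr.1]
    exact ⟨hj.map_eq_self fun α hα _ => (hj.critPt_spec hne).2.2 α hα,
      fun m _ => (critSeq_succ j m).symm⟩
  | succ n ih =>
    obtain ⟨h1, h2⟩ := ih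
    have hn := (g n).elem hc
    have hlev : ∀ m, n ≤ m → r n (lev (critSeq j m) (hj.critSeq_lt hne m)) =
        lev (critSeq j (m + 1)) (hj.critSeq_lt hne (m + 1)) := fun m hm => by
      rw [hn.map_lev, lev_inj, h2 m hm]
    refine ⟨fun x hx => ?_, fun m hm => ?_⟩
    · refine (g n).apply_fix hc (hr.2 n) (v := lev (critSeq j n) (hj.critSeq_lt hne n))
        (fun x hx => h1 x (mem_lev.1 hx)) x ?_
      rw [hlev n le_rfl]
      exact mem_lev.2 hx
    · obtain ⟨m, rfl⟩ : ∃ i, m = i + 1 := ⟨m - 1, by omega⟩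
      refine ordMap_eq_of_map_lev (hj.critSeq_lt hne _) (hj.critSeq_lt hne _) ?_
      rw [← hlev m (by omega), (g n).apply_map (hr.2 n), hlev m (by omega), hlev _ (by omega)]

theorem rightPowers_map_lev {m n : ℕ} (h : n ≤ m) :
    r n (lev (critSeq j m) (hj.critSeq_lt hne m)) =
      lev (critSeq j (m + 1)) (hj.critSeq_lt hne (m + 1)) := by
  rw [((g n).elem (hj.cofOmega hne)).map_lev, lev_inj, (rightPowers_spec hj hne hr g n).2 m h]

theorem rightPowers_lt_ordMap (n : ℕ) : critSeq j n < ordMap (r n) (critSeq j n) := by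
  rw [(rightPowers_spec hj hne hr g n).2 n le_rfl]
  exact hj.critSeq_lt_succ hne n

theorem rightPowers_ordMap_eq {n : ℕ} {α : Ordinal.{u}} (hα : α < critSeq j n) :
    ordMap (r n) α = α := by
  have hα' := hα.trans (hj.critSeq_lt hne n)
  refine ordMap_eq_of_map_lev hα' hα' ((rightPowers_spec hj hne hr g n).1 _ ?_)
  simpa [lev] using hα

theorem critPt_rightPowers (n : ℕ) : critPt (r n) = critSeq j n :=
  ((g n).elem (hj.cofOmega hne)).critPt_eq_of (hj.critSeq_lt hne n)
    (rightPowers_lt_ordMap hj hne hr g n) fun _ hα => rightPowers_ordMap_eq hj hne hr g hα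

theorem rightPowers_mem (n : ℕ) : r n ∈ RankEmb lam := by
  refine ⟨(g n).elem (hj.cofOmega hne), fun h => (rightPowers_lt_ordMap hj hne hr g n).ne' ?_⟩
  exact ordMap_eq_of_map_lev (hj.critSeq_lt hne n) (hj.critSeq_lt hne n) (by rw [h]; rfl)

theorem liminf_critPt (s : ℕ) :
    Filter.liminf (fun n => critPt (r (n + s))) Filter.atTop = lam := by
  simp only [critPt_rightPowers hj hne hr g, Filter.liminf_eq]
  have : {a | ∀ᶠ n in Filter.atTop, a ≤ critSeq j (n + s)} = Set.Iio lam := by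
    ext a
    simp only [Set.mem_ofPred_eq, Set.mem_Iio, Filter.eventually_atTop]
    constructor
    · rintro ⟨N, hN⟩
      exact (hN N le_rfl).trans_lt (hj.critSeq_lt hne _)
    · intro ha
      obtain ⟨N, hN⟩ := hj.exists_lt_critSeq hne ha
      exact ⟨N, fun n hn => hN.le.trans ((hj.critSeq_strictMono hne).monotone (by omega))⟩
  rw [this]
  exact hl.out.isSuccPrelimit.isLUB_Iio.csSup_eq ⟨0, hl.out.pos⟩

/-- The fixed part is $V_{\kappa_{n-1}}$, empty for $n=0$. Although $j^{(n)}$ fixes all of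
$V_{\kappa_n}$ pointwise, it sends this class to $V_{\kappa_{n+1}}$, contrary to `Chain.ext`. -/
theorem chain_rightPowers : Chain r fun n => {x | ∃ m, n = m + 1 ∧ x.1.rank < critSeq j m} := by
  have hmono := hj.critSeq_strictMono hne
  have hfix := fun n => (rightPowers_spec hj hne hr g n).1
  refine ⟨g, ?_, fun n => ?_, fun a => ?_⟩
  · rintro _ b ⟨m, rfl, hb⟩
    exact hfix _ _ (hb.trans (hmono (Nat.lt_succ_self m)))
  · cases n with
    | zero => simpa using (g 0).ext_empty
    | succ m =>
      have := (g (m + 1)).ext_coe (lev (critSeq j m) (hj.critSeq_lt hne m))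
      rw [hfix (m + 1) (lev (critSeq j m) (hj.critSeq_lt hne m))
        (by simpa [lev] using hmono (Nat.lt_succ_self m))] at this
      simpa only [mem_lev, Nat.add_right_cancel_iff, exists_eq_left'] using this
  · obtain ⟨N, hN⟩ := hj.exists_lt_critSeq hne a.rank_lt
    refine ⟨N + 1, fun n hn => ?_⟩
    obtain ⟨m, rfl⟩ : ∃ i, n = i + 1 := ⟨n - 1, by omega⟩
    have h := hN.trans_le (hmono.monotone (show N ≤ m by omega))
    exact ⟨⟨m, rfl, h⟩, fun w hw => ⟨m, rfl, (ZFSet.rank_lt_of_mem hw).trans h⟩⟩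

theorem isInverseLimit_rightPowers (s : ℕ) {K : VRank lam → VRank lam}
    (hK : Lim (fun n => r (n + s)) K) : IsInverseLimit (fun n => r (n + s)) K := by
  refine ⟨fun n => rightPowers_mem hj hne hr g _, liminf_critPt hj hne hr g s, fun a => ?_⟩
  obtain ⟨N, hN⟩ := hK a
  obtain ⟨M, hM⟩ := hj.exists_lt_critSeq hne a.rank_lt
  refine ⟨max N M, fun i hi => (rightPowers_spec hj hne hr g _).1 a (hM.trans_le
    ((hj.critSeq_strictMono hne).monotone (by omega))), (hN _ (le_max_left _ _)).symm⟩

theorem lim_rightPowers_eq_self {t : ℕ} {K : VRank lam → VRank lam}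
    (hK : Lim (fun n => r (n + t)) K) {x : VRank lam} (hx : x.1.rank < critSeq j t) : K x = x := by
  have hfix : ∀ n, r (n + t) x = x := fun n => (rightPowers_spec hj hne hr g _).1 x
    (hx.trans_le ((hj.critSeq_strictMono hne).monotone (by omega)))
  have : ∀ n, compUpTo (fun n => r (n + t)) n x = x := fun n => by
    induction n with
    | zero => exact hfix 0
    | succ n ih => rw [compUpTo, Function.comp_apply, hfix, ih]
  obtain ⟨N, hN⟩ := hK x
  rw [← hN N le_rfl, this]

/-- The factors with index above $s$ fix $\kappa_s$, and each of the $d$ factors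
$j^{(s)},\dots,j^{(t)}$ moves it one step up the critical sequence. -/
theorem ordMap_lim_rightPowers {t s d : ℕ} (h : t + d = s + 1) {K : VRank lam → VRank lam}
    (hK : Lim (fun n => r (n + t)) K) : ordMap K (critSeq j s) = critSeq j (s + d) := by
  refine ordMap_eq_of_map_lev (hj.critSeq_lt hne _) (hj.critSeq_lt hne _) ?_
  induction d generalizing t K with
  | zero =>
    refine lim_rightPowers_eq_self hj hne hr g hK ?_
    rw [add_zero] at h
    simpa [lev, h] using hj.critSeq_lt_succ hne s
  | succ d ih =>
    obtain ⟨K', hK'⟩ := ((chain_rightPowers hj hne hr g).shift (t + 1)).exists_lim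
    rw [hK.shift_eq hK', Function.comp_apply, ih (by omega) hK',
      rightPowers_map_lev hj hne hr g (by omega)]
    rfl

/-- Compared with $\kappa_s$ itself one step is saved: $j^{(s)}$ fixes everything of rank below
$\kappa_s$. -/
theorem rank_lim_rightPowers_lt {t s d : ℕ} (h : t + d = s) {K : VRank lam → VRank lam}
    (hK : Lim (fun n => r (n + t)) K) {x : VRank lam} (hx : x.1.rank < critSeq j s) :
    (K x).1.rank < critSeq j (s + d) := by
  induction d generalizing t K with
  | zero =>
    rw [lim_rightPowers_eq_self hj hne hr g hK (by rwa [← h] at hx)]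
    exact hx
  | succ d ih =>
    obtain ⟨K', hK'⟩ := ((chain_rightPowers hj hne hr g).shift (t + 1)).exists_lim
    have ht := (g t).elem (hj.cofOmega hne)
    rw [hK.shift_eq hK', Function.comp_apply, ht.rank_map, ← add_assoc,
      ← (rightPowers_spec hj hne hr g t).2 (s + d) (by omega),
      ht.ordMap_lt_iff (rank_lt _) (hj.critSeq_lt hne _)]
    exact ih (by omega) hK'

theorem rightPowers_downAll {a : ℕ} (h : DownAll (2 * a + 1) j) (n : ℕ) :
    DownAll (2 * a + 1) (r n) := by
  induction n with
  | zero => rwa [hr.1]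
  | succ n ih => exact ih.apply (hj.cofOmega hne) (g n) (g n) (g (n + 1)) (hr.2 n) ih

theorem sigmaElementary_lim_rightPowers {m : ℕ} (h : SigmaElementary m j) {t : ℕ}
    {K : VRank lam → VRank lam} (hK : Lim (fun n => r (n + t)) K) : SigmaElementary m K := by
  have hc := hj.cofOmega hne
  have gK := hK.good hc fun n => g _
  refine DownAll.sigmaElementary gK ?_
  rcases Nat.eq_zero_or_pos m with rfl | hm
  · exact fun κ _ P hP => gK.down_of_foDef hc hP
  -- The largest odd number not exceeding $m$; its successor is at least $m$.
  · have h1 : DownAll (2 * ((m - 1) / 2) + 1) j := (downAll_of_sigmaElementary h).mono (by omega)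
    exact (((chain_rightPowers hj hne hr g).shift t).downAll hc hK
      fun n => rightPowers_downAll hj hne hr g h1 _).mono (by omega)

end RightPowers

/-! ### Gaps avoided by functions in the range -/

/-- The binary relation coded by the pairs in `D` is single-valued. -/
def Functional (D : Set (VRank lam)) : Prop :=
  ∀ a z z' : VRank lam, pair a z ∈ D → pair a z' ∈ D → z = z'

theorem FODef.functional {ι κ : Type} (k : κ) :
    FODef (lam := lam) (ι := ι) fun _ X => Functional (X k) :=
  all (all (all ((pairPred k (some (some none)) (some none)).imp
    ((pairPred k (some (some none)) none).imp (eq (some none) none)))))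

theorem FODef.functional_coe {ι κ : Type} (i : ι) :
    FODef (lam := lam) (κ := κ) fun x _ => Functional {w : VRank lam | w.1 ∈ (x i).1} :=
  all (all (all ((pairMem (some (some none)) (some none) (some (some (some i)))).imp
    ((pairMem (some (some none)) none (some (some (some i)))).imp (eq (some none) none)))))

theorem Good.functional_iff (hc : CofOmega lam) {l : VRank lam → VRank lam} (g : Good l)
    {D : Set (VRank lam)} : Functional D ↔ Functional (extendEmb l D) :=
  g.iff hc (FODef.functional (ι := Fin 0) (0 : Fin 1)) nofun fun _ => D

/-- A single-valued relation below the critical point `κ` of an embedding is bounded below `κ`. -/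
theorem exists_bound_of_functional (hc : CofOmega lam) {f : VRank lam → VRank lam} (gf : Good f)
    {κ τ : Ordinal.{u}} (hκ : κ < lam) (hfix : ∀ x : VRank lam, x.1.rank < κ → f x = x)
    (hmove : κ < ordMap f κ) (hτ : τ < κ) {D : Set (VRank lam)} (hD : Functional D) :
    ∃ σ < κ, ∀ a z : VRank lam, a.1.rank < τ → z.1.rank < κ → pair a z ∈ D → z.1.rank < σ := by
  by_contra! hunb
  have hτ' := hτ.trans hκ
  have hf := gf.elem hc
  -- Apply $f$ to the unboundedness and test it at the level $V_\kappa\in f(V_\kappa)$: at some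
  -- $a\in V_\tau$ the class $f\cdot D$ has a value $z\in f(V_\kappa)\setminus V_\kappa$.
  have h1 := (gf.iff hc (P := fun (x : Fin 2 → VRank lam) (X : Fin 1 → Set (VRank lam)) =>
    ∀ v : VRank lam, v.1 ∈ (x 1).1 → IsLev v → ∃ a z : VRank lam, a.1 ∈ (x 0).1 ∧
      z.1 ∈ (x 1).1 ∧ pair a z ∈ X 0 ∧ ¬ z.1 ∈ v.1)
    (FODef.all ((FODef.mem none (some 1)).imp ((FODef.isLev none).imp (FODef.ex (FODef.ex
      ((FODef.mem (some none) (some (some (some 0)))).and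
        ((FODef.mem none (some (some (some 1)))).and ((FODef.pairPred 0 (some none) none).and
          (FODef.mem none (some (some none))).not)))))))) ![lev τ hτ', lev κ hκ] fun _ => D).1 (by
    intro v hv hlev
    obtain ⟨σ, hσ, rfl⟩ := isLev_iff.1 hlev
    have hσκ : σ < κ := by simpa [lev] using hv
    obtain ⟨a, z, ha, hz, hD, hzσ⟩ := hunb σ hσκ
    exact ⟨a, z, (mem_lev (h := hτ')).2 ha, (mem_lev (h := hκ)).2 hz, hD,
      fun h => (mem_lev.1 h).not_ge hzσ⟩)
    (lev κ hκ) (by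
      show _ ∈ (f (lev κ hκ)).1
      rw [hf.map_lev, mem_lev]
      simpa [lev] using hmove) (isLev_iff.2 ⟨κ, hκ, rfl⟩)
  obtain ⟨a, z, ha, hz, hDz, hzκ⟩ := h1
  change a.1 ∈ (f (lev τ hτ')).1 at ha
  change z.1 ∈ (f (lev κ hκ)).1 at hz
  rw [hfix (lev τ hτ') (by simpa [lev] using hτ), mem_lev] at ha
  have hfa := hfix a (ha.trans hτ)
  -- By elementarity $D$ already has a value $w\in V_\kappa$ at $a$. As $f$ fixes $a$ and $w$, this
  -- is also the value of $f\cdot D$, so $z=w$.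
  obtain ⟨w, hw, hDw⟩ := (gf.iff hc (P := fun (x : Fin 2 → VRank lam) (X : Fin 1 → Set (VRank lam)) =>
    ∃ z : VRank lam, z.1 ∈ (x 1).1 ∧ pair (x 0) z ∈ X 0)
    (FODef.ex ((FODef.mem none (some 1)).and (FODef.pairPred 0 (some 0) none)))
    ![a, lev κ hκ] fun _ => D).2 ⟨z, hz, by
      show pair (f a) z ∈ _
      rwa [hfa]⟩
  change w.1 ∈ (lev κ hκ).1 at hw
  change pair a w ∈ D at hDw
  have hDw' := gf.map_mem_ext.2 hDw
  rw [gf.map_pair, hfa, hfix w (mem_lev.1 hw)] at hDw'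
  rw [(gf.functional_iff hc).1 hD a z w hDz hDw'] at hzκ
  exact hzκ hw

/-- Values in `V_ν` at arguments in `V_θ` of functions in the range of `l` are in `V_θ`. -/
def Avoids (l : VRank lam → VRank lam) (θ ν : Ordinal.{u}) : Prop :=
  ∀ D : Set (VRank lam), Functional D → ∀ a z : VRank lam, a.1.rank < θ → z.1.rank < ν →
    pair a z ∈ extendEmb l D → z.1.rank < θ

/-- The bound $\sigma<\kappa$ for values of $D$ on $V_\tau$ is carried by $l$ to the bound
$l(\sigma)<\theta$ on $V_{l(\tau)}$, and the ordinals $l(\tau)$ with $\tau<\kappa$ exhaust $\theta$.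
The map $f$ serves only to make $\kappa$ a critical point. -/
theorem Good.avoids (hc : CofOmega lam) {l f : VRank lam → VRank lam} (g : Good l) (gf : Good f)
    {κ θ : Ordinal.{u}} (hκ : κ < lam) (hfix : ∀ x : VRank lam, x.1.rank < κ → f x = x)
    (hmove : κ < ordMap f κ) (hθ : ∀ ρ, ρ < θ ↔ ∃ σ < κ, ρ < ordMap l σ) :
    Avoids l θ (ordMap l κ) := by
  intro D hD a z ha hz hDz
  have h := g.elem hc
  obtain ⟨τ, hτ, ha⟩ := (hθ _).1 ha
  obtain ⟨σ, hσ, hb⟩ := exists_bound_of_functional hc gf hκ hfix hmove hτ hD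
  have hτ' := hτ.trans hκ
  have hσ' := hσ.trans hκ
  have := (g.iff hc (P := fun (x : Fin 3 → VRank lam) (X : Fin 1 → Set (VRank lam)) =>
    ∀ a z : VRank lam, a.1 ∈ (x 0).1 → z.1 ∈ (x 1).1 → pair a z ∈ X 0 → z.1 ∈ (x 2).1)
    (FODef.all (FODef.all ((FODef.mem (some none) (some (some 0))).imp
      ((FODef.mem none (some (some 1))).imp ((FODef.pairPred 0 (some none) none).imp
        (FODef.mem none (some (some 2)))))))) ![lev τ hτ', lev κ hκ, lev σ hσ'] fun _ => D).1
    (fun a z ha hz hDz => (mem_lev (h := hσ')).2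
      (hb a z ((mem_lev (h := hτ')).1 ha) ((mem_lev (h := hκ)).1 hz) hDz)) a z (by
      show _ ∈ (l (lev τ hτ')).1
      rwa [h.map_lev, mem_lev]) (by
      show _ ∈ (l (lev κ hκ)).1
      rwa [h.map_lev, mem_lev]) hDz
  change z.1 ∈ (l (lev σ hσ')).1 at this
  rw [h.map_lev, mem_lev] at this
  exact (hθ _).2 ⟨σ, hσ, this⟩

theorem rank_pair_le {x y : ZFSet.{u}} {σ : Ordinal.{u}} (hx : x.rank < σ) (hy : y.rank < σ) :
    (ZFSet.pair x y).rank ≤ Order.succ σ := by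
  simp only [ZFSet.pair, ZFSet.rank_pair, ZFSet.rank_singleton]
  simp only [max_le_iff, Order.succ_le_iff, max_lt_iff, Order.succ_lt_succ_iff]
  exact ⟨hx, hx, hy⟩

theorem FODef.eqPairPair {ι κ : Type} (i j k m : ι) :
    FODef (lam := lam) (κ := κ) fun x _ => x i = pair (pair (x j) (x k)) (x m) :=
  (ex (Q := fun x _ p => p = pair (x j) (x k) ∧ x i = pair p (x m))
    ((eqPair none (some j) (some k)).and (eqPair (some i) none (some m)))).congr
      fun _ _ => by simp

/-- The relation with value `e(a)` at `(a, x)`, where `e` is the value at `x` of the relation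
`D`. -/
def uncurry (D : Set (VRank lam)) : Set (VRank lam) :=
  {w | ∃ a x z e : VRank lam, w = pair (pair a x) z ∧ pair x e ∈ D ∧ (pair a z).1 ∈ e.1 ∧
    Functional {w : VRank lam | w.1 ∈ e.1}}

theorem functional_uncurry {D : Set (VRank lam)} (hD : Functional D) : Functional (uncurry D) := by
  rintro p z z' ⟨a, x, y, e, h1, h2, h3, h4⟩ ⟨a', x', y', e', h1', h2', h3', h4'⟩
  rw [pair_inj] at h1 h1'
  obtain ⟨rfl, rfl⟩ := h1
  obtain ⟨h, rfl⟩ := h1'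
  obtain ⟨rfl, rfl⟩ := pair_inj.1 h
  obtain rfl := hD _ _ _ h2 h2'
  exact h4 _ _ _ h3 h3'

theorem Good.ext_uncurry (hc : CofOmega lam) {l : VRank lam → VRank lam} (g : Good l)
    (D : Set (VRank lam)) : extendEmb l (uncurry D) = uncurry (extendEmb l D) := by
  exact Set.ext fun w => (g.iff hc (P := fun (_ : Fin 0 → VRank lam)
    (X : Fin 2 → Set (VRank lam)) => ∀ w, w ∈ X 0 ↔ ∃ a x z e : VRank lam, w = pair (pair a x) z ∧
      pair x e ∈ X 1 ∧ (pair a z).1 ∈ e.1 ∧ Functional {w : VRank lam | w.1 ∈ e.1})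
    (FODef.all ((FODef.pred 0 none).iff (FODef.ex (FODef.ex (FODef.ex (FODef.ex
      ((FODef.eqPairPair (some (some (some (some none)))) (some (some (some none)))
        (some (some none)) (some none)).and ((FODef.pairPred 1 (some (some none)) none).and
        ((FODef.pairMem (some (some (some none))) (some none) none).and
          (FODef.functional_coe none))))))))) ) nofun ![uncurry D, D]).1 (fun w => Iff.rfl) w

/-- The hypothesis on $l$ is used twice. Some $\sigma<\theta$ has $h(\sigma)\ge\theta$; since $h$
itself is a function in the range of $l$, even $h(\sigma)\ge\nu$. Hence a value below $\nu$ of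
$h\cdot D$ at $a\in V_\theta$ is a value of $h(c)$ for a part $c\subseteq V_\sigma\times V_\sigma$
of $D$. Now $c$ has rank below $\theta$, and $(a,c)\mapsto h(c)(a)$ is again a function in the range
of $l$ (`Good.ext_uncurry`). -/
theorem Avoids.of_graph (hc : CofOmega lam) {l h : VRank lam → VRank lam} (g : Good l)
    (gh : Good h) (hne : h ≠ id) {θ ν : Ordinal.{u}} (hθ : Order.IsSuccLimit θ) (hθl : θ < lam)
    (A : Avoids l θ ν) {B : Set (VRank lam)} (e : extendEmb l B = graphEmb h)
    (hcrit : critPt h < θ) : Avoids h θ ν := by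
  intro D hD a z ha hz hDz
  have hh := gh.elem hc
  have hB : Functional B := by
    rw [g.functional_iff hc, e]
    intro a z z' h1 h2
    rw [pair_mem_graphEmb] at h1 h2
    rw [h1, h2]
  obtain ⟨σ, hσ, hσθ⟩ := hh.exists_le_ordMap hne hθl hcrit
  have hσl := hσ.trans hθl
  have hν : ν ≤ ordMap h σ := by
    by_contra! hlt
    refine (A B hB (lev σ hσl) (h (lev σ hσl)) (by simpa [lev] using hσ) ?_ ?_).not_ge ?_
    · rw [hh.map_lev]; simpa [lev] using hlt
    · rw [e, pair_mem_graphEmb]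
    · rw [hh.map_lev]; simpa [lev] using hσθ
  obtain ⟨d, hd, hdz⟩ := gh.mem_ext.1 hDz
  let c := sep d fun w => ∃ x y : VRank lam, x.1 ∈ (lev σ hσl).1 ∧ y.1 ∈ (lev σ hσl).1 ∧ w = pair x y
  have hcr : c.1.rank < θ := by
    refine lt_of_le_of_lt ?_ (hθ.succ_lt (hθ.succ_lt hσ))
    rw [ZFSet.rank_le_iff]
    intro w hw
    obtain ⟨w, rfl⟩ : ∃ w' : VRank lam, w'.1 = w := ⟨⟨w, ZFSet.mem_vonNeumann.2 ((ZFSet.rank_lt_of_mem hw).trans c.rank_lt)⟩, rfl⟩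
    obtain ⟨-, x, y, hx, hy, rfl⟩ := mem_sep.1 hw
    exact Order.lt_succ_iff.2 (rank_pair_le (mem_lev.1 hx) (mem_lev.1 hy))
  have hcf : Functional {w : VRank lam | w.1 ∈ (h c).1} := by
    refine (hh.iff₁ (R := fun c => Functional {w : VRank lam | w.1 ∈ c.1}) (FODef.functional_coe 0) c).1 ?_
    exact fun a z z' h1 h2 => hD a z z' (hd _ (mem_sep.1 h1).1) (hd _ (mem_sep.1 h2).1)
  have hcz : (pair a z).1 ∈ (h c).1 := by
    refine ((hh.iff₃ (R := fun c d v => ∀ w : VRank lam, w.1 ∈ c.1 ↔ w.1 ∈ d.1 ∧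
      ∃ x y : VRank lam, x.1 ∈ v.1 ∧ y.1 ∈ v.1 ∧ w = pair x y) (FODef.all
        ((FODef.mem none (some 0)).iff ((FODef.mem none (some 1)).and (FODef.ex (FODef.ex
          ((FODef.mem (some none) (some (some (some 2)))).and
            ((FODef.mem none (some (some (some 2)))).and
              (FODef.eqPair (some (some none)) (some none) none)))))))) c d (lev σ hσl)).1
      (fun w => mem_sep) (pair a z)).2 ⟨hdz, a, z, ?_, ?_, rfl⟩
    · rw [hh.map_lev, mem_lev]; exact ha.trans_le hσθ
    · rw [hh.map_lev, mem_lev]; exact hz.trans_le hν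
  refine A _ (functional_uncurry hB) (pair a c) z (rank_pair_lt hθ ha hcr) hz ?_
  rw [g.ext_uncurry hc, e]
  exact ⟨a, c, z, h c, rfl, pair_mem_graphEmb.2 rfl, hcz, hcf⟩

/-- The set $l(x)$ is the value at $\emptyset$ of the image of the one-point function
$\{(\emptyset,x)\}$. -/
theorem Avoids.rank_lt (hc : CofOmega lam) {l : VRank lam → VRank lam} (g : Good l)
    {θ ν : Ordinal.{u}} (hθ : 0 < θ) (A : Avoids l θ ν) {x : VRank lam}
    (hx : (l x).1.rank < ν) : (l x).1.rank < θ := by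
  have h0 : (lev 0 hl.out.pos : VRank lam).1.rank = 0 := by simp [lev]
  have h1 : l (lev 0 hl.out.pos) = lev 0 hl.out.pos := by
    rw [(g.elem hc).map_lev, lev_inj]
    simpa using (g.elem hc).ordMap_natCast 0
  refine A {pair (lev 0 hl.out.pos) x} ?_ (lev 0 hl.out.pos) (l x) (by rwa [h0]) hx ?_
  · rintro a z z' h h'
    rw [Set.mem_singleton_iff, pair_inj] at h h'
    rw [h.2, h'.2]
  · rw [g.ext_singleton, g.map_pair, h1]; rfl

theorem Elem.isSuccLimit_critPt {j : VRank lam → VRank lam} (hj : Elem j) (hne : j ≠ id) :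
    Order.IsSuccLimit (critPt j) := by
  obtain ⟨h1, h2, h3⟩ := hj.critPt_spec hne
  refine ⟨fun h => ?_, Order.isSuccPrelimit_of_succ_ne fun α hα => ?_⟩
  · rw [isMin_iff_eq_bot.1 h] at h2
    have := hj.ordMap_natCast 0
    rw [Nat.cast_zero] at this
    exact h2.ne' this
  · have hα' : α < critPt j := hα ▸ Order.lt_succ α
    rw [← hα, hj.ordMap_succ (hα'.trans h1), h3 α hα'] at h2
    exact h2.false

theorem Elem.exists_sup {l : VRank lam → VRank lam} (h : Elem l) {κ : Ordinal.{u}}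
    (hκ : Order.IsSuccLimit κ) (hκl : κ < lam) :
    ∃ θ, (∀ ρ, ρ < θ ↔ ∃ σ < κ, ρ < ordMap l σ) ∧ Order.IsSuccLimit θ ∧ κ ≤ θ ∧
      θ ≤ ordMap l κ := by
  have hbdd : BddAbove (ordMap l '' Set.Iio κ) := ⟨ordMap l κ, by
    rintro _ ⟨σ, hσ, rfl⟩
    exact ((h.ordMap_lt_iff (lt_trans hσ hκl) hκl).2 hσ).le⟩
  have hθ : ∀ ρ, ρ < sSup (ordMap l '' Set.Iio κ) ↔ ∃ σ < κ, ρ < ordMap l σ := fun ρ => by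
    rw [lt_csSup_iff hbdd ⟨_, 0, hκ.pos, rfl⟩]
    simp
  have hle : κ ≤ sSup (ordMap l '' Set.Iio κ) := le_of_forall_lt fun σ hσ =>
    (hθ σ).2 ⟨Order.succ σ, hκ.succ_lt hσ,
      (Order.lt_succ σ).trans_le (h.le_ordMap ((hκ.succ_lt hσ).trans hκl))⟩
  refine ⟨_, hθ, ⟨fun hmin => ?_, Order.isSuccPrelimit_of_succ_lt fun ρ hρ => ?_⟩, hle,
    le_of_forall_lt fun ρ hρ => ?_⟩
  · exact (hκ.pos.trans_le hle).ne' (isMin_iff_eq_bot.1 hmin)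
  · obtain ⟨σ, hσ, hρ⟩ := (hθ ρ).1 hρ
    refine (hθ _).2 ⟨Order.succ σ, hκ.succ_lt hσ, ?_⟩
    rw [h.ordMap_succ (hσ.trans hκl)]
    exact Order.succ_lt_succ hρ
  · obtain ⟨σ, hσ, hρ⟩ := (hθ ρ).1 hρ
    exact hρ.trans ((h.ordMap_lt_iff (hσ.trans hκl) hκl).2 hσ)

theorem elem_of_mem_irng {l h : VRank lam → VRank lam} (hh : h ∈ irng l) : Elem h := by
  obtain ⟨n, hn⟩ := Set.mem_iUnion.1 hh
  cases n with
  | zero => exact hn.1.1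
  | succ n =>
    obtain ⟨f, -, hf⟩ := Set.mem_iUnion₂.1 hn
    exact hf.1.1

/-- Each passage to an embedding in the range loses only the indices $s$ for which $\theta_s$ does
not exceed its critical point, and these are bounded. -/
theorem avoids_of_mem_irng (hc : CofOmega lam) {l : VRank lam → VRank lam} (g : Good l)
    {θ ν : ℕ → Ordinal.{u}} (hθ : ∀ s, Order.IsSuccLimit (θ s)) (hθl : ∀ s, θ s < lam)
    (hθc : ∀ α < lam, ∃ N, ∀ s, N ≤ s → α < θ s) (A : ∀ s, Avoids l (θ s) (ν s))
    {h : VRank lam → VRank lam} (hh : h ∈ irng l) : ∃ N, ∀ s, N ≤ s → Avoids h (θ s) (ν s) := by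
  have key : ∀ {f h : VRank lam → VRank lam}, Good f → (∃ N, ∀ s, N ≤ s → Avoids f (θ s) (ν s)) →
      h ∈ irngZero f → ∃ N, ∀ s, N ≤ s → Avoids h (θ s) (ν s) := by
    rintro f h gf ⟨N, hN⟩ ⟨⟨he, hne⟩, B, e⟩
    obtain ⟨N', hN'⟩ := hθc _ (Elem.critPt_spec he hne).1
    exact ⟨max N N', fun s hs => (hN s (by omega)).of_graph hc gf (Elem.good he) hne (hθ s) (hθl s)
      e (hN' s (by omega))⟩
  obtain ⟨n, hn⟩ := Set.mem_iUnion.1 hh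
  induction n generalizing h with
  | zero => exact key g ⟨0, fun s _ => A s⟩ hn
  | succ n ih =>
    obtain ⟨f, hf, hn⟩ := Set.mem_iUnion₂.1 hn
    have hf' := Set.mem_iUnion.2 ⟨n, hf⟩
    exact key (elem_of_mem_irng hf').good (ih hf' hf) hn

/-! ### Disjointness of the iterated ranges -/

section RightPowers

variable {j : VRank lam → VRank lam} {r : ℕ → VRank lam → VRank lam}
  (hj : Elem j) (hne : j ≠ id) (hr : IsRightPowers j r) (g : ∀ n, Good (r n))

include hj hne hr g

/-- The discontinuity of $K$ at $\kappa_{s+t}$: the image of $\kappa_{s+t}$ is $\kappa_{2s+t+1}$,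
while the images of smaller ordinals stay below $\kappa_{2s+t}$. -/
theorem gap_of_mem_irng {t : ℕ} {K : VRank lam → VRank lam} (hK : Lim (fun n => r (n + t)) K)
    {h : VRank lam → VRank lam} (hh : h ∈ irng K) : ∃ N, ∀ s, N ≤ s → ∀ x : VRank lam,
      (h x).1.rank < critSeq j (s + t + (s + 1)) → (h x).1.rank < critSeq j (s + t + s) := by
  have hc := hj.cofOmega hne
  have gK := hK.good hc fun n => g _
  have hKe := gK.elem hc
  have hmono := hj.critSeq_strictMono hne
  have hex := fun s => hKe.exists_sup (κ := critSeq j (s + t)) (by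
    rw [← critPt_rightPowers hj hne hr g]
    exact ((g _).elem hc).isSuccLimit_critPt (rightPowers_mem hj hne hr g _).2)
    (hj.critSeq_lt hne _)
  choose θ hθ hlim hle hθl using hex
  obtain ⟨N, hN⟩ := avoids_of_mem_irng hc gK hlim
    (fun s => (hθl s).trans_lt (ordMap_lt K (hj.critSeq_lt hne _))) (fun α hα => by
      obtain ⟨N, hN⟩ := hj.exists_lt_critSeq hne hα
      exact ⟨N, fun s hs => hN.trans_le
        ((hmono.monotone (show N ≤ s + t by omega)).trans (hle s))⟩)
    (fun s => gK.avoids hc (g (s + t)) (hj.critSeq_lt hne _)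
      (rightPowers_spec hj hne hr g _).1 (rightPowers_lt_ordMap hj hne hr g _) (hθ s)) hh
  have gh := (elem_of_mem_irng hh).good
  refine ⟨N, fun s hs x hx => ?_⟩
  rw [← ordMap_lim_rightPowers hj hne hr g (s := s + t) (by omega) hK] at hx
  obtain ⟨σ, hσ, hxσ⟩ := (hθ s _).1 ((hN s hs).rank_lt hc gh (hlim s).pos hx)
  have hσl := hσ.trans (hj.critSeq_lt hne _)
  refine hxσ.trans ?_
  have := rank_lim_rightPowers_lt hj hne hr g (s := s + t) (d := s) (by omega) hK (x := lev σ hσl)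
    (by simpa [lev] using hσ)
  rw [hKe.map_lev] at this
  simpa [lev] using this

theorem irng_disjoint {k l : VRank lam → VRank lam} (hk : Lim r k)
    (hl' : Lim (fun n => r (n + 1)) l) : irng k ∩ irng l = ∅ := by
  have hc := hj.cofOmega hne
  refine Set.eq_empty_of_forall_notMem fun h hh => ?_
  obtain ⟨N, hN⟩ := gap_of_mem_irng hj hne hr g (t := 0) hk hh.1
  obtain ⟨N', hN'⟩ := gap_of_mem_irng hj hne hr g (t := 1) hl' hh.2
  have hmono := hj.critSeq_strictMono hne
  -- An even $i=2s$ is a gap for `k`, an odd $i=2s+1$ a gap for `l`.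
  have hstep : ∀ i, 2 * (N + N') + 1 ≤ i → ∀ x : VRank lam, (h x).1.rank < critSeq j (i + 1) →
      (h x).1.rank < critSeq j i := by
    intro i hi x hx
    rcases Nat.even_or_odd' i with ⟨s, rfl | rfl⟩
    · rw [show 2 * s = s + 0 + s by ring]
      exact hN s (by omega) x (by rwa [show s + 0 + (s + 1) = 2 * s + 1 by ring])
    · rw [show 2 * s + 1 = s + 1 + s by ring]
      exact hN' s (by omega) x (by rwa [show s + 1 + (s + 1) = 2 * s + 1 + 1 by ring])
  have he := elem_of_mem_irng hh.1
  have hM := hj.critSeq_lt hne (2 * (N + N') + 1)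
  obtain ⟨n, hn⟩ := hj.exists_lt_critSeq hne (h (lev _ hM)).rank_lt
  -- Descending through the gaps would put the image of a level below that level.
  have hdown : ∀ d, (h (lev _ hM)).1.rank < critSeq j (2 * (N + N') + 1 + d) → False := by
    intro d
    induction d with
    | zero =>
      refine not_lt_of_ge ?_
      rw [he.map_lev]
      simpa [lev] using he.le_ordMap hM
    | succ d ih => exact fun hd => ih (hstep _ (by omega) _ hd)
  exact hdown n (hn.trans_le (hmono.monotone (by omega)))

end RightPowers

end VRank

theorem theorem23 (lam : Ordinal.{u}) (hlam : Order.IsSuccLimit lam) (m : ℕ)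
    (j : VRank lam → VRank lam) (hj : j ∈ RankEmb lam) (hjm : SigmaElementary m j) :
    ∃ (r : ℕ → VRank lam → VRank lam) (k l : VRank lam → VRank lam),
      IsRightPowers j r ∧
      IsInverseLimit r k ∧
      IsInverseLimit (fun n => r (n + 1)) l ∧
      k ∈ RankEmb lam ∧ SigmaElementary m k ∧
      l ∈ RankEmb lam ∧ SigmaElementary m l ∧
      irng k ∩ irng l = ∅ := by
  have : Fact (Order.IsSuccLimit lam) := ⟨hlam⟩
  obtain ⟨he, hne⟩ := hj
  replace he : VRank.Elem j := he
  have hc := he.cofOmega hne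
  obtain ⟨r, hr, g⟩ := he.exists_isRightPowers hc
  have c := VRank.chain_rightPowers he hne hr g
  obtain ⟨k, hk⟩ := (c.shift 0).exists_lim
  obtain ⟨l, hl⟩ := (c.shift 1).exists_lim
  have hmem : ∀ {t : ℕ} {K : VRank lam → VRank lam}, t ≤ 1 →
      VRank.Lim (fun n => r (n + t)) K → K ∈ RankEmb lam := by
    intro t K ht hK
    refine ⟨(hK.good hc fun n => g _).elem hc, ?_⟩
    rintro rfl
    -- The ordinal $\kappa_1$ serves both limits: it is moved to $\kappa_{3-t}$ for $t\le 1$.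
    have h1 := VRank.ordMap_lim_rightPowers he hne hr g (s := 1) (d := 2 - t) (by omega) hK
    have h2 := VRank.ordMap_eq_of_map_lev (j := id) (he.critSeq_lt hne 1) (he.critSeq_lt hne 1) rfl
    exact (he.critSeq_strictMono hne (show 1 < 1 + (2 - t) by omega)).ne (h2.symm.trans h1)
  exact ⟨r, k, l, hr, VRank.isInverseLimit_rightPowers he hne hr g 0 hk,
    VRank.isInverseLimit_rightPowers he hne hr g 1 hl, hmem (by omega) hk,
    VRank.sigmaElementary_lim_rightPowers he hne hr g hjm hk, hmem le_rfl hl,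
    VRank.sigmaElementary_lim_rightPowers he hne hr g hjm hl,
    VRank.irng_disjoint he hne hr g hk hl⟩
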